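/- \textbf{Setting.} Finitely many threads $1,\dots,n$ run asynchronously over a sequentially consistent shared memory. An execution is a finite interleaving, starting from the initial configuration, of atomic steps, each of which makes at most one access (read, write, fetch\&increment, test\&set or compare-and-swap) to shared memory. An idle thread may invoke any of the operations $\mathrm{Push}(v)$, $\mathrm{Pop}()$, $\mathrm{Peek}()$ at any time. Objects that are allocated are new; addresses are not reused, and counters do not overflow. There are $K$ aggregators, every thread $t$ is assigned to a fixed aggregator $A(t)$, and at most $P$ threads are assigned to each aggregator. \textbf{The algorithm SEC.} A node has fields $value$ and $next$. A batch has integer fields $pushCount$, $popCount$, $pushCountAtFreeze$, $popCountAtFreeze$ (initially $0$), an array $elim[0..P-1]$ of node pointers and a node pointer $subStackTop$ (initially null), and booleans $isFreezerDecided$, $isBatchApplied$ (initially false). Each aggregator holds a pointer $batch$, initially to a new batch of its own. The shared pointer $stackTop$ is initially null. $\mathrm{Push}(v)$, by a thread of aggregator $A$: allocate a node $x$ with value $v$ and next null. Repeat: (1) $B\gets A.batch$; (2) $i\gets$ fetch\&increment$(B.pushCount)$; (3) $B.elim[i]\gets x$; (4) if $i=0$ and test\&set$(B.isFreezerDecided)$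 returns false, then freeze $B$, i.e. execute $B.popCountAtFreeze\gets B.popCount$; $B.pushCountAtFreeze\gets B.pushCount$; $A.batch\gets$ a new batch; otherwise wait until $A.batch\ne B$; (5) if $i\ge B.pushCountAtFreeze$, start again from (1); (6) if $i<B.popCountAtFreeze$, return TRUE; (7) if $i=B.popCountAtFreeze$, execute PushToStack$(B,i)$, set $B.isBatchApplied\gets$ true and return TRUE; otherwise wait until $B.isBatchApplied$ and return TRUE. PushToStack$(B,i)$: $bot\gets B.elim[i]$; $top\gets bot$; for each $j=i+1,i+2,\dots$ with $j<B.pushCountAtFreeze$, wait until $B.elim[j]$ is not null, then $y\gets B.elim[j]$; $y.next\gets top$; $top\gets y$. Then repeat $s\gets stackTop$; $bot.next\gets s$; CAS$(stackTop,s,top)$ until the CAS succeeds. $\mathrm{Pop}()$, by a thread of aggregator $A$: repeat: (1) $B\gets A.batch$; (2) $i\gets$ fetch\&increment$(B.popCount)$; (3) as in (4) of Push; (4) if $i\ge B.popCountAtFreeze$, start again from (1); (5) if $i<B.pushCountAtFreeze$, wait until $B.elim[i]$ is not null and return $B.elim[i].value$; (6) if $i=B.pushCountAtFreeze$, execute PopFromStack$(B,i)$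 and set $B.isBatchApplied\gets$ true; otherwise wait until $B.isBatchApplied$; (7) $k\gets i-B.pushCountAtFreeze$; $y\gets B.subStackTop$; $k$ times: if $y$ is null return EMPTY, else $y\gets y.next$; finally return EMPTY if $y$ is null and $y.value$ otherwise. PopFromStack$(B,i)$: repeat $top\gets stackTop$; $bot\gets top$; for each $j=i,i+1,\dots$ with $j<B.popCountAtFreeze$, if $bot$ is null stop this inner loop, else $bot\gets bot.next$; CAS$(stackTop,top,bot)$; until the CAS succeeds. Then $B.subStackTop\gets top$. $\mathrm{Peek}()$: $y\gets stackTop$; return EMPTY if $y$ is null and $y.value$ otherwise. \textbf{Theorem.} SEC is a linearizable stack implementation. That is, no execution dereferences an invalid pointer or accesses an array out of bounds, and for the history $H$ (the sequence of invocations and responses) of every execution there is a sequence $S$ of distinct operations of $H$, each with a response, such that (a) $S$ contains every completed operation of $H$ with its response in $H$, and possibly some pending operations; (b) if an operation responds in $H$ before another one is invoked, then the second does not precede the first in $S$; (c) $S$ is a run of the sequential stack that is initially empty, in which Push puts its value on top and returns TRUE, Pop removes and returns the top value, Peek returns the top value without removing it, and both return EMPTY on the empty stack. -/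

import Mathlib

/-! # Histories and linearizability -/

namespace ConcObj

/-- An event of a history: an invocation or a response of an operation by a thread. -/
inductive Event (T Op Ret : Type*) where
  | inv (t : T) (o : Op)
  | res (t : T) (r : Ret)

/-- Position `i` of `h` is an invocation, and position `j` is its matching response, with
value `r`: the first later response of the same thread. -/
def Completes {T Op Ret : Type*} (h : List (Event T Op Ret)) (i j : ℕ) (r : Ret) : Prop :=
  ∃ t o, h[i]? = some (.inv t o) ∧ i < j ∧ h[j]? = some (.res t r) ∧
    ∀ k r', i < k → k < j → h[k]? ≠ some (.res t r')

/-- Real-time order: the operation invoked at position `i` responds before the invocation at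
position `i'`. -/
def Precedes {T Op Ret : Type*} (h : List (Event T Op Ret)) (i i' : ℕ) : Prop :=
  ∃ j r, Completes h i j r ∧ j < i'

/-- A sequence of operations with responses is a run, from state `s`, of the sequential object
with transition function `δ`. -/
def Legal {σ Op Ret : Type*} (δ : σ → Op → σ × Ret) : σ → List (Op × Ret) → Prop
  | _, [] => True
  | s, (o, r) :: l => (δ s o).2 = r ∧ Legal δ (δ s o).1 l

/-- An entry of a linearization: an operation of the history, named by the position of its
invocation, with the response assigned to it. -/
structure Entry (Op Ret : Type*) where
  pos : ℕ
  op : Op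
  ret : Ret

/-- A history `h` is linearizable with respect to the sequential object with transition function
`δ` and initial state `s₀`: there is a sequence `S` of distinct operations of `h` that contains
every completed operation with the response it has in `h`, and possibly pending operations with
some response, that respects the real-time order of `h`, and that is legal. -/
def Linearizable {σ T Op Ret : Type*} (δ : σ → Op → σ × Ret) (s₀ : σ)
    (h : List (Event T Op Ret)) : Prop :=
  ∃ S : List (Entry Op Ret),
    (S.map Entry.pos).Nodup ∧
    (∀ e ∈ S, ∃ t, h[e.pos]? = some (.inv t e.op)) ∧
    (∀ i j r, Completes h i j r → ∃ e ∈ S, e.pos = i ∧ e.ret = r) ∧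
    S.Pairwise (fun e e' => ¬ Precedes h e'.pos e.pos) ∧
    Legal δ s₀ (S.map fun e => (e.op, e.ret))

end ConcObj

/-! # The sequential stack -/

namespace SEC

/-- Operations of the stack. -/
inductive Op (V : Type*) where
  | push (v : V)
  | pop
  | peek

/-- Responses: `true` (of a push), a value, or `EMPTY`. -/
inductive Ret (V : Type*) where
  | tt
  | val (v : V)
  | empty

/-- The sequential stack; the head of the list is the top. -/
def stackSpec {V : Type*} : List V → Op V → List V × Ret V
  | s, .push v => (v :: s, .tt)
  | [], .pop => ([], .empty)
  | v :: s, .pop => (s, .val v)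
  | [], .peek => ([], .empty)
  | v :: s, .peek => (v :: s, .val v)

/-! # Shared memory of the algorithm -/

/-- Pointers to nodes are `Option ℕ`, with `none` for null. -/
structure Node (V : Type*) where
  value : V
  next : Option ℕ

/-- A batch, with an elimination array of `P` slots. -/
structure Batch (P : ℕ) where
  pushCount : ℕ
  popCount : ℕ
  pushCountAtFreeze : ℕ
  popCountAtFreeze : ℕ
  eliminationArray : Fin P → Option ℕ
  subStackTop : Option ℕ
  isFreezerDecided : Bool
  isBatchApplied : Bool

/-- `CreateNewBatch(0,0,0,0,{0},⊥,FALSE,FALSE)`. -/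
def Batch.new (P : ℕ) : Batch P := ⟨0, 0, 0, 0, fun _ => none, none, false, false⟩

/-- Slot `i` of the elimination array; `none` if `i` is out of bounds. -/
def Batch.slot {P : ℕ} (B : Batch P) (i : ℕ) : Option (Option ℕ) :=
  if hi : i < P then some (B.eliminationArray ⟨i, hi⟩) else none

/-- Shared memory. Nodes live at the addresses below `numNodes` and batches at the addresses below
`numBatches`; allocation takes the next address, and addresses are never reused.
`agg a` is the field `batch` of aggregator `a`. -/
structure Mem (V : Type*) (K P : ℕ) where
  nodes : ℕ → Option (Node V)
  numNodes : ℕ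
  batches : ℕ → Batch P
  numBatches : ℕ
  agg : Fin K → ℕ
  stackTop : Option ℕ

/-- Initially the shared stack is empty and every aggregator points to a fresh batch of its own. -/
def Mem.start (V : Type*) (K P : ℕ) : Mem V K P where
  nodes := fun _ => none
  numNodes := 0
  batches := fun _ => Batch.new P
  numBatches := K
  agg := fun a => a
  stackTop := none

/-- Modify the batch at address `b`. -/
def Mem.modBatch {V : Type*} {K P : ℕ} (m : Mem V K P) (b : ℕ) (f : Batch P → Batch P) :
    Mem V K P :=
  { m with batches := Function.update m.batches b (f (m.batches b)) }

/-! # The program -/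

/-- The code that `Push` and `Pop` have in common is run on behalf of a push whose node is at
address `x`, or of a pop. -/
inductive Caller where
  | push (x : ℕ)
  | pop

/-- Control states of a thread, with the values of its local variables: `b` is `myBatch`, `i` is
`mySeqNum`, `x` is `myNode`. -/
inductive PC (V : Type*) where
  /-- no operation in progress -/
  | idle
  /-- about to respond -/
  | ret (r : Ret V)
  /-- a null or dangling pointer was dereferenced, or an array index was out of bounds -/
  | fault
  -- `Push` and `Pop`: joining a batch and freezing it
  | pushAlloc (v : V)
  | getBatch (c : Caller)
  | announce (c : Caller) (b : ℕ)
  | pushWrite (x b i : ℕ)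
  | freezerTest (c : Caller) (b i : ℕ)
  | freezeReadPop (c : Caller) (b i : ℕ)
  | freezeWritePop (c : Caller) (b i r : ℕ)
  | freezeReadPush (c : Caller) (b i : ℕ)
  | freezeWritePush (c : Caller) (b i r : ℕ)
  | freezeNewBatch (c : Caller) (b i : ℕ)
  | freezeWait (c : Caller) (b i : ℕ)
  | inclusionTest (c : Caller) (b i : ℕ)
  -- `Push`: elimination and combining
  | pushElimTest (b i : ℕ)
  | pushCombinerTest (b i : ℕ)
  | pushApplied (b : ℕ)
  | pushWaitApplied (b : ℕ)
  -- `PushToStack`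
  | ptsInit (b i : ℕ)
  | ptsLoop (b i : ℕ) (top bot : Option ℕ)
  | ptsWait (b i : ℕ) (top bot : Option ℕ)
  | ptsRead (b i : ℕ) (top bot : Option ℕ)
  | ptsLink (b i : ℕ) (tempNode top bot : Option ℕ)
  | ptsReadTop (b : ℕ) (top bot : Option ℕ)
  | ptsSetBot (b : ℕ) (top bot tempTop : Option ℕ)
  | ptsCAS (b : ℕ) (top bot tempTop : Option ℕ)
  -- `Pop`: elimination and combining
  | popElimTest (b i : ℕ)
  | popElimWait (b i : ℕ)
  | popElimRead (b i : ℕ)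
  | popElimValue (y : Option ℕ)
  | popCombinerTest (b i : ℕ)
  | popApplied (b i : ℕ)
  | popWaitApplied (b i : ℕ)
  -- `PopFromStack`; `j` is its loop counter
  | pfsReadTop (b i : ℕ)
  | pfsLoop (b i j : ℕ) (top bot : Option ℕ)
  | pfsNext (b i j : ℕ) (top bot : Option ℕ)
  | pfsCAS (b i : ℕ) (top bot : Option ℕ)
  | pfsPublish (b i : ℕ) (top : Option ℕ)
  -- `GetValue`; `k` is the number of remaining iterations
  | gvArg (b i : ℕ)
  | gvInit (b k : ℕ)
  | gvLoop (k : ℕ) (temp : Option ℕ)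
  -- `Peek`
  | peekTop
  | peekValue (y : Option ℕ)

/-- The first control state of an operation. -/
def startPC {V : Type*} : Op V → PC V
  | .push v => .pushAlloc v
  | .pop => .getBatch .pop
  | .peek => .peekTop

/-- One atomic step of a thread of aggregator `a`: at most one access to shared memory, followed
by local computation. A test in a waiting loop that fails leaves the configuration unchanged. -/
def next {V : Type*} {K P : ℕ} (a : Fin K) (m : Mem V K P) : PC V → Mem V K P × PC V
  | .idle => (m, .idle)
  | .ret r => (m, .ret r)
  | .fault => (m, .fault)
  -- myNode ← New Node(value, null)
  | .pushAlloc v =>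
      ({ m with
          nodes := Function.update m.nodes m.numNodes (some ⟨v, none⟩)
          numNodes := m.numNodes + 1 }, .getBatch (.push m.numNodes))
  -- myBatch ← myAgg.batch
  | .getBatch c => (m, .announce c (m.agg a))
  -- mySeqNum ← fetch&increment(myBatch.pushCount)
  | .announce (.push x) b =>
      (m.modBatch b fun B => { B with pushCount := B.pushCount + 1 },
        .pushWrite x b (m.batches b).pushCount)
  -- mySeqNum ← fetch&increment(myBatch.popCount)
  | .announce .pop b =>
      (m.modBatch b fun B => { B with popCount := B.popCount + 1 },
        .freezerTest .pop b (m.batches b).popCount)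
  -- myBatch.eliminationArray[mySeqNum] ← myNode
  | .pushWrite x b i =>
      if hi : i < P then
        (m.modBatch b fun B =>
          { B with eliminationArray := Function.update B.eliminationArray ⟨i, hi⟩ (some x) },
          .freezerTest (.push x) b i)
      else (m, .fault)
  -- mySeqNum == 0 && !T&S(myBatch.isFreezerDecided)
  | .freezerTest c b i =>
      if i = 0 then
        (m.modBatch b fun B => { B with isFreezerDecided := true },
          if (m.batches b).isFreezerDecided then .freezeWait c b i else .freezeReadPop c b i)
      else (m, .freezeWait c b i)
  -- myBatch.popCountAtFreeze ← myBatch.popCount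
  | .freezeReadPop c b i => (m, .freezeWritePop c b i (m.batches b).popCount)
  | .freezeWritePop c b i r =>
      (m.modBatch b fun B => { B with popCountAtFreeze := r }, .freezeReadPush c b i)
  -- myBatch.pushCountAtFreeze ← myBatch.pushCount
  | .freezeReadPush c b i => (m, .freezeWritePush c b i (m.batches b).pushCount)
  | .freezeWritePush c b i r =>
      (m.modBatch b fun B => { B with pushCountAtFreeze := r }, .freezeNewBatch c b i)
  -- myAgg.batch ← CreateNewBatch(...)
  | .freezeNewBatch c b i =>
      ({ m with
          batches := Function.update m.batches m.numBatches (Batch.new P)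
          numBatches := m.numBatches + 1
          agg := Function.update m.agg a m.numBatches }, .inclusionTest c b i)
  -- while (myBatch == myAgg.batch) nop
  | .freezeWait c b i => (m, if b = m.agg a then .freezeWait c b i else .inclusionTest c b i)
  -- push: mySeqNum < myBatch.pushCountAtFreeze
  | .inclusionTest (.push x) b i =>
      (m, if i < (m.batches b).pushCountAtFreeze then .pushElimTest b i else .getBatch (.push x))
  -- pop: mySeqNum < myBatch.popCountAtFreeze
  | .inclusionTest .pop b i =>
      (m, if i < (m.batches b).popCountAtFreeze then .popElimTest b i else .getBatch .pop)
  -- push: mySeqNum ≥ myBatch.popCountAtFreeze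
  | .pushElimTest b i =>
      (m, if (m.batches b).popCountAtFreeze ≤ i then .pushCombinerTest b i else .ret .tt)
  -- push: mySeqNum == myBatch.popCountAtFreeze
  | .pushCombinerTest b i =>
      (m, if i = (m.batches b).popCountAtFreeze then .ptsInit b i else .pushWaitApplied b)
  -- myBatch.isBatchApplied ← TRUE; return TRUE
  | .pushApplied b => (m.modBatch b fun B => { B with isBatchApplied := true }, .ret .tt)
  -- while (!myBatch.isBatchApplied) nop; return TRUE
  | .pushWaitApplied b =>
      (m, if (m.batches b).isBatchApplied then .ret .tt else .pushWaitApplied b)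
  -- bot ← myBatch.eliminationArray[mySeqNum]; top ← bot
  | .ptsInit b i =>
      match (m.batches b).slot i with
      | none => (m, .fault)
      | some y => (m, .ptsLoop b i y y)
  -- while (++i < myBatch.pushCountAtFreeze)
  | .ptsLoop b i top bot =>
      (m, if i + 1 < (m.batches b).pushCountAtFreeze then .ptsWait b (i + 1) top bot
        else .ptsReadTop b top bot)
  -- while (!myBatch.eliminationArray[i]) nop
  | .ptsWait b i top bot =>
      match (m.batches b).slot i with
      | none => (m, .fault)
      | some none => (m, .ptsWait b i top bot)
      | some (some _) => (m, .ptsRead b i top bot)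
  -- tempNode ← myBatch.eliminationArray[i]
  | .ptsRead b i top bot =>
      match (m.batches b).slot i with
      | none => (m, .fault)
      | some y => (m, .ptsLink b i y top bot)
  -- tempNode.next ← top; top ← tempNode
  | .ptsLink b i tempNode top bot =>
      match tempNode with
      | none => (m, .fault)
      | some y =>
        match m.nodes y with
        | none => (m, .fault)
        | some N =>
            ({ m with nodes := Function.update m.nodes y (some { N with next := top }) },
              .ptsLoop b i (some y) bot)
  -- tempTop ← stackTop
  | .ptsReadTop b top bot => (m, .ptsSetBot b top bot m.stackTop)
  -- bot.next ← tempTop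
  | .ptsSetBot b top bot tempTop =>
      match bot with
      | none => (m, .fault)
      | some y =>
        match m.nodes y with
        | none => (m, .fault)
        | some N =>
            ({ m with nodes := Function.update m.nodes y (some { N with next := tempTop }) },
              .ptsCAS b top bot tempTop)
  -- CAS(stackTop, tempTop, top)
  | .ptsCAS b top bot tempTop =>
      if m.stackTop = tempTop then ({ m with stackTop := top }, .pushApplied b)
      else (m, .ptsReadTop b top bot)
  -- pop: mySeqNum < myBatch.pushCountAtFreeze
  | .popElimTest b i =>
      (m, if i < (m.batches b).pushCountAtFreeze then .popElimWait b i else .popCombinerTest b i)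
  -- while (!myBatch.eliminationArray[mySeqNum]) nop
  | .popElimWait b i =>
      match (m.batches b).slot i with
      | none => (m, .fault)
      | some none => (m, .popElimWait b i)
      | some (some _) => (m, .popElimRead b i)
  -- return myBatch.eliminationArray[mySeqNum].value
  | .popElimRead b i =>
      match (m.batches b).slot i with
      | none => (m, .fault)
      | some y => (m, .popElimValue y)
  | .popElimValue y =>
      match y.bind m.nodes with
      | none => (m, .fault)
      | some N => (m, .ret (.val N.value))
  -- pop: mySeqNum == myBatch.pushCountAtFreeze
  | .popCombinerTest b i =>
      (m, if i = (m.batches b).pushCountAtFreeze then .pfsReadTop b i else .popWaitApplied b i)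
  -- myBatch.isBatchApplied ← TRUE
  | .popApplied b i => (m.modBatch b fun B => { B with isBatchApplied := true }, .gvArg b i)
  -- while (!myBatch.isBatchApplied) nop
  | .popWaitApplied b i =>
      (m, if (m.batches b).isBatchApplied then .gvArg b i else .popWaitApplied b i)
  -- top ← stackTop; bot ← top; j ← mySeqNum
  | .pfsReadTop b i => (m, .pfsLoop b i i m.stackTop m.stackTop)
  -- while (j++ < myBatch.popCountAtFreeze)
  | .pfsLoop b i j top bot =>
      (m, if j < (m.batches b).popCountAtFreeze then .pfsNext b i (j + 1) top bot
        else .pfsCAS b i top bot)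
  -- if (bot == null) break; bot ← bot.next
  | .pfsNext b i j top bot =>
      match bot with
      | none => (m, .pfsCAS b i top bot)
      | some y =>
        match m.nodes y with
        | none => (m, .fault)
        | some N => (m, .pfsLoop b i j top N.next)
  -- CAS(stackTop, top, bot)
  | .pfsCAS b i top bot =>
      if m.stackTop = top then ({ m with stackTop := bot }, .pfsPublish b i top)
      else (m, .pfsReadTop b i)
  -- myBatch.subStackTop ← top
  | .pfsPublish b i top => (m.modBatch b fun B => { B with subStackTop := top }, .popApplied b i)
  -- return GetValue(myBatch, mySeqNum - myBatch.pushCountAtFreeze)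
  | .gvArg b i => (m, .gvInit b (i - (m.batches b).pushCountAtFreeze))
  -- temp ← myBatch.subStackTop
  | .gvInit b k => (m, .gvLoop k (m.batches b).subStackTop)
  -- after the loop: if (temp == null) return EMPTY; return temp.value
  | .gvLoop 0 temp =>
      match temp with
      | none => (m, .ret .empty)
      | some y =>
        match m.nodes y with
        | none => (m, .fault)
        | some N => (m, .ret (.val N.value))
  -- in the loop: if (temp == null) return EMPTY; temp ← temp.next
  | .gvLoop (k + 1) temp =>
      match temp with
      | none => (m, .ret .empty)
      | some y =>
        match m.nodes y with
        | none => (m, .fault)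
        | some N => (m, .gvLoop k N.next)
  -- top ← stackTop; if (top == null) return EMPTY
  | .peekTop => (m, if m.stackTop = none then .ret .empty else .peekValue m.stackTop)
  -- return top.value
  | .peekValue y =>
      match y.bind m.nodes with
      | none => (m, .fault)
      | some N => (m, .ret (.val N.value))

/-! # Executions -/

/-- A configuration of a system of `n` threads: shared memory and the state of every thread. -/
structure Config (V : Type*) (n K P : ℕ) where
  mem : Mem V K P
  pc : Fin n → PC V

/-- The initial configuration. -/
def Config.start (V : Type*) (n K P : ℕ) : Config V n K P := ⟨Mem.start V K P, fun _ => .idle⟩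

/-- `Execution asg s h`: some finite execution, in which thread `t` is assigned to aggregator
`asg t`, leads from the initial configuration to `s` and has history `h`. The steps of the threads
are interleaved arbitrarily; an idle thread may invoke any operation at any time. -/
inductive Execution {V : Type*} {n K P : ℕ} (asg : Fin n → Fin K) :
    Config V n K P → List (ConcObj.Event (Fin n) (Op V) (Ret V)) → Prop
  | start : Execution asg (Config.start V n K P) []
  | invoke {s : Config V n K P} {h : List (ConcObj.Event (Fin n) (Op V) (Ret V))}
      (t : Fin n) (o : Op V) :
      Execution asg s h → s.pc t = .idle →
      Execution asg ⟨s.mem, Function.update s.pc t (startPC o)⟩ (h ++ [.inv t o])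
  | step {s : Config V n K P} {h : List (ConcObj.Event (Fin n) (Op V) (Ret V))} (t : Fin n) :
      Execution asg s h →
      Execution asg ⟨(next (asg t) s.mem (s.pc t)).1,
        Function.update s.pc t (next (asg t) s.mem (s.pc t)).2⟩ h
  | respond {s : Config V n K P} {h : List (ConcObj.Event (Fin n) (Op V) (Ret V))}
      (t : Fin n) (r : Ret V) :
      Execution asg s h → s.pc t = .ret r →
      Execution asg ⟨s.mem, Function.update s.pc t .idle⟩ (h ++ [.res t r])

end SEC

/-!
# SEC is a linearizable stack

Every operation takes effect atomically at some step between its invocation and its response, and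
the order in which operations take effect is a linearization (`LinExec.linearizable`). The steps
are the following.

* Let `u` pushes and `w` pops be counted when a batch is frozen. The pushes and pops with sequence
  numbers below `min u w` eliminate each other. They take effect in pairs, the push `i` directly
  before the pop `i`, when the freezer replaces the batch of its aggregator
  (`Inv.linearize_eliminated`). Until then every thread that has announced an operation in the
  batch waits for the replacement, so that all of these operations are still pending.
* If `w < u`, the pushes `w, …, u - 1` take effect in this order when the push `w`, the combiner,
  succeeds with its CAS (`Inv.linearize_pushes`). The others wait for `isBatchApplied`.
* If `u < w`, the pops `u, …, w - 1` take effect in this order when the pop `u` succeeds with its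
  CAS (`Inv.linearize_pops`).
* A peek takes effect when it reads `stackTop`.

A node is published when a CAS makes it reachable from `stackTop`, and published nodes never change
afterwards. Hence a pointer to a published node determines the list of values below it for good
(`Chain.unique`, `Chain.mono`). This is why a CAS of a combiner for pops that finds the expected
`stackTop` removes what the combiner has traversed, even if `stackTop` has changed in the meantime,
and why later traversals from `subStackTop` find the stack as it was before that CAS.

The proof is an invariant `Inv` of configurations with auxiliary data `Ghost`: which operations are
announced in a batch, with which nodes, which nodes are published, what the stack contains, and
which operations have taken effect. It consists of an assertion for every control state (`PCInv`),
a part on the memory (`Global`), and the fact that a thread does not leave a batch as long as its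
operation there may still take effect. `Frame` collects what a step of one thread must preserve for
the assertions of the others. Since a thread announces at most one push in a batch, and only in
batches of its own aggregator, sequence numbers stay within the elimination array
(`Global.pushers_length_le`). The assertion for the control state `fault` is `False`.
-/

namespace ConcObj

/-! ### Operations that take effect atomically -/

/-- The progress of a thread: no operation in progress, an operation that has not taken effect
yet, or an operation that has taken effect with response `r` but has not responded. -/
inductive Status (Op Ret : Type*) where
  | idle
  | pending (o : Op)
  | done (r : Ret)

/-- Executions in which every operation takes effect atomically on a sequential object at some
moment between its invocation and its response. `LinExec δ s₀ h s l`: some such execution has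
history `h` and leads to state `s` of the object and to progress `l t` of every thread `t`. -/
inductive LinExec {σ T Op Ret : Type*} [DecidableEq T] (δ : σ → Op → σ × Ret) (s₀ : σ) :
    List (Event T Op Ret) → σ → (T → Status Op Ret) → Prop
  | start : LinExec δ s₀ [] s₀ (fun _ => .idle)
  | invoke {h : List (Event T Op Ret)} {s : σ} {l : T → Status Op Ret} (t : T) (o : Op) :
      LinExec δ s₀ h s l → l t = .idle →
      LinExec δ s₀ (h ++ [.inv t o]) s (Function.update l t (.pending o))
  | linearize {h : List (Event T Op Ret)} {s : σ} {l : T → Status Op Ret} (t : T) (o : Op) :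
      LinExec δ s₀ h s l → l t = .pending o →
      LinExec δ s₀ h (δ s o).1 (Function.update l t (.done (δ s o).2))
  | respond {h : List (Event T Op Ret)} {s : σ} {l : T → Status Op Ret} (t : T) (r : Ret) :
      LinExec δ s₀ h s l → l t = .done r →
      LinExec δ s₀ (h ++ [.res t r]) s (Function.update l t .idle)

section Linearization

variable {σ T Op Ret : Type*} {δ : σ → Op → σ × Ret} {s₀ : σ}

/-- A response of thread `t` occurs in `h` after position `i`. -/
def Answered (h : List (Event T Op Ret)) (t : T) (i : ℕ) : Prop :=
  ∃ k r, i < k ∧ h[k]? = some (.res t r)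

/-- Position `p` of `h` invokes the only operation of thread `t` that has not responded. -/
structure Current (h : List (Event T Op Ret)) (t : T) (p : ℕ) (o : Op) : Prop where
  inv : h[p]? = some (.inv t o)
  unanswered : ¬ Answered h t p
  old : ∀ i o', h[i]? = some (.inv t o') → i ≠ p → Answered h t i

/-- What the linearization `S` has to say about the progress of thread `t`. -/
def StatusOK (h : List (Event T Op Ret)) (S : List (Entry Op Ret)) (t : T) :
    Status Op Ret → Prop
  | .idle => ∀ i o, h[i]? = some (.inv t o) → Answered h t i
  | .pending o => ∃ p, Current h t p o ∧ p ∉ S.map Entry.pos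
  | .done r => ∃ p o, Current h t p o ∧ ∃ e ∈ S, e.pos = p ∧ e.ret = r

/-- `S` lists the operations of `h` that have taken effect, in the order in which they did. -/
structure Certificate (δ : σ → Op → σ × Ret) (s₀ : σ) (h : List (Event T Op Ret)) (s : σ)
    (l : T → Status Op Ret) (S : List (Entry Op Ret)) : Prop where
  nodup : (S.map Entry.pos).Nodup
  mem : ∀ e ∈ S, ∃ t, h[e.pos]? = some (.inv t e.op)
  complete : ∀ i j r, Completes h i j r → ∃ e ∈ S, e.pos = i ∧ e.ret = r
  order : S.Pairwise (fun e e' => ¬ Precedes h e'.pos e.pos)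
  legal : Legal δ s₀ (S.map fun e => (e.op, e.ret))
  state : S.foldl (fun s e => (δ s e.op).1) s₀ = s
  status : ∀ t, StatusOK h S t (l t)

theorem getElem?_concat_eq_some {α : Type*} {h : List α} {x y : α} {i : ℕ} :
    (h ++ [x])[i]? = some y ↔ h[i]? = some y ∨ (i = h.length ∧ x = y) := by
  rcases lt_trichotomy i h.length with hi | hi | hi
  · rw [List.getElem?_append_left hi]
    constructor
    · exact Or.inl
    · rintro (h1 | ⟨h1, -⟩)
      · exact h1
      · omega
  · subst hi
    simp
  · have h1 : (h ++ [x])[i]? = none := by simp; omega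
    have h2 : h[i]? = none := by simp; omega
    simp [h1, h2]
    omega

theorem lt_length_of_getElem?_eq_some {α : Type*} {h : List α} {y : α} {i : ℕ}
    (hi : h[i]? = some y) : i < h.length := by
  by_contra hc
  rw [List.getElem?_eq_none (by omega)] at hi
  cases hi

theorem Answered.concat {h : List (Event T Op Ret)} {t : T} {i : ℕ} (ha : Answered h t i)
    (x : Event T Op Ret) : Answered (h ++ [x]) t i := by
  obtain ⟨k, r, hk, hr⟩ := ha
  exact ⟨k, r, hk, getElem?_concat_eq_some.2 (Or.inl hr)⟩

theorem Completes.of_concat {h : List (Event T Op Ret)} {x : Event T Op Ret} {i j : ℕ} {r : Ret}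
    (hc : Completes (h ++ [x]) i j r) (hj : j < h.length) : Completes h i j r := by
  obtain ⟨t, o, h1, h2, h3, h4⟩ := hc
  rw [List.getElem?_append_left (by omega)] at h1
  rw [List.getElem?_append_left hj] at h3
  refine ⟨t, o, h1, h2, h3, fun k r' hk hk' h5 => h4 k r' hk hk' ?_⟩
  exact getElem?_concat_eq_some.2 (Or.inl h5)

/-- A new event at the end does not change the real-time order of the operations before it. -/
theorem Certificate.order_concat {h : List (Event T Op Ret)} {s : σ} {l : T → Status Op Ret}
    {S : List (Entry Op Ret)} (hS : Certificate δ s₀ h s l S) (x : Event T Op Ret) :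
    S.Pairwise (fun e e' => ¬ Precedes (h ++ [x]) e'.pos e.pos) := by
  refine hS.order.imp_of_mem ?_
  rintro e e' he - hn ⟨j, r, hc, hj⟩
  obtain ⟨t, ht⟩ := hS.mem e he
  have := lt_length_of_getElem?_eq_some ht
  exact hn ⟨j, r, hc.of_concat (by omega), hj⟩

/-- Events of one thread do not affect the progress of another. -/
theorem StatusOK.concat {h : List (Event T Op Ret)} {S : List (Entry Op Ret)} {t : T}
    {st : Status Op Ret} (hst : StatusOK h S t st) {x : Event T Op Ret}
    (hi : ∀ o, x ≠ .inv t o) (hr : ∀ r, x ≠ .res t r) : StatusOK (h ++ [x]) S t st := by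
  have cur : ∀ p o, Current h t p o → Current (h ++ [x]) t p o := by
    intro p o hc
    refine ⟨getElem?_concat_eq_some.2 (Or.inl hc.inv), ?_, ?_⟩
    · rintro ⟨k, r, hk, hkr⟩
      rcases getElem?_concat_eq_some.1 hkr with h1 | ⟨-, h1⟩
      · exact hc.unanswered ⟨k, r, hk, h1⟩
      · exact hr _ h1
    · intro i o' hio hne
      rcases getElem?_concat_eq_some.1 hio with h1 | ⟨-, h1⟩
      · exact (hc.old i o' h1 hne).concat x
      · exact absurd h1 (hi _)
  cases st with
  | idle =>
    intro i o hio
    rcases getElem?_concat_eq_some.1 hio with h1 | ⟨-, h1⟩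
    · exact (hst i o h1).concat x
    · exact absurd h1 (hi _)
  | pending o =>
    obtain ⟨p, hp, h2⟩ := hst
    exact ⟨p, cur p o hp, h2⟩
  | done r =>
    obtain ⟨p, o, hp, h2⟩ := hst
    exact ⟨p, o, cur p o hp, h2⟩

theorem legal_concat {s : σ} {l : List (Op × Ret)} {o : Op} {r : Ret} (hl : Legal δ s l)
    (hr : (δ (l.foldl (fun s e => (δ s e.1).1) s) o).2 = r) : Legal δ s (l ++ [(o, r)]) := by
  induction l generalizing s with
  | nil => exact ⟨hr, trivial⟩
  | cons a l ih => exact ⟨hl.1, ih hl.2 hr⟩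

variable [DecidableEq T]

theorem LinExec.exists_certificate {h : List (Event T Op Ret)} {s : σ} {l : T → Status Op Ret}
    (he : LinExec δ s₀ h s l) : ∃ S, Certificate δ s₀ h s l S := by
  induction he with
  | start =>
    refine ⟨[], by simp, by simp, ?_, by simp, trivial, rfl, ?_⟩
    · rintro i j r ⟨t, o, h1, -⟩
      simp at h1
    · intro t i o hio
      simp at hio
  | @invoke h s l t o he hl ih =>
    obtain ⟨S, hS⟩ := ih
    refine ⟨S, hS.nodup, ?_, ?_, hS.order_concat _, hS.legal, hS.state, ?_⟩
    · intro e he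
      obtain ⟨t', ht'⟩ := hS.mem e he
      exact ⟨t', getElem?_concat_eq_some.2 (Or.inl ht')⟩
    · intro i j r hc
      have hj : j < h.length := by
        obtain ⟨t', o', -, -, h3, -⟩ := hc
        rcases getElem?_concat_eq_some.1 h3 with h4 | ⟨-, h4⟩
        · exact lt_length_of_getElem?_eq_some h4
        · cases h4
      exact hS.complete i j r (hc.of_concat hj)
    · intro t'
      have hst := hS.status t'
      by_cases ht : t' = t
      · subst ht
        rw [Function.update_self]
        rw [hl] at hst
        refine ⟨h.length, ⟨by simp, ?_, ?_⟩, ?_⟩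
        · rintro ⟨k, r, hk, hkr⟩
          have := lt_length_of_getElem?_eq_some hkr
          simp at this
          omega
        · intro i o' hio hne
          rcases getElem?_concat_eq_some.1 hio with h1 | ⟨h1, -⟩
          · exact (hst i o' h1).concat _
          · exact absurd h1 hne
        · intro hmem
          obtain ⟨e, he, hp⟩ := List.mem_map.1 hmem
          obtain ⟨t'', ht''⟩ := hS.mem e he
          have := lt_length_of_getElem?_eq_some ht''
          omega
      · rw [Function.update_of_ne ht]
        refine hst.concat ?_ ?_
        · intro o' h1
          injection h1 with h1
          exact ht h1.symm
        · intro r h1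
          cases h1
  | @linearize h s l t o he hl ih =>
    obtain ⟨S, hS⟩ := ih
    have hst := hS.status t
    rw [hl] at hst
    obtain ⟨p, hp, hpS⟩ := hst
    have hnot : ∀ i, ¬ Precedes h p i := by
      rintro i ⟨j, r, ⟨t', o', h1, h2, h3, -⟩, -⟩
      have h5 := hp.inv.symm.trans h1
      simp only [Option.some.injEq, Event.inv.injEq] at h5
      obtain ⟨rfl, rfl⟩ := h5
      exact hp.unanswered ⟨j, r, h2, h3⟩
    refine ⟨S ++ [⟨p, o, (δ s o).2⟩], ?_, ?_, ?_, ?_, ?_, ?_, ?_⟩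
    · rw [List.map_append, List.nodup_append]
      refine ⟨hS.nodup, by simp, ?_⟩
      rintro a ha b hb rfl
      simp at hb
      exact hpS (hb ▸ ha)
    · intro e he
      rcases List.mem_append.1 he with he | he
      · exact hS.mem e he
      · simp at he
        subst he
        exact ⟨t, hp.inv⟩
    · intro i j r hc
      obtain ⟨e, he, h1⟩ := hS.complete i j r hc
      exact ⟨e, List.mem_append_left _ he, h1⟩
    · rw [List.pairwise_append]
      refine ⟨hS.order, by simp, ?_⟩
      intro e _ e' he'
      simp at he'
      subst he'
      exact hnot _
    · rw [List.map_append]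
      refine legal_concat hS.legal ?_
      rw [List.foldl_map]
      simp only
      rw [hS.state]
    · rw [List.foldl_append, hS.state]
      rfl
    · intro t'
      by_cases ht : t' = t
      · subst ht
        rw [Function.update_self]
        exact ⟨p, o, hp, _, List.mem_append_right _ (List.mem_singleton_self _), rfl, rfl⟩
      · rw [Function.update_of_ne ht]
        have hst' := hS.status t'
        revert hst'
        cases l t' with
        | idle => exact fun hst' => hst'
        | pending o' =>
          rintro ⟨p', hp', h1⟩
          refine ⟨p', hp', ?_⟩
          rw [List.map_append, List.mem_append]
          rintro (h2 | h2)
          · exact h1 h2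
          · simp at h2
            subst h2
            have h5 := hp.inv.symm.trans hp'.inv
            simp only [Option.some.injEq, Event.inv.injEq] at h5
            exact ht h5.1.symm
        | done r =>
          rintro ⟨p', o', hp', e, he, h1⟩
          exact ⟨p', o', hp', e, List.mem_append_left _ he, h1⟩
  | @respond h s l t r he hl ih =>
    obtain ⟨S, hS⟩ := ih
    have hst := hS.status t
    rw [hl] at hst
    obtain ⟨p, o, hp, e, heS, hep, her⟩ := hst
    have hans : ∀ i o', h[i]? = some (.inv t o') → Answered (h ++ [.res t r]) t i := by
      intro i o' hi
      exact ⟨h.length, r, lt_length_of_getElem?_eq_some hi, by simp⟩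
    refine ⟨S, hS.nodup, ?_, ?_, hS.order_concat _, hS.legal, hS.state, ?_⟩
    · intro e he
      obtain ⟨t', ht'⟩ := hS.mem e he
      exact ⟨t', getElem?_concat_eq_some.2 (Or.inl ht')⟩
    · intro i j r' hc
      by_cases hj : j < h.length
      · exact hS.complete i j r' (hc.of_concat hj)
      obtain ⟨t', o', h1, h2, h3, h4⟩ := hc
      rcases getElem?_concat_eq_some.1 h3 with h5 | ⟨h5, h6⟩
      · exact absurd (lt_length_of_getElem?_eq_some h5) hj
      injection h6 with h6 h7
      subst h6 h7 h5
      rcases getElem?_concat_eq_some.1 h1 with h5 | ⟨-, h5⟩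
      · by_cases hip : i = p
        · exact ⟨e, heS, hep.trans hip.symm, her⟩
        · obtain ⟨k, r'', hk, hkr⟩ := hp.old i o' h5 hip
          exact absurd (getElem?_concat_eq_some.2 (Or.inl hkr))
            (h4 k r'' hk (lt_length_of_getElem?_eq_some hkr))
      · cases h5
    · intro t'
      by_cases ht : t' = t
      · subst ht
        rw [Function.update_self]
        intro i o' hio
        rcases getElem?_concat_eq_some.1 hio with h1 | ⟨-, h1⟩
        · exact hans i o' h1
        · cases h1
      · rw [Function.update_of_ne ht]
        refine (hS.status t').concat ?_ ?_
        · intro o' h1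
          cases h1
        · intro r' h1
          injection h1 with h1
          exact ht h1.symm

/-- If every operation takes effect atomically between its invocation and its response, then the
order in which the operations take effect is a linearization. -/
theorem LinExec.linearizable {h : List (Event T Op Ret)} {s : σ} {l : T → Status Op Ret}
    (he : LinExec δ s₀ h s l) : Linearizable δ s₀ h := by
  obtain ⟨S, hS⟩ := he.exists_certificate
  exact ⟨S, hS.nodup, hS.mem, hS.complete, hS.order, hS.legal⟩

/-- Let the pending operations `op k`, `k < N`, of distinct threads `own k` take effect one after
the other. -/
theorem LinExec.linearize_many {h : List (Event T Op Ret)} {l : T → Status Op Ret}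
    (own : ℕ → T) (op : ℕ → Op) (ret : ℕ → Ret) (st : ℕ → σ) (N : ℕ)
    (he : LinExec δ s₀ h (st 0) l)
    (hinj : ∀ i j, i < N → j < N → own i = own j → i = j)
    (hpend : ∀ k, k < N → l (own k) = .pending (op k))
    (hδ : ∀ k, k < N → δ (st k) (op k) = (st (k + 1), ret k)) :
    ∃ l', LinExec δ s₀ h (st N) l' ∧ (∀ k, k < N → l' (own k) = .done (ret k)) ∧
      ∀ t, (∀ k, k < N → own k ≠ t) → l' t = l t := by
  induction N with
  | zero => exact ⟨l, he, by simp, by simp⟩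
  | succ N ih =>
    obtain ⟨l', h1, h2, h3⟩ := ih (fun i j hi hj => hinj i j (by omega) (by omega))
      (fun k hk => hpend k (by omega)) (fun k hk => hδ k (by omega))
    have hne : ∀ k, k < N → own k ≠ own N := by
      intro k hk hkn
      have := hinj k N (by omega) (by omega) hkn
      omega
    have h4 := h1.linearize (own N) (op N) ((h3 _ hne).trans (hpend N (by omega)))
    rw [hδ N (by omega)] at h4
    refine ⟨_, h4, ?_, ?_⟩
    · intro k hk
      by_cases hkN : k = N
      · subst hkN
        simp
      · rw [Function.update_of_ne (hne k (by omega))]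
        exact h2 k (by omega)
    · intro t ht
      rw [Function.update_of_ne (ht N (by omega)).symm]
      exact h3 t fun k hk => ht k (by omega)

end Linearization

end ConcObj

namespace SEC

open ConcObj

variable {V : Type*} {n K P : ℕ}

/-! ### The invariant -/

/-- Auxiliary data recorded along an execution. -/
structure Ghost (V : Type*) (n K : ℕ) where
  /-- the aggregator that a batch has been created for -/
  home : ℕ → Option (Fin K)
  /-- the thread that has allocated a node -/
  owner : ℕ → Option (Fin n)
  /-- the nodes that are, or have been, reachable from `stackTop` -/
  published : Set ℕ
  /-- the pushes announced in a batch, by sequence number: thread, node, value -/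
  pushers : ℕ → List (Fin n × ℕ × V)
  /-- the pops announced in a batch, by sequence number -/
  poppers : ℕ → List (Fin n)
  /-- the contents of the stack just before the combiner of a batch has changed it -/
  snap : ℕ → Option (List V)
  /-- the progress of every thread -/
  status : Fin n → Status (Op V) (Ret V)
  /-- the contents of the stack -/
  stack : List V

/-- The list of values at the nodes reachable from `p` is `l`, and all these nodes are in `pub`. -/
def Chain (nodes : ℕ → Option (Node V)) (pub : Set ℕ) : Option ℕ → List V → Prop
  | p, [] => p = none
  | p, v :: l => ∃ y nxt, p = some y ∧ y ∈ pub ∧ nodes y = some ⟨v, nxt⟩ ∧ Chain nodes pub nxt l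

/-- Published nodes starting at `p` hold the stack contents `l`. -/
abbrev IsStack (m : Mem V K P) (g : Ghost V n K) (p : Option ℕ) (l : List V) : Prop :=
  Chain m.nodes g.published p l

/-- Batch `b` has been created, and its aggregator has moved on to another batch. -/
def Closed (m : Mem V K P) (b : ℕ) : Prop := b < m.numBatches ∧ ∀ a, m.agg a ≠ b

/-- The response of the `k`-th of several consecutive pops from `l`. -/
def popResult (l : List V) (k : ℕ) : Ret V :=
  match l[k]? with
  | some v => .val v
  | none => .empty

/-- The push with sequence number `i` in batch `b` has taken effect. -/
def PushEffective (m : Mem V K P) (g : Ghost V n K) (b i : ℕ) : Prop :=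
  Closed m b ∧ i < (m.batches b).pushCountAtFreeze ∧
    (i < (m.batches b).popCountAtFreeze ∨ g.snap b ≠ none)

/-- The pop with sequence number `i` in batch `b` has taken effect. -/
def PopEffective (m : Mem V K P) (g : Ghost V n K) (b i : ℕ) : Prop :=
  Closed m b ∧ i < (m.batches b).popCountAtFreeze ∧
    (i < (m.batches b).pushCountAtFreeze ∨ g.snap b ≠ none)

/-- The push with sequence number `i` in batch `b` may still take effect there. -/
def PushLive (m : Mem V K P) (g : Ghost V n K) (b i : ℕ) : Prop :=
  Closed m b → (m.batches b).popCountAtFreeze ≤ i ∧ i < (m.batches b).pushCountAtFreeze ∧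
    g.snap b = none

/-- The pop with sequence number `i` in batch `b` may still take effect there. -/
def PopLive (m : Mem V K P) (g : Ghost V n K) (b i : ℕ) : Prop :=
  Closed m b → (m.batches b).pushCountAtFreeze ≤ i ∧ i < (m.batches b).popCountAtFreeze ∧
    g.snap b = none

/-- Thread `t` is in batch `b` with a push of node `x` and sequence number `i`. The last clause
says that the change to the stack is still to be made if this push is the combiner. -/
def PushTicket (m : Mem V K P) (g : Ghost V n K) (t : Fin n) (x b i : ℕ) : Prop :=
  ∃ v, (g.pushers b)[i]? = some (t, x, v) ∧
    (PushEffective m g b i → g.status t = .done .tt) ∧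
    (¬ PushEffective m g b i → g.status t = .pending (.push v) ∧ x ∉ g.published) ∧
    (i = (m.batches b).popCountAtFreeze → i < (m.batches b).pushCountAtFreeze → g.snap b = none)

/-- Thread `t` is in batch `b` with a pop and sequence number `i`. -/
structure PopTicket (m : Mem V K P) (g : Ghost V n K) (t : Fin n) (b i : ℕ) : Prop where
  mem : (g.poppers b)[i]? = some t
  eliminated : Closed m b → i < (m.batches b).popCountAtFreeze →
    i < (m.batches b).pushCountAtFreeze →
    ∀ e, (g.pushers b)[i]? = some e → g.status t = .done (.val e.2.2)
  combined : Closed m b → i < (m.batches b).popCountAtFreeze →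
    (m.batches b).pushCountAtFreeze ≤ i →
    ∀ l, g.snap b = some l →
      g.status t = .done (popResult l (i - (m.batches b).pushCountAtFreeze))
  pending : ¬ PopEffective m g b i → g.status t = .pending .pop
  combiner : i = (m.batches b).pushCountAtFreeze → i < (m.batches b).popCountAtFreeze →
    g.snap b = none

/-- Thread `t` is in batch `b`; a push has written its node to the elimination array. -/
def Ticket (m : Mem V K P) (g : Ghost V n K) (t : Fin n) : Caller → ℕ → ℕ → Prop
  | .push x, b, i => PushTicket m g t x b i ∧ (m.batches b).slot i = some (some x)
  | .pop, b, i => PopTicket m g t b i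

/-- The operation of thread `t` has not taken effect; the node of a push is not published. -/
def Fresh (m : Mem V K P) (g : Ghost V n K) (t : Fin n) : Caller → Prop
  | .push x => ∃ v nx, m.nodes x = some ⟨v, nx⟩ ∧ g.owner x = some t ∧ x ∉ g.published ∧
      g.status t = .pending (.push v)
  | .pop => g.status t = .pending .pop

/-- Thread `t` has not announced an operation of the given kind in batch `b`. -/
def Absent (g : Ghost V n K) (t : Fin n) : Caller → ℕ → Prop
  | .push _, b => ∀ e ∈ g.pushers b, e.1 ≠ t
  | .pop, b => t ∉ g.poppers b

/-- Thread `t` is entitled to freeze batch `b`. -/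
def Freezing (asg : Fin n → Fin K) (m : Mem V K P) (t : Fin n) (b : ℕ) : Prop :=
  m.agg (asg t) = b ∧ (m.batches b).isFreezerDecided = true

/-- Thread `t` runs the combiner of batch `b` for pushes. -/
def PushCombiner (m : Mem V K P) (g : Ghost V n K) (t : Fin n) (b : ℕ) : Prop :=
  (∃ x, PushTicket m g t x b (m.batches b).popCountAtFreeze) ∧ Closed m b ∧
    (m.batches b).popCountAtFreeze < (m.batches b).pushCountAtFreeze

/-- Thread `t` runs the combiner of batch `b` for pops. -/
def PopCombiner (m : Mem V K P) (g : Ghost V n K) (t : Fin n) (b i : ℕ) : Prop :=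
  PopTicket m g t b i ∧ Closed m b ∧ i = (m.batches b).pushCountAtFreeze ∧
    i < (m.batches b).popCountAtFreeze

/-- The nodes of the pushes of batch `b` are linked from `top`, the node of push `i`, down to
`bot`, the node of the combiner. -/
def Linked (m : Mem V K P) (g : Ghost V n K) (b i : ℕ) (top bot : Option ℕ) : Prop :=
  (∃ e, (g.pushers b)[(m.batches b).popCountAtFreeze]? = some e ∧ bot = some e.2.1) ∧
  (∃ e, (g.pushers b)[i]? = some e ∧ top = some e.2.1) ∧
  ∀ j, (m.batches b).popCountAtFreeze ≤ j → j < i →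
    ∃ e e', (g.pushers b)[j]? = some e ∧ (g.pushers b)[j + 1]? = some e' ∧
      m.nodes e'.2.1 = some ⟨e'.2.2, some e.2.1⟩

/-- What holds when thread `t` is at a given control state. -/
def PCInv (asg : Fin n → Fin K) (m : Mem V K P) (g : Ghost V n K) (t : Fin n) : PC V → Prop
  | .idle => g.status t = .idle
  | .ret r => g.status t = .done r
  | .fault => False
  | .pushAlloc v => g.status t = .pending (.push v)
  | .getBatch c => Fresh m g t c
  | .announce c b => Fresh m g t c ∧ g.home b = some (asg t) ∧ Absent g t c b
  | .pushWrite x b i => PushTicket m g t x b i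
  | .freezerTest c b i => Ticket m g t c b i
  | .freezeReadPop c b i => Ticket m g t c b i ∧ Freezing asg m t b
  | .freezeWritePop c b i r =>
      Ticket m g t c b i ∧ Freezing asg m t b ∧ r ≤ (m.batches b).popCount
  | .freezeReadPush c b i => Ticket m g t c b i ∧ Freezing asg m t b
  | .freezeWritePush c b i r =>
      Ticket m g t c b i ∧ Freezing asg m t b ∧ r ≤ (m.batches b).pushCount
  | .freezeNewBatch c b i => Ticket m g t c b i ∧ Freezing asg m t b
  | .freezeWait c b i => Ticket m g t c b i
  | .inclusionTest c b i => Ticket m g t c b i ∧ Closed m b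
  | .pushElimTest b i => ∃ x, Ticket m g t (.push x) b i ∧ Closed m b ∧
      i < (m.batches b).pushCountAtFreeze
  | .pushCombinerTest b i => ∃ x, Ticket m g t (.push x) b i ∧ Closed m b ∧
      i < (m.batches b).pushCountAtFreeze ∧ (m.batches b).popCountAtFreeze ≤ i
  | .pushApplied b => g.status t = .done .tt ∧ g.snap b ≠ none ∧ Closed m b ∧
      (m.batches b).popCountAtFreeze < (m.batches b).pushCountAtFreeze
  | .pushWaitApplied b => ∃ x i, PushTicket m g t x b i ∧ Closed m b ∧
      i < (m.batches b).pushCountAtFreeze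
  | .ptsInit b i => ∃ x, Ticket m g t (.push x) b i ∧ Closed m b ∧
      i < (m.batches b).pushCountAtFreeze ∧ i = (m.batches b).popCountAtFreeze
  | .ptsLoop b i top bot => PushCombiner m g t b ∧ i < (m.batches b).pushCountAtFreeze ∧
      (m.batches b).popCountAtFreeze ≤ i ∧ Linked m g b i top bot
  | .ptsWait b i top bot => PushCombiner m g t b ∧ i < (m.batches b).pushCountAtFreeze ∧
      ∃ j, i = j + 1 ∧ (m.batches b).popCountAtFreeze ≤ j ∧ Linked m g b j top bot
  | .ptsRead b i top bot => PushCombiner m g t b ∧ i < (m.batches b).pushCountAtFreeze ∧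
      (∃ j, i = j + 1 ∧ (m.batches b).popCountAtFreeze ≤ j ∧ Linked m g b j top bot) ∧
      ∃ x, (m.batches b).slot i = some (some x)
  | .ptsLink b i tempNode top bot => PushCombiner m g t b ∧
      i < (m.batches b).pushCountAtFreeze ∧
      (∃ j, i = j + 1 ∧ (m.batches b).popCountAtFreeze ≤ j ∧ Linked m g b j top bot) ∧
      ∃ e, (g.pushers b)[i]? = some e ∧ tempNode = some e.2.1
  | .ptsReadTop b top bot => PushCombiner m g t b ∧
      ∃ i, i + 1 = (m.batches b).pushCountAtFreeze ∧ (m.batches b).popCountAtFreeze ≤ i ∧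
        Linked m g b i top bot
  | .ptsSetBot b top bot _ => PushCombiner m g t b ∧
      ∃ i, i + 1 = (m.batches b).pushCountAtFreeze ∧ (m.batches b).popCountAtFreeze ≤ i ∧
        Linked m g b i top bot
  | .ptsCAS b top bot tempTop => PushCombiner m g t b ∧
      (∃ i, i + 1 = (m.batches b).pushCountAtFreeze ∧ (m.batches b).popCountAtFreeze ≤ i ∧
        Linked m g b i top bot) ∧
      ∃ e, (g.pushers b)[(m.batches b).popCountAtFreeze]? = some e ∧
        m.nodes e.2.1 = some ⟨e.2.2, tempTop⟩
  | .popElimTest b i => PopTicket m g t b i ∧ Closed m b ∧ i < (m.batches b).popCountAtFreeze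
  | .popElimWait b i => PopTicket m g t b i ∧ Closed m b ∧
      i < (m.batches b).popCountAtFreeze ∧ i < (m.batches b).pushCountAtFreeze
  | .popElimRead b i => PopTicket m g t b i ∧ Closed m b ∧
      i < (m.batches b).popCountAtFreeze ∧ i < (m.batches b).pushCountAtFreeze ∧
      ∃ x, (m.batches b).slot i = some (some x)
  | .popElimValue y => ∃ x N, y = some x ∧ m.nodes x = some N ∧
      g.status t = .done (.val N.value)
  | .popCombinerTest b i => PopTicket m g t b i ∧ Closed m b ∧
      i < (m.batches b).popCountAtFreeze ∧ (m.batches b).pushCountAtFreeze ≤ i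
  | .popWaitApplied b i => PopTicket m g t b i ∧ Closed m b ∧
      i < (m.batches b).popCountAtFreeze ∧ (m.batches b).pushCountAtFreeze ≤ i
  | .popApplied b i => ∃ l, g.snap b = some l ∧ IsStack m g (m.batches b).subStackTop l ∧
      Closed m b ∧ g.status t = .done (popResult l (i - (m.batches b).pushCountAtFreeze))
  | .gvArg b i => ∃ l, g.snap b = some l ∧ IsStack m g (m.batches b).subStackTop l ∧
      Closed m b ∧ g.status t = .done (popResult l (i - (m.batches b).pushCountAtFreeze))
  | .gvInit b k => ∃ l, g.snap b = some l ∧ IsStack m g (m.batches b).subStackTop l ∧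
      g.status t = .done (popResult l k)
  | .gvLoop k temp => ∃ l, IsStack m g temp l ∧ g.status t = .done (popResult l k)
  | .pfsReadTop b i => PopCombiner m g t b i
  | .pfsLoop b i j top bot => PopCombiner m g t b i ∧ i ≤ j ∧
      j ≤ (m.batches b).popCountAtFreeze ∧
      ∃ l, IsStack m g top l ∧ IsStack m g bot (l.drop (j - i))
  | .pfsNext b i j top bot => PopCombiner m g t b i ∧
      ∃ k, j = k + 1 ∧ i ≤ k ∧ k < (m.batches b).popCountAtFreeze ∧
        ∃ l, IsStack m g top l ∧ IsStack m g bot (l.drop (k - i))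
  | .pfsCAS b i top bot => PopCombiner m g t b i ∧
      ∃ l, IsStack m g top l ∧ IsStack m g bot (l.drop ((m.batches b).popCountAtFreeze - i))
  | .pfsPublish b i top => ∃ l, g.snap b = some l ∧ IsStack m g top l ∧
      Closed m b ∧ g.status t = .done (popResult l (i - (m.batches b).pushCountAtFreeze))
  | .peekTop => g.status t = .pending .peek
  | .peekValue y => ∃ x N, y = some x ∧ m.nodes x = some N ∧
      g.status t = .done (.val N.value)

/-- The operation is a push. -/
def Caller.isPush : Caller → Bool
  | .push _ => true
  | .pop => false

/-- The kind of the operation and the batch in which it has been announced, up to the point where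
the thread knows that it takes no effect there, or that it has taken effect there. -/
def PC.batch : PC V → Option (Bool × ℕ)
  | .pushWrite _ b _ => some (true, b)
  | .freezerTest c b _ => some (c.isPush, b)
  | .freezeReadPop c b _ => some (c.isPush, b)
  | .freezeWritePop c b _ _ => some (c.isPush, b)
  | .freezeReadPush c b _ => some (c.isPush, b)
  | .freezeWritePush c b _ _ => some (c.isPush, b)
  | .freezeNewBatch c b _ => some (c.isPush, b)
  | .freezeWait c b _ => some (c.isPush, b)
  | .inclusionTest c b _ => some (c.isPush, b)
  | .pushElimTest b _ => some (true, b)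
  | .pushCombinerTest b _ => some (true, b)
  | .pushWaitApplied b => some (true, b)
  | .ptsInit b _ => some (true, b)
  | .ptsLoop b _ _ _ => some (true, b)
  | .ptsWait b _ _ _ => some (true, b)
  | .ptsRead b _ _ _ => some (true, b)
  | .ptsLink b _ _ _ _ => some (true, b)
  | .ptsReadTop b _ _ => some (true, b)
  | .ptsSetBot b _ _ _ => some (true, b)
  | .ptsCAS b _ _ _ => some (true, b)
  | .popElimTest b _ => some (false, b)
  | .popElimWait b _ => some (false, b)
  | .popElimRead b _ => some (false, b)
  | .popCombinerTest b _ => some (false, b)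
  | .popWaitApplied b _ => some (false, b)
  | .pfsReadTop b _ => some (false, b)
  | .pfsLoop b _ _ _ _ => some (false, b)
  | .pfsNext b _ _ _ _ => some (false, b)
  | .pfsCAS b _ _ _ => some (false, b)
  | _ => none

/-- The batch that the thread is freezing. -/
def PC.freezing : PC V → Option ℕ
  | .freezeReadPop _ b _ => some b
  | .freezeWritePop _ b _ _ => some b
  | .freezeReadPush _ b _ => some b
  | .freezeWritePush _ b _ _ => some b
  | .freezeNewBatch _ b _ => some b
  | _ => none

/-- The batch whose nodes the thread is linking. -/
def PC.linking : PC V → Option ℕ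
  | .ptsLoop b _ _ _ => some b
  | .ptsWait b _ _ _ => some b
  | .ptsRead b _ _ _ => some b
  | .ptsLink b _ _ _ _ => some b
  | .ptsReadTop b _ _ => some b
  | .ptsSetBot b _ _ _ => some b
  | .ptsCAS b _ _ _ => some b
  | _ => none

/-- The part of the invariant that does not refer to control states. -/
structure Global (asg : Fin n → Fin K) (m : Mem V K P) (g : Ghost V n K) : Prop where
  agg_lt : ∀ a, m.agg a < m.numBatches
  home_agg : ∀ a, g.home (m.agg a) = some a
  home_lt : ∀ b a, g.home b = some a → b < m.numBatches
  pushCount : ∀ b, (g.pushers b).length = (m.batches b).pushCount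
  popCount : ∀ b, (g.poppers b).length = (m.batches b).popCount
  pushFreeze_le : ∀ b, (m.batches b).pushCountAtFreeze ≤ (m.batches b).pushCount
  popFreeze_le : ∀ b, (m.batches b).popCountAtFreeze ≤ (m.batches b).popCount
  pushers_home : ∀ b, ∀ e ∈ g.pushers b, g.home b = some (asg e.1)
  poppers_home : ∀ b, ∀ t ∈ g.poppers b, g.home b = some (asg t)
  pushers_owner : ∀ b, ∀ e ∈ g.pushers b, g.owner e.2.1 = some e.1
  pushers_node : ∀ b, ∀ e ∈ g.pushers b, ∃ nx, m.nodes e.2.1 = some ⟨e.2.2, nx⟩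
  pushers_nodup : ∀ b, ((g.pushers b).map Prod.fst).Nodup
  poppers_nodup : ∀ b, (g.poppers b).Nodup
  slot : ∀ b i x, (m.batches b).slot i = some (some x) →
    ∃ e, (g.pushers b)[i]? = some e ∧ x = e.2.1
  closed_decided : ∀ b, Closed m b → (m.batches b).isFreezerDecided = true
  snap_closed : ∀ b, g.snap b ≠ none → Closed m b
  applied : ∀ b, (m.batches b).isBatchApplied = true → g.snap b ≠ none ∧
    ((m.batches b).pushCountAtFreeze < (m.batches b).popCountAtFreeze →
      ∃ l, g.snap b = some l ∧ IsStack m g (m.batches b).subStackTop l)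
  stack : IsStack m g m.stackTop g.stack
  nodes_lt : ∀ x N, m.nodes x = some N → x < m.numNodes
  owner_lt : ∀ x t, g.owner x = some t → x < m.numNodes
  published_lt : ∀ x ∈ g.published, x < m.numNodes

/-- The invariant of the algorithm. -/
structure Inv (asg : Fin n → Fin K) (s : Config V n K P)
    (h : List (Event (Fin n) (Op V) (Ret V))) (g : Ghost V n K) : Prop where
  lin : LinExec stackSpec [] h g.stack g.status
  glob : Global asg s.mem g
  pcInv : ∀ t, PCInv asg s.mem g t (s.pc t)
  pushLive : ∀ (b i : ℕ) (e : Fin n × ℕ × V), (g.pushers b)[i]? = some e → PushLive s.mem g b i →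
    (s.pc e.1).batch = some (true, b)
  popLive : ∀ (b i : ℕ) (t : Fin n), (g.poppers b)[i]? = some t → PopLive s.mem g b i →
    (s.pc t).batch = some (false, b)
  freezer : ∀ t t' b, (s.pc t).freezing = some b → (s.pc t').freezing = some b → t = t'

/-- The change from `m, g` to `m', g'`, made by other threads, preserves everything that thread `t`
at control state `pc` relies on. -/
structure Frame (asg : Fin n → Fin K) (t : Fin n) (pc : PC V) (m : Mem V K P) (g : Ghost V n K)
    (m' : Mem V K P) (g' : Ghost V n K) : Prop where
  fresh : pc.batch = none → ∀ c, Fresh m g t c → Fresh m' g' t c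
  status : pc.batch = none → g'.status t = g.status t
  home : ∀ b a, g.home b = some a → g'.home b = some a
  absent : ∀ c b, Absent g t c b → Absent g' t c b
  pushTicket : ∀ x b i, pc.batch = some (true, b) → PushTicket m g t x b i →
    PushTicket m' g' t x b i
  popTicket : ∀ b i, pc.batch = some (false, b) → PopTicket m g t b i → PopTicket m' g' t b i
  pushers : ∀ (b i : ℕ) (e : Fin n × ℕ × V), (g.pushers b)[i]? = some e →
    (g'.pushers b)[i]? = some e
  slot : ∀ b i x, (m.batches b).slot i = some (some x) →
    (m'.batches b).slot i = some (some x)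
  closed : ∀ b, Closed m b → Closed m' b
  pushFreeze : ∀ b, Closed m b →
    (m'.batches b).pushCountAtFreeze = (m.batches b).pushCountAtFreeze
  popFreeze : ∀ b, Closed m b →
    (m'.batches b).popCountAtFreeze = (m.batches b).popCountAtFreeze
  snap : ∀ b l, g.snap b = some l → g'.snap b = some l
  freezing : ∀ b, pc.freezing = some b → Freezing asg m t b → Freezing asg m' t b
  pushCount : ∀ b, pc.freezing = some b → (m.batches b).pushCount ≤ (m'.batches b).pushCount
  popCount : ∀ b, pc.freezing = some b → (m.batches b).popCount ≤ (m'.batches b).popCount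
  linking : ∀ b, pc.linking = some b → PushCombiner m g t b → ∀ (j : ℕ) (e : Fin n × ℕ × V),
    (m.batches b).popCountAtFreeze ≤ j → j < (m.batches b).pushCountAtFreeze →
    (g.pushers b)[j]? = some e → m'.nodes e.2.1 = m.nodes e.2.1
  value : ∀ x N, m.nodes x = some N → ∃ N', m'.nodes x = some N' ∧ N'.value = N.value
  chain : ∀ p l, IsStack m g p l → IsStack m' g' p l
  sub : ∀ b l, g.snap b = some l → IsStack m g (m.batches b).subStackTop l →
    IsStack m' g' (m'.batches b).subStackTop l

/-! ### Stability under steps of other threads -/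

section Frame

variable {asg : Fin n → Fin K} {t : Fin n} {pc : PC V} {m m' : Mem V K P} {g g' : Ghost V n K}

theorem Frame.ticket (hF : Frame asg t pc m g m' g') {c : Caller} {b i : ℕ}
    (hb : pc.batch = some (c.isPush, b)) (hT : Ticket m g t c b i) : Ticket m' g' t c b i := by
  cases c with
  | push x => exact ⟨hF.pushTicket x b i hb hT.1, hF.slot b i x hT.2⟩
  | pop => exact hF.popTicket b i hb hT

theorem Frame.pushCombiner (hF : Frame asg t pc m g m' g') {b : ℕ}
    (hb : pc.batch = some (true, b)) (hC : PushCombiner m g t b) : PushCombiner m' g' t b := by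
  obtain ⟨⟨x, hx⟩, hc, hlt⟩ := hC
  refine ⟨⟨x, ?_⟩, hF.closed b hc, ?_⟩
  · rw [hF.popFreeze b hc]
    exact hF.pushTicket x b _ hb hx
  · rwa [hF.popFreeze b hc, hF.pushFreeze b hc]

theorem Frame.popCombiner (hF : Frame asg t pc m g m' g') {b i : ℕ}
    (hb : pc.batch = some (false, b)) (hC : PopCombiner m g t b i) : PopCombiner m' g' t b i := by
  obtain ⟨hx, hc, hi, hlt⟩ := hC
  refine ⟨hF.popTicket b _ hb hx, hF.closed b hc, ?_, ?_⟩
  · rwa [hF.pushFreeze b hc]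
  · rwa [hF.popFreeze b hc]

theorem Frame.linked (hF : Frame asg t pc m g m' g') {b i : ℕ} {top bot : Option ℕ}
    (hb : pc.linking = some b) (hC : PushCombiner m g t b)
    (hi : i < (m.batches b).pushCountAtFreeze) (hL : Linked m g b i top bot) :
    Linked m' g' b i top bot := by
  obtain ⟨⟨e, he, hbot⟩, ⟨e', he', htop⟩, hj⟩ := hL
  have hw := hF.popFreeze b hC.2.1
  refine ⟨⟨e, ?_, hbot⟩, ⟨e', hF.pushers _ _ _ he', htop⟩, ?_⟩
  · rw [hw]
    exact hF.pushers _ _ _ he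
  · intro j hj1 hj2
    rw [hw] at hj1
    obtain ⟨e1, e2, h1, h2, h3⟩ := hj j hj1 hj2
    refine ⟨e1, e2, hF.pushers _ _ _ h1, hF.pushers _ _ _ h2, ?_⟩
    rw [hF.linking b hb hC (j + 1) e2 (by omega) (by omega) h2]
    exact h3

/-- The assertions at the control state of a thread are stable under steps of other threads. -/
theorem Frame.pcInv (hF : Frame asg t pc m g m' g') (hI : PCInv asg m g t pc) :
    PCInv asg m' g' t pc := by
  have hst := hF.status
  have hT := fun c b i => hF.ticket (c := c) (b := b) (i := i)
  have hPC := fun b => hF.pushCombiner (b := b)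
  have hQC := fun b i => hF.popCombiner (b := b) (i := i)
  have hL := fun b i top bot => hF.linked (b := b) (i := i) (top := top) (bot := bot)
  cases pc with
  | idle => exact (hst rfl).trans hI
  | ret r => exact (hst rfl).trans hI
  | fault => exact hI
  | pushAlloc v => exact (hst rfl).trans hI
  | getBatch c => exact hF.fresh rfl c hI
  | announce c b => exact ⟨hF.fresh rfl c hI.1, hF.home _ _ hI.2.1, hF.absent _ _ hI.2.2⟩
  | pushWrite x b i => exact hF.pushTicket x b i rfl hI
  | freezerTest c b i => exact hT c b i rfl hI
  | freezeReadPop c b i => exact ⟨hT c b i rfl hI.1, hF.freezing b rfl hI.2⟩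
  | freezeWritePop c b i r =>
    exact ⟨hT c b i rfl hI.1, hF.freezing b rfl hI.2.1, hI.2.2.trans (hF.popCount b rfl)⟩
  | freezeReadPush c b i => exact ⟨hT c b i rfl hI.1, hF.freezing b rfl hI.2⟩
  | freezeWritePush c b i r =>
    exact ⟨hT c b i rfl hI.1, hF.freezing b rfl hI.2.1, hI.2.2.trans (hF.pushCount b rfl)⟩
  | freezeNewBatch c b i => exact ⟨hT c b i rfl hI.1, hF.freezing b rfl hI.2⟩
  | freezeWait c b i => exact hT c b i rfl hI
  | inclusionTest c b i => exact ⟨hT c b i rfl hI.1, hF.closed b hI.2⟩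
  | pushElimTest b i =>
    obtain ⟨x, h1, h2, h3⟩ := hI
    exact ⟨x, hT (.push x) b i rfl h1, hF.closed b h2, by rwa [hF.pushFreeze b h2]⟩
  | pushCombinerTest b i =>
    obtain ⟨x, h1, h2, h3, h4⟩ := hI
    exact ⟨x, hT (.push x) b i rfl h1, hF.closed b h2, by rwa [hF.pushFreeze b h2],
      by rwa [hF.popFreeze b h2]⟩
  | pushApplied b =>
    obtain ⟨h1, h2, h3, h4⟩ := hI
    refine ⟨(hst rfl).trans h1, ?_, hF.closed b h3, ?_⟩
    · obtain ⟨l, hl⟩ := Option.ne_none_iff_exists'.1 h2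
      rw [hF.snap b l hl]
      simp
    · rwa [hF.pushFreeze b h3, hF.popFreeze b h3]
  | pushWaitApplied b =>
    obtain ⟨x, i, h1, h2, h3⟩ := hI
    exact ⟨x, i, hF.pushTicket x b i rfl h1, hF.closed b h2, by rwa [hF.pushFreeze b h2]⟩
  | ptsInit b i =>
    obtain ⟨x, h1, h2, h3, h4⟩ := hI
    exact ⟨x, hT (.push x) b i rfl h1, hF.closed b h2, by rwa [hF.pushFreeze b h2],
      by rwa [hF.popFreeze b h2]⟩
  | ptsLoop b i top bot =>
    obtain ⟨h1, h2, h3, h4⟩ := hI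
    exact ⟨hPC b rfl h1, by rwa [hF.pushFreeze b h1.2.1], by rwa [hF.popFreeze b h1.2.1],
      hL _ _ _ _ rfl h1 h2 h4⟩
  | ptsWait b i top bot =>
    obtain ⟨h1, h2, j, rfl, h3, h4⟩ := hI
    exact ⟨hPC b rfl h1, by rwa [hF.pushFreeze b h1.2.1], j, rfl,
      by rwa [hF.popFreeze b h1.2.1], hL _ _ _ _ rfl h1 (by omega) h4⟩
  | ptsRead b i top bot =>
    obtain ⟨h1, h2, ⟨j, rfl, h3, h4⟩, x, h5⟩ := hI
    exact ⟨hPC b rfl h1, by rwa [hF.pushFreeze b h1.2.1], ⟨j, rfl,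
      by rwa [hF.popFreeze b h1.2.1], hL _ _ _ _ rfl h1 (by omega) h4⟩, x, hF.slot b _ x h5⟩
  | ptsLink b i temp top bot =>
    obtain ⟨h1, h2, ⟨j, rfl, h3, h4⟩, e, h5, h6⟩ := hI
    exact ⟨hPC b rfl h1, by rwa [hF.pushFreeze b h1.2.1], ⟨j, rfl,
      by rwa [hF.popFreeze b h1.2.1], hL _ _ _ _ rfl h1 (by omega) h4⟩,
      e, hF.pushers _ _ _ h5, h6⟩
  | ptsReadTop b top bot =>
    obtain ⟨h1, i, h2, h3, h4⟩ := hI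
    exact ⟨hPC b rfl h1, i, by rwa [hF.pushFreeze b h1.2.1], by rwa [hF.popFreeze b h1.2.1],
      hL _ _ _ _ rfl h1 (by omega) h4⟩
  | ptsSetBot b top bot temp =>
    obtain ⟨h1, i, h2, h3, h4⟩ := hI
    exact ⟨hPC b rfl h1, i, by rwa [hF.pushFreeze b h1.2.1], by rwa [hF.popFreeze b h1.2.1],
      hL _ _ _ _ rfl h1 (by omega) h4⟩
  | ptsCAS b top bot temp =>
    obtain ⟨h1, ⟨i, h2, h3, h4⟩, e, h5, h6⟩ := hI
    refine ⟨hPC b rfl h1, ⟨i, by rwa [hF.pushFreeze b h1.2.1], by rwa [hF.popFreeze b h1.2.1],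
      hL _ _ _ _ rfl h1 (by omega) h4⟩, e, ?_, ?_⟩
    · rw [hF.popFreeze b h1.2.1]
      exact hF.pushers _ _ _ h5
    · rw [hF.linking b rfl h1 _ e le_rfl h1.2.2 h5]
      exact h6
  | popElimTest b i =>
    obtain ⟨h1, h2, h3⟩ := hI
    exact ⟨hF.popTicket b i rfl h1, hF.closed b h2, by rwa [hF.popFreeze b h2]⟩
  | popElimWait b i =>
    obtain ⟨h1, h2, h3, h4⟩ := hI
    exact ⟨hF.popTicket b i rfl h1, hF.closed b h2, by rwa [hF.popFreeze b h2],
      by rwa [hF.pushFreeze b h2]⟩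
  | popElimRead b i =>
    obtain ⟨h1, h2, h3, h4, x, h5⟩ := hI
    exact ⟨hF.popTicket b i rfl h1, hF.closed b h2, by rwa [hF.popFreeze b h2],
      by rwa [hF.pushFreeze b h2], x, hF.slot b i x h5⟩
  | popElimValue y =>
    obtain ⟨x, N, h1, h2, h3⟩ := hI
    obtain ⟨N', h4, h5⟩ := hF.value x N h2
    exact ⟨x, N', h1, h4, by rw [hst rfl, h3, h5]⟩
  | popCombinerTest b i =>
    obtain ⟨h1, h2, h3, h4⟩ := hI
    exact ⟨hF.popTicket b i rfl h1, hF.closed b h2, by rwa [hF.popFreeze b h2],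
      by rwa [hF.pushFreeze b h2]⟩
  | popWaitApplied b i =>
    obtain ⟨h1, h2, h3, h4⟩ := hI
    exact ⟨hF.popTicket b i rfl h1, hF.closed b h2, by rwa [hF.popFreeze b h2],
      by rwa [hF.pushFreeze b h2]⟩
  | popApplied b i =>
    obtain ⟨l, h1, h2, h3, h4⟩ := hI
    exact ⟨l, hF.snap b l h1, hF.sub b l h1 h2, hF.closed b h3,
      by rw [hF.pushFreeze b h3, hst rfl, h4]⟩
  | gvArg b i =>
    obtain ⟨l, h1, h2, h3, h4⟩ := hI
    exact ⟨l, hF.snap b l h1, hF.sub b l h1 h2, hF.closed b h3,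
      by rw [hF.pushFreeze b h3, hst rfl, h4]⟩
  | gvInit b k =>
    obtain ⟨l, h1, h2, h3⟩ := hI
    exact ⟨l, hF.snap b l h1, hF.sub b l h1 h2, (hst rfl).trans h3⟩
  | gvLoop k temp =>
    obtain ⟨l, h1, h2⟩ := hI
    exact ⟨l, hF.chain _ _ h1, (hst rfl).trans h2⟩
  | pfsReadTop b i => exact hQC b i rfl hI
  | pfsLoop b i j top bot =>
    obtain ⟨h1, h2, h3, l, h4, h5⟩ := hI
    exact ⟨hQC b i rfl h1, h2, by rwa [hF.popFreeze b h1.2.1], l, hF.chain _ _ h4,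
      hF.chain _ _ h5⟩
  | pfsNext b i j top bot =>
    obtain ⟨h1, k, h2, h3, h4, l, h5, h6⟩ := hI
    exact ⟨hQC b i rfl h1, k, h2, h3, by rwa [hF.popFreeze b h1.2.1], l, hF.chain _ _ h5,
      hF.chain _ _ h6⟩
  | pfsCAS b i top bot =>
    obtain ⟨h1, l, h2, h3⟩ := hI
    exact ⟨hQC b i rfl h1, l, hF.chain _ _ h2,
      by rw [hF.popFreeze b h1.2.1]; exact hF.chain _ _ h3⟩
  | pfsPublish b i top =>
    obtain ⟨l, h1, h2, h3, h4⟩ := hI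
    exact ⟨l, hF.snap b l h1, hF.chain _ _ h2, hF.closed b h3,
      by rw [hF.pushFreeze b h3, hst rfl, h4]⟩
  | peekTop => exact (hst rfl).trans hI
  | peekValue y =>
    obtain ⟨x, N, h1, h2, h3⟩ := hI
    obtain ⟨N', h4, h5⟩ := hF.value x N h2
    exact ⟨x, N', h1, h4, by rw [hst rfl, h3, h5]⟩

end Frame

/-! ### Sequence numbers in a batch -/

section Tickets

variable {asg : Fin n → Fin K} {m : Mem V K P} {g : Ghost V n K}

/-- A thread announces at most one push in a batch. -/
theorem Global.pusher_index_unique (hG : Global asg m g) {b i j : ℕ} {e e' : Fin n × ℕ × V}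
    (hi : (g.pushers b)[i]? = some e) (hj : (g.pushers b)[j]? = some e') (he : e.1 = e'.1) :
    i = j := by
  have h1 : ((g.pushers b).map Prod.fst)[i]? = ((g.pushers b).map Prod.fst)[j]? := by
    rw [List.getElem?_map, List.getElem?_map, hi, hj]
    simp [he]
  exact (List.getElem?_inj (by simpa using lt_length_of_getElem?_eq_some hi)
    (hG.pushers_nodup b)).1 h1

/-- A thread announces at most one pop in a batch. -/
theorem Global.popper_index_unique (hG : Global asg m g) {b i j : ℕ} {t : Fin n}
    (hi : (g.poppers b)[i]? = some t) (hj : (g.poppers b)[j]? = some t) : i = j :=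
  (List.getElem?_inj (lt_length_of_getElem?_eq_some hi) (hG.poppers_nodup b)).1
    (hi.trans hj.symm)

theorem Global.exists_pusher (hG : Global asg m g) {b i : ℕ}
    (hi : i < (m.batches b).pushCountAtFreeze) : ∃ e, (g.pushers b)[i]? = some e := by
  have h1 : i < (g.pushers b).length := by
    rw [hG.pushCount]
    exact hi.trans_le (hG.pushFreeze_le b)
  exact ⟨_, List.getElem?_eq_getElem h1⟩

theorem Global.exists_popper (hG : Global asg m g) {b i : ℕ}
    (hi : i < (m.batches b).popCountAtFreeze) : ∃ t, (g.poppers b)[i]? = some t := by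
  have h1 : i < (g.poppers b).length := by
    rw [hG.popCount]
    exact hi.trans_le (hG.popFreeze_le b)
  exact ⟨_, List.getElem?_eq_getElem h1⟩

/-- Threads announce at most one push in every batch of their aggregator, so that the elimination
array has room for all of them. -/
theorem Global.pushers_length_le (hG : Global asg m g)
    (hP : ∀ a : Fin K, (Finset.univ.filter fun t => asg t = a).card ≤ P) (b : ℕ) :
    (g.pushers b).length ≤ P := by
  rcases hl : g.pushers b with - | ⟨e, l⟩
  · simp
  rw [← hl, ← List.length_map (f := Prod.fst), ← List.toFinset_card_of_nodup (hG.pushers_nodup b)]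
  refine le_trans (Finset.card_le_card ?_) (hP (asg e.1))
  intro t ht
  obtain ⟨e', he', rfl⟩ := List.mem_map.1 (List.mem_toFinset.1 ht)
  have h1 := hG.pushers_home b e' he'
  have h2 := hG.pushers_home b e (by rw [hl]; exact List.mem_cons_self)
  rw [h1] at h2
  simpa using h2

theorem Global.slot_ne_none (hG : Global asg m g)
    (hP : ∀ a : Fin K, (Finset.univ.filter fun t => asg t = a).card ≤ P) {b i : ℕ}
    (hi : i < (m.batches b).pushCountAtFreeze) : (m.batches b).slot i ≠ none := by
  have h1 := hG.pushers_length_le hP b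
  have h2 := hG.pushFreeze_le b
  rw [hG.pushCount] at h1
  have h3 : i < P := by omega
  simp [Batch.slot, h3]

/-- The aggregator of a batch that is not closed still points to it. -/
theorem Global.closed_iff (hG : Global asg m g) {b : ℕ} {a : Fin K} (hb : g.home b = some a) :
    Closed m b ↔ m.agg a ≠ b := by
  refine ⟨fun h => h.2 a, fun h => ⟨hG.home_lt b a hb, fun a' ha' => ?_⟩⟩
  have h1 := hG.home_agg a'
  rw [ha', hb] at h1
  injection h1 with h1
  exact h (h1 ▸ ha')

theorem PushTicket.home (hG : Global asg m g) {t : Fin n} {x b i : ℕ}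
    (hT : PushTicket m g t x b i) : g.home b = some (asg t) := by
  obtain ⟨v, hv, -⟩ := hT
  exact hG.pushers_home b _ (List.mem_of_getElem? hv)

theorem PopTicket.home (hG : Global asg m g) {t : Fin n} {b i : ℕ}
    (hT : PopTicket m g t b i) : g.home b = some (asg t) :=
  hG.poppers_home b _ (List.mem_of_getElem? hT.mem)

theorem Ticket.home (hG : Global asg m g) {t : Fin n} {c : Caller} {b i : ℕ}
    (hT : Ticket m g t c b i) : g.home b = some (asg t) := by
  cases c with
  | push x => exact PushTicket.home hG hT.1
  | pop => exact PopTicket.home hG hT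

/-- Thread `t` has no operation of the given kind in batch `b` that may still take effect there. -/
def Left (m : Mem V K P) (g : Ghost V n K) (t : Fin n) : Bool → ℕ → Prop
  | true, b => ∀ (i : ℕ) (e : Fin n × ℕ × V), (g.pushers b)[i]? = some e → e.1 = t →
      ¬ PushLive m g b i
  | false, b => ∀ i : ℕ, (g.poppers b)[i]? = some t → ¬ PopLive m g b i

theorem PushTicket.left (hG : Global asg m g) {t : Fin n} {x b i : ℕ}
    (hT : PushTicket m g t x b i) (hn : ¬ PushLive m g b i) : Left m g t true b := by
  obtain ⟨v, hv, -⟩ := hT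
  intro j e hj he
  rwa [hG.pusher_index_unique hj hv he]

theorem PopTicket.left (hG : Global asg m g) {t : Fin n} {b i : ℕ}
    (hT : PopTicket m g t b i) (hn : ¬ PopLive m g b i) : Left m g t false b := by
  intro j hj
  rwa [hG.popper_index_unique hj hT.mem]

theorem PCInv.freezing {t : Fin n} {pc : PC V} (hI : PCInv asg m g t pc) {b : ℕ}
    (hb : pc.freezing = some b) : Freezing asg m t b := by
  cases pc <;> simp only [PC.freezing, reduceCtorEq, Option.some.injEq] at hb <;> subst hb
  · exact hI.2
  · exact hI.2.1
  · exact hI.2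
  · exact hI.2.1
  · exact hI.2

theorem PCInv.pushTicket {t : Fin n} {pc : PC V} (hI : PCInv asg m g t pc) {b : ℕ}
    (hb : pc.batch = some (true, b)) : ∃ x i, PushTicket m g t x b i := by
  have key : ∀ (c : Caller) (b' i : ℕ), Ticket m g t c b' i → some (c.isPush, b') =
      some (true, b) → ∃ x i, PushTicket m g t x b i := by
    intro c b' i hT he
    cases c with
    | push x =>
      cases he
      exact ⟨x, i, hT.1⟩
    | pop => cases he
  cases pc with
  | freezerTest c b' i => exact key c b' i hI hb
  | freezeReadPop c b' i => exact key c b' i hI.1 hb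
  | freezeWritePop c b' i r => exact key c b' i hI.1 hb
  | freezeReadPush c b' i => exact key c b' i hI.1 hb
  | freezeWritePush c b' i r => exact key c b' i hI.1 hb
  | freezeNewBatch c b' i => exact key c b' i hI.1 hb
  | freezeWait c b' i => exact key c b' i hI hb
  | inclusionTest c b' i => exact key c b' i hI.1 hb
  | pushWrite x b' i => cases hb; exact ⟨x, i, hI⟩
  | pushElimTest b' i => cases hb; obtain ⟨x, h1, -⟩ := hI; exact ⟨x, i, h1.1⟩
  | pushCombinerTest b' i => cases hb; obtain ⟨x, h1, -⟩ := hI; exact ⟨x, i, h1.1⟩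
  | pushWaitApplied b' => cases hb; obtain ⟨x, i, h1, -⟩ := hI; exact ⟨x, i, h1⟩
  | ptsInit b' i => cases hb; obtain ⟨x, h1, -⟩ := hI; exact ⟨x, i, h1.1⟩
  | ptsLoop b' i => cases hb; obtain ⟨x, h1⟩ := hI.1.1; exact ⟨x, _, h1⟩
  | ptsWait b' i => cases hb; obtain ⟨x, h1⟩ := hI.1.1; exact ⟨x, _, h1⟩
  | ptsRead b' i => cases hb; obtain ⟨x, h1⟩ := hI.1.1; exact ⟨x, _, h1⟩
  | ptsLink b' i => cases hb; obtain ⟨x, h1⟩ := hI.1.1; exact ⟨x, _, h1⟩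
  | ptsReadTop b' => cases hb; obtain ⟨x, h1⟩ := hI.1.1; exact ⟨x, _, h1⟩
  | ptsSetBot b' => cases hb; obtain ⟨x, h1⟩ := hI.1.1; exact ⟨x, _, h1⟩
  | ptsCAS b' => cases hb; obtain ⟨x, h1⟩ := hI.1.1; exact ⟨x, _, h1⟩
  | _ => cases hb

theorem PCInv.popTicket {t : Fin n} {pc : PC V} (hI : PCInv asg m g t pc) {b : ℕ}
    (hb : pc.batch = some (false, b)) : ∃ i, PopTicket m g t b i := by
  have key : ∀ (c : Caller) (b' i : ℕ), Ticket m g t c b' i → some (c.isPush, b') =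
      some (false, b) → ∃ i, PopTicket m g t b i := by
    intro c b' i hT he
    cases c with
    | push x => cases he
    | pop =>
      cases he
      exact ⟨i, hT⟩
  cases pc with
  | freezerTest c b' i => exact key c b' i hI hb
  | freezeReadPop c b' i => exact key c b' i hI.1 hb
  | freezeWritePop c b' i r => exact key c b' i hI.1 hb
  | freezeReadPush c b' i => exact key c b' i hI.1 hb
  | freezeWritePush c b' i r => exact key c b' i hI.1 hb
  | freezeNewBatch c b' i => exact key c b' i hI.1 hb
  | freezeWait c b' i => exact key c b' i hI hb
  | inclusionTest c b' i => exact key c b' i hI.1 hb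
  | popElimTest b' i => cases hb; exact ⟨i, hI.1⟩
  | popElimWait b' i => cases hb; exact ⟨i, hI.1⟩
  | popElimRead b' i => cases hb; exact ⟨i, hI.1⟩
  | popCombinerTest b' i => cases hb; exact ⟨i, hI.1⟩
  | popWaitApplied b' i => cases hb; exact ⟨i, hI.1⟩
  | pfsReadTop b' i => cases hb; exact ⟨i, hI.1⟩
  | pfsLoop b' i => cases hb; exact ⟨i, hI.1.1⟩
  | pfsNext b' i => cases hb; exact ⟨i, hI.1.1⟩
  | pfsCAS b' i => cases hb; exact ⟨i, hI.1.1⟩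
  | _ => cases hb

end Tickets

/-! ### Linked lists of published nodes -/

section Chains

theorem Chain.unique {nodes : ℕ → Option (Node V)} {pub : Set ℕ} {p : Option ℕ} {l l' : List V}
    (h : Chain nodes pub p l) (h' : Chain nodes pub p l') : l = l' := by
  induction l generalizing p l' with
  | nil =>
    cases l' with
    | nil => rfl
    | cons v' l' =>
      obtain ⟨y, nxt, hy, -⟩ := h'
      rw [h] at hy
      cases hy
  | cons v l ih =>
    obtain ⟨y, nxt, hy, -, hn, hc⟩ := h
    cases l' with
    | nil =>
      rw [h'] at hy
      cases hy
    | cons v' l' =>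
      obtain ⟨y', nxt', hy', -, hn', hc'⟩ := h'
      rw [hy] at hy'
      injection hy' with hy'
      subst hy'
      rw [hn] at hn'
      simp only [Option.some.injEq, Node.mk.injEq] at hn'
      obtain ⟨rfl, rfl⟩ := hn'
      rw [ih hc hc']

theorem Chain.mono {nodes nodes' : ℕ → Option (Node V)} {pub pub' : Set ℕ} {p : Option ℕ}
    {l : List V} (h : Chain nodes pub p l) (hpub : pub ⊆ pub')
    (hn : ∀ x ∈ pub, nodes' x = nodes x) : Chain nodes' pub' p l := by
  induction l generalizing p with
  | nil => exact h
  | cons v l ih =>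
    obtain ⟨y, nxt, hy, hp, h1, hc⟩ := h
    exact ⟨y, nxt, hy, hpub hp, (hn y hp).trans h1, ih hc⟩

theorem Chain.eq_nil {nodes : ℕ → Option (Node V)} {pub : Set ℕ} {l : List V}
    (h : Chain nodes pub none l) : l = [] := by
  cases l with
  | nil => rfl
  | cons v l =>
    obtain ⟨y, nxt, hy, -⟩ := h
    cases hy

theorem Chain.of_some {nodes : ℕ → Option (Node V)} {pub : Set ℕ} {l : List V} {y : ℕ}
    (h : Chain nodes pub (some y) l) : ∃ v nxt l', l = v :: l' ∧ y ∈ pub ∧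
      nodes y = some ⟨v, nxt⟩ ∧ Chain nodes pub nxt l' := by
  cases l with
  | nil => cases h
  | cons v l =>
    obtain ⟨y', nxt, hy, h1, h2, h3⟩ := h
    injection hy with hy
    subst hy
    exact ⟨v, nxt, l, rfl, h1, h2, h3⟩

end Chains

/-! ### Preservation of the invariant -/

section Update

variable {asg : Fin n → Fin K} {s : Config V n K P} {h : List (Event (Fin n) (Op V) (Ret V))}
  {g g' : Ghost V n K} {t : Fin n} {m' : Mem V K P}
  {h' : List (Event (Fin n) (Op V) (Ret V))} {pc' : PC V}

/-- The invariant after a step of thread `t`. -/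
theorem Inv.update (hI : Inv asg s h g)
    (lin : LinExec stackSpec [] h' g'.stack g'.status) (glob : Global asg m' g')
    (frame : ∀ t', t' ≠ t → Frame asg t' (s.pc t') s.mem g m' g')
    (own : PCInv asg m' g' t pc')
    (pushLive : ∀ (b i : ℕ) (e : Fin n × ℕ × V), e.1 ≠ t → (g'.pushers b)[i]? = some e →
      PushLive m' g' b i → (g.pushers b)[i]? = some e ∧ PushLive s.mem g b i)
    (popLive : ∀ (b i : ℕ) (t' : Fin n), t' ≠ t → (g'.poppers b)[i]? = some t' →
      PopLive m' g' b i → (g.poppers b)[i]? = some t' ∧ PopLive s.mem g b i)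
    (ownPush : ∀ (b i : ℕ) (e : Fin n × ℕ × V), e.1 = t → (g'.pushers b)[i]? = some e →
      PushLive m' g' b i → pc'.batch = some (true, b))
    (ownPop : ∀ b i : ℕ, (g'.poppers b)[i]? = some t →
      PopLive m' g' b i → pc'.batch = some (false, b))
    (freezer : ∀ b, pc'.freezing = some b → ∀ t', t' ≠ t → (s.pc t').freezing ≠ some b) :
    Inv asg ⟨m', Function.update s.pc t pc'⟩ h' g' := by
  refine ⟨lin, glob, ?_, ?_, ?_, ?_⟩
  · intro t'
    by_cases ht : t' = t
    · subst ht
      simpa using own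
    · simp only [Function.update_of_ne ht]
      exact (frame t' ht).pcInv (hI.pcInv t')
  · intro b i e he hl
    by_cases ht : e.1 = t
    · simp only [ht, Function.update_self]
      exact ownPush b i e ht he hl
    · simp only [Function.update_of_ne ht]
      obtain ⟨h1, h2⟩ := pushLive b i e ht he hl
      exact hI.pushLive b i e h1 h2
  · intro b i t' he hl
    by_cases ht : t' = t
    · subst ht
      simp only [Function.update_self]
      exact ownPop b i he hl
    · simp only [Function.update_of_ne ht]
      obtain ⟨h1, h2⟩ := popLive b i t' ht he hl
      exact hI.popLive b i t' h1 h2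
  · intro t1 t2 b h1 h2
    by_cases ht1 : t1 = t <;> by_cases ht2 : t2 = t
    · rw [ht1, ht2]
    · subst ht1
      simp only [Function.update_self] at h1
      simp only [Function.update_of_ne ht2] at h2
      exact absurd h2 (freezer b h1 t2 ht2)
    · subst ht2
      simp only [Function.update_self] at h2
      simp only [Function.update_of_ne ht1] at h1
      exact absurd h1 (freezer b h2 t1 ht1)
    · simp only [Function.update_of_ne ht1] at h1
      simp only [Function.update_of_ne ht2] at h2
      exact hI.freezer t1 t2 b h1 h2

/-- The change from `m, g` to `m', g'` is made by thread `t`, and neither an operation of another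
thread takes effect nor a batch is closed. -/
structure Quiet (t : Fin n) (m : Mem V K P) (g : Ghost V n K) (m' : Mem V K P)
    (g' : Ghost V n K) : Prop where
  agg : m'.agg = m.agg
  numBatches : m'.numBatches = m.numBatches
  home : g'.home = g.home
  snap : g'.snap = g.snap
  published : g'.published = g.published
  status : ∀ t', t' ≠ t → g'.status t' = g.status t'
  pushers : ∀ (b i : ℕ) (e : Fin n × ℕ × V), (g.pushers b)[i]? = some e →
    (g'.pushers b)[i]? = some e
  newPushers : ∀ (b i : ℕ) (e : Fin n × ℕ × V), e.1 ≠ t → (g'.pushers b)[i]? = some e →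
    (g.pushers b)[i]? = some e
  poppers : ∀ (b i : ℕ) (t' : Fin n), (g.poppers b)[i]? = some t' →
    (g'.poppers b)[i]? = some t'
  newPoppers : ∀ (b i : ℕ) (t' : Fin n), t' ≠ t → (g'.poppers b)[i]? = some t' →
    (g.poppers b)[i]? = some t'
  owner : ∀ x a, g.owner x = some a → g'.owner x = some a
  pushFreeze : ∀ b, Closed m b →
    (m'.batches b).pushCountAtFreeze = (m.batches b).pushCountAtFreeze
  popFreeze : ∀ b, Closed m b →
    (m'.batches b).popCountAtFreeze = (m.batches b).popCountAtFreeze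
  pushCount : ∀ b, (m.batches b).pushCount ≤ (m'.batches b).pushCount
  popCount : ∀ b, (m.batches b).popCount ≤ (m'.batches b).popCount
  slot : ∀ b i x, (m.batches b).slot i = some (some x) → (m'.batches b).slot i = some (some x)
  decided : ∀ b, (m.batches b).isFreezerDecided = true → (m'.batches b).isFreezerDecided = true
  value : ∀ x N, m.nodes x = some N → ∃ N', m'.nodes x = some N' ∧ N'.value = N.value
  publishedNodes : ∀ x ∈ g.published, m'.nodes x = m.nodes x
  sub : ∀ b l, g.snap b = some l → IsStack m g (m.batches b).subStackTop l →
    IsStack m' g' (m'.batches b).subStackTop l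

theorem Quiet.closed_iff {m : Mem V K P} (hQ : Quiet t m g m' g') (b : ℕ) :
    Closed m' b ↔ Closed m b := by
  rw [Closed, Closed, hQ.agg, hQ.numBatches]

theorem Quiet.pushEffective_iff {m : Mem V K P} (hQ : Quiet t m g m' g') (b i : ℕ) :
    PushEffective m' g' b i ↔ PushEffective m g b i := by
  rw [PushEffective, PushEffective, hQ.closed_iff, hQ.snap]
  refine and_congr_right fun hc => ?_
  rw [hQ.pushFreeze b hc, hQ.popFreeze b hc]

theorem Quiet.popEffective_iff {m : Mem V K P} (hQ : Quiet t m g m' g') (b i : ℕ) :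
    PopEffective m' g' b i ↔ PopEffective m g b i := by
  rw [PopEffective, PopEffective, hQ.closed_iff, hQ.snap]
  refine and_congr_right fun hc => ?_
  rw [hQ.pushFreeze b hc, hQ.popFreeze b hc]

theorem Quiet.pushLive_iff {m : Mem V K P} (hQ : Quiet t m g m' g') (b i : ℕ) :
    PushLive m' g' b i ↔ PushLive m g b i := by
  rw [PushLive, PushLive, hQ.closed_iff, hQ.snap]
  refine forall_congr' fun hc => ?_
  rw [hQ.pushFreeze b hc, hQ.popFreeze b hc]

theorem Quiet.popLive_iff {m : Mem V K P} (hQ : Quiet t m g m' g') (b i : ℕ) :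
    PopLive m' g' b i ↔ PopLive m g b i := by
  rw [PopLive, PopLive, hQ.closed_iff, hQ.snap]
  refine forall_congr' fun hc => ?_
  rw [hQ.pushFreeze b hc, hQ.popFreeze b hc]

/-- A combiner starts with no change to the stack recorded, in particular while the batch is not
closed and the counts at freeze time may still change. -/
theorem Quiet.snap_eq_none {m : Mem V K P} (hQ : Quiet t m g m' g') (hG : Global asg m g)
    {b : ℕ} (hc : Closed m b → g.snap b = none) : g'.snap b = none := by
  rw [hQ.snap]
  by_contra h1
  exact h1 (hc (hG.snap_closed b h1))

theorem Quiet.pushTicket {m : Mem V K P} (hQ : Quiet t m g m' g') (hG : Global asg m g)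
    {t' : Fin n} (hst : g'.status t' = g.status t') {x b i : ℕ} (hT : PushTicket m g t' x b i) :
    PushTicket m' g' t' x b i := by
  obtain ⟨v, h1, h2, h3, h4⟩ := hT
  refine ⟨v, hQ.pushers _ _ _ h1, ?_, ?_, ?_⟩
  · rw [hQ.pushEffective_iff, hst]
    exact h2
  · rw [hQ.pushEffective_iff, hst, hQ.published]
    exact h3
  · intro h5 h6
    refine hQ.snap_eq_none hG fun hc => h4 ?_ ?_
    · rwa [hQ.popFreeze b hc] at h5
    · rwa [hQ.pushFreeze b hc] at h6

theorem Quiet.popTicket {m : Mem V K P} (hQ : Quiet t m g m' g') (hG : Global asg m g)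
    {t' : Fin n} (hst : g'.status t' = g.status t') {b i : ℕ} (hT : PopTicket m g t' b i) :
    PopTicket m' g' t' b i := by
  refine ⟨hQ.poppers _ _ _ hT.mem, ?_, ?_, ?_, ?_⟩
  · intro hc h1 h2 e he
    rw [hQ.closed_iff] at hc
    rw [hQ.popFreeze b hc] at h1
    rw [hQ.pushFreeze b hc] at h2
    obtain ⟨e', he'⟩ := hG.exists_pusher h2
    rw [hQ.pushers _ _ _ he'] at he
    injection he with he
    subst he
    rw [hst]
    exact hT.eliminated hc h1 h2 e' he'
  · intro hc h1 h2 l hl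
    rw [hQ.closed_iff] at hc
    rw [hQ.popFreeze b hc] at h1
    rw [hQ.pushFreeze b hc] at h2 ⊢
    rw [hQ.snap] at hl
    rw [hst]
    exact hT.combined hc h1 h2 l hl
  · rw [hQ.popEffective_iff, hst]
    exact hT.pending
  · intro h5 h6
    refine hQ.snap_eq_none hG fun hc => hT.combiner ?_ ?_
    · rwa [hQ.pushFreeze b hc] at h5
    · rwa [hQ.popFreeze b hc] at h6

theorem Quiet.ticket {m : Mem V K P} (hQ : Quiet t m g m' g') (hG : Global asg m g)
    {t' : Fin n} (hst : g'.status t' = g.status t') {c : Caller} {b i : ℕ}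
    (hT : Ticket m g t' c b i) : Ticket m' g' t' c b i := by
  cases c with
  | push x => exact ⟨hQ.pushTicket hG hst hT.1, hQ.slot b i x hT.2⟩
  | pop => exact hQ.popTicket hG hst hT

theorem Quiet.frame {m : Mem V K P} (hQ : Quiet t m g m' g') (hG : Global asg m g)
    {t' : Fin n} (ht : t' ≠ t) {pc : PC V}
    (linking : ∀ b, pc.linking = some b → PushCombiner m g t' b →
      ∀ (j : ℕ) (e : Fin n × ℕ × V), (m.batches b).popCountAtFreeze ≤ j →
        j < (m.batches b).pushCountAtFreeze →
        (g.pushers b)[j]? = some e → m'.nodes e.2.1 = m.nodes e.2.1) :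
    Frame asg t' pc m g m' g' where
  fresh _ c hc := by
    cases c with
    | push x =>
      obtain ⟨v, nx, h1, h2, h3, h4⟩ := hc
      obtain ⟨⟨v', nx'⟩, h5, h6⟩ := hQ.value x _ h1
      simp only at h6
      subst h6
      exact ⟨v', nx', h5, hQ.owner _ _ h2, by rwa [hQ.published], (hQ.status t' ht).trans h4⟩
    | pop => exact (hQ.status t' ht).trans hc
  status _ := hQ.status t' ht
  home b a hb := by rwa [hQ.home]
  absent c b hA := by
    cases c with
    | push x =>
      intro e he h1
      obtain ⟨i, hi⟩ := List.mem_iff_getElem?.1 he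
      exact hA e (List.mem_of_getElem? (hQ.newPushers b i e (h1 ▸ ht) hi)) h1
    | pop =>
      intro he
      obtain ⟨i, hi⟩ := List.mem_iff_getElem?.1 he
      exact hA (List.mem_of_getElem? (hQ.newPoppers b i t' ht hi))
  pushTicket x b i _ hT := hQ.pushTicket hG (hQ.status t' ht) hT
  popTicket b i _ hT := hQ.popTicket hG (hQ.status t' ht) hT
  pushers := hQ.pushers
  slot := hQ.slot
  closed b hc := (hQ.closed_iff b).2 hc
  pushFreeze := hQ.pushFreeze
  popFreeze := hQ.popFreeze
  snap b l hl := by rwa [hQ.snap]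
  freezing b _ hb := ⟨by rw [hQ.agg]; exact hb.1, hQ.decided b hb.2⟩
  pushCount b _ := hQ.pushCount b
  popCount b _ := hQ.popCount b
  linking := linking
  value := hQ.value
  chain p l hl := hl.mono (by rw [hQ.published]) hQ.publishedNodes
  sub := hQ.sub

/-- The invariant after a quiet step that announces no operation. -/
theorem Inv.quiet (hI : Inv asg s h g) (hQ : Quiet t s.mem g m' g')
    (pushers : g'.pushers = g.pushers) (poppers : g'.poppers = g.poppers)
    (lin : LinExec stackSpec [] h' g'.stack g'.status) (glob : Global asg m' g')
    (own : PCInv asg m' g' t pc')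
    (linking : ∀ t', t' ≠ t → ∀ b, (s.pc t').linking = some b → PushCombiner s.mem g t' b →
      ∀ (j : ℕ) (e : Fin n × ℕ × V), (s.mem.batches b).popCountAtFreeze ≤ j →
        j < (s.mem.batches b).pushCountAtFreeze →
        (g.pushers b)[j]? = some e → m'.nodes e.2.1 = s.mem.nodes e.2.1)
    (left : ∀ k b, (s.pc t).batch = some (k, b) → pc'.batch = some (k, b) ∨
      Left s.mem g t k b)
    (freezer : ∀ b, pc'.freezing = some b → ∀ t', t' ≠ t → (s.pc t').freezing ≠ some b) :
    Inv asg ⟨m', Function.update s.pc t pc'⟩ h' g' := by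
  refine hI.update lin glob (fun t' ht => hQ.frame hI.glob ht (linking t' ht)) own ?_ ?_ ?_ ?_
    freezer
  · intro b i e _ he hl
    exact ⟨by rwa [pushers] at he, (hQ.pushLive_iff b i).1 hl⟩
  · intro b i t' _ he hl
    exact ⟨by rwa [poppers] at he, (hQ.popLive_iff b i).1 hl⟩
  · intro b i e ht he hl
    rw [pushers] at he
    rw [hQ.pushLive_iff] at hl
    have h1 := hI.pushLive b i e he hl
    rw [ht] at h1
    rcases left _ _ h1 with h2 | h2
    · exact h2
    · exact absurd hl (h2 i e he ht)
  · intro b i he hl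
    rw [poppers] at he
    rw [hQ.popLive_iff] at hl
    have h1 := hI.popLive b i t he hl
    rcases left _ _ h1 with h2 | h2
    · exact h2
    · exact absurd hl (h2 i he)

/-- A step that changes nothing but the progress of the thread itself. -/
theorem Quiet.of_status (m : Mem V K P) (g : Ghost V n K) (t : Fin n)
    (st : Status (Op V) (Ret V)) :
    Quiet t m g m { g with status := Function.update g.status t st } := by
  constructor <;> intros <;> simp_all

theorem Global.congr_status {m : Mem V K P} (hG : Global asg m g)
    (st : Fin n → Status (Op V) (Ret V)) : Global asg m { g with status := st } :=
  { hG with }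

/-- A local step. -/
theorem Inv.local (hI : Inv asg s h g) {pc : PC V} (hp : s.pc t = pc)
    (own : PCInv asg s.mem g t pc')
    (left : ∀ k b, pc.batch = some (k, b) → pc'.batch = some (k, b) ∨ Left s.mem g t k b)
    (freezer : ∀ b, pc'.freezing = some b → pc.freezing = some b) :
    Inv asg ⟨s.mem, Function.update s.pc t pc'⟩ h g := by
  subst hp
  have hQ := Quiet.of_status s.mem g t (g.status t)
  rw [Function.update_eq_self] at hQ
  refine hI.quiet hQ rfl rfl hI.lin hI.glob own (fun _ _ _ _ _ _ _ _ _ _ => rfl) left ?_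
  intro b hb t' ht h1
  exact ht (hI.freezer t' t b h1 (freezer b hb))

@[simp]
theorem Mem.modBatch_self (m : Mem V K P) (b : ℕ) (f : Batch P → Batch P) :
    (m.modBatch b f).batches b = f (m.batches b) := by
  simp [Mem.modBatch]

@[simp]
theorem Mem.modBatch_of_ne (m : Mem V K P) {b b' : ℕ} (hb : b' ≠ b) (f : Batch P → Batch P) :
    (m.modBatch b f).batches b' = m.batches b' := by
  simp [Mem.modBatch, hb]

/-- A step that modifies a batch, but not its counters. -/
theorem Inv.modBatch (hI : Inv asg s h g) {pc : PC V} (hp : s.pc t = pc) {b : ℕ} {f : Batch P → Batch P} {B : Batch P}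
    (hB : f (s.mem.batches b) = B)
    (pushCount : B.pushCount = (s.mem.batches b).pushCount)
    (popCount : B.popCount = (s.mem.batches b).popCount)
    (pushFreeze_le : B.pushCountAtFreeze ≤ B.pushCount)
    (popFreeze_le : B.popCountAtFreeze ≤ B.popCount)
    (freeze : Closed s.mem b → B.pushCountAtFreeze = (s.mem.batches b).pushCountAtFreeze ∧
      B.popCountAtFreeze = (s.mem.batches b).popCountAtFreeze)
    (slot_mono : ∀ i x, (s.mem.batches b).slot i = some (some x) → B.slot i = some (some x))
    (slot : ∀ i x, B.slot i = some (some x) → ∃ e, (g.pushers b)[i]? = some e ∧ x = e.2.1)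
    (decided : (s.mem.batches b).isFreezerDecided = true → B.isFreezerDecided = true)
    (sub : ∀ l, g.snap b = some l → IsStack s.mem g (s.mem.batches b).subStackTop l →
      IsStack s.mem g B.subStackTop l)
    (applied : B.isBatchApplied = true → g.snap b ≠ none ∧
      (B.pushCountAtFreeze < B.popCountAtFreeze →
        ∃ l, g.snap b = some l ∧ IsStack s.mem g B.subStackTop l))
    (own : Quiet t s.mem g (s.mem.modBatch b f) g → PCInv asg (s.mem.modBatch b f) g t pc')
    (left : ∀ k b, pc.batch = some (k, b) → pc'.batch = some (k, b) ∨ Left s.mem g t k b)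
    (freezer : ∀ b, pc'.freezing = some b → ∀ t', t' ≠ t → (s.pc t').freezing ≠ some b) :
    Inv asg ⟨s.mem.modBatch b f, Function.update s.pc t pc'⟩ h g := by
  subst hp
  have hB' : (s.mem.modBatch b f).batches b = B := by rw [Mem.modBatch_self, hB]
  have hG := hI.glob
  have hQ : Quiet t s.mem g (s.mem.modBatch b f) g := by
    refine ⟨rfl, rfl, rfl, rfl, rfl, fun _ _ => rfl, fun _ _ _ h => h, fun _ _ _ _ h => h,
      fun _ _ _ h => h, fun _ _ _ _ h => h, fun _ _ h => h, ?_, ?_, ?_, ?_, ?_, ?_,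
      fun x N h => ⟨N, h, rfl⟩, fun _ _ => rfl, ?_⟩
    all_goals
      intro b'
      rcases eq_or_ne b' b with rfl | hb <;> [rw [hB']; rw [Mem.modBatch_of_ne _ hb]]
    · exact fun hc => (freeze hc).1
    · exact fun _ => rfl
    · exact fun hc => (freeze hc).2
    · exact fun _ => rfl
    · exact pushCount.ge
    · exact popCount.ge
    · exact slot_mono
    · exact fun _ _ h => h
    · exact decided
    · exact fun h => h
    · exact sub
    · exact fun _ _ h => h
  refine hI.quiet hQ rfl rfl hI.lin ?_ (own hQ) (fun _ _ _ _ _ _ _ _ _ _ => rfl) left freezer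
  refine { hG with
    pushCount := ?_, popCount := ?_, pushFreeze_le := ?_, popFreeze_le := ?_, slot := ?_,
    closed_decided := ?_, applied := ?_ }
  all_goals
    intro b'
    rcases eq_or_ne b' b with rfl | hb <;> [rw [hB']; rw [Mem.modBatch_of_ne _ hb]]
  · rw [pushCount]
    exact hG.pushCount b'
  · exact hG.pushCount b'
  · rw [popCount]
    exact hG.popCount b'
  · exact hG.popCount b'
  · exact pushFreeze_le
  · exact hG.pushFreeze_le b'
  · exact popFreeze_le
  · exact hG.popFreeze_le b'
  · exact slot
  · exact hG.slot b'
  · exact fun hc => decided (hG.closed_decided b' hc)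
  · exact hG.closed_decided b'
  · exact applied
  · exact hG.applied b'

end Update

/-! ### Local steps -/

section Step

variable {asg : Fin n → Fin K} {s : Config V n K P} {h : List (Event (Fin n) (Op V) (Ret V))}
  {g : Ghost V n K} {t : Fin n}

/-- The invariant holds, with suitable auxiliary data, after thread `t` has gone from control
state `pc` to the next one. -/
def StepOK (asg : Fin n → Fin K) (s : Config V n K P)
    (h : List (Event (Fin n) (Op V) (Ret V))) (t : Fin n) (pc : PC V) : Prop :=
  ∃ g', Inv asg ⟨(next (asg t) s.mem pc).1,
    Function.update s.pc t (next (asg t) s.mem pc).2⟩ h g'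

theorem not_pushLive {m : Mem V K P} {b i : ℕ} (hc : Closed m b)
    (hi : (m.batches b).popCountAtFreeze ≤ i → i < (m.batches b).pushCountAtFreeze →
      g.snap b = none → False) : ¬ PushLive m g b i :=
  fun hl => hi (hl hc).1 (hl hc).2.1 (hl hc).2.2

theorem not_popLive {m : Mem V K P} {b i : ℕ} (hc : Closed m b)
    (hi : (m.batches b).pushCountAtFreeze ≤ i → i < (m.batches b).popCountAtFreeze →
      g.snap b = none → False) : ¬ PopLive m g b i :=
  fun hl => hi (hl hc).1 (hl hc).2.1 (hl hc).2.2

theorem left_of_push {m : Mem V K P} {b : ℕ} (hL : Left m g t true b) {pc : PC V} (k : Bool)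
    (b' : ℕ) (hb : some (true, b) = some (k, b')) : pc.batch = some (k, b') ∨ Left m g t k b' := by
  cases hb
  exact Or.inr hL

theorem left_of_pop {m : Mem V K P} {b : ℕ} (hL : Left m g t false b) {pc : PC V} (k : Bool)
    (b' : ℕ) (hb : some (false, b) = some (k, b')) : pc.batch = some (k, b') ∨ Left m g t k b' := by
  cases hb
  exact Or.inr hL

theorem Inv.step_freezeWait (hI : Inv asg s h g) {c : Caller} {b i : ℕ}
    (hp : s.pc t = .freezeWait c b i) : StepOK asg s h t (.freezeWait c b i) := by
  have hpc := hI.pcInv t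
  rw [hp] at hpc
  refine ⟨g, hI.local hp ?_ ?_ ?_⟩ <;> simp only [next] <;> split
  · exact hpc
  · next hne => exact ⟨hpc, (hI.glob.closed_iff (Ticket.home hI.glob hpc)).2 (Ne.symm hne)⟩
  · exact fun k b hb => Or.inl hb
  · exact fun k b hb => Or.inl hb
  · exact fun b hb => hb
  · exact fun b hb => hb

theorem Inv.step_inclusionTest (hI : Inv asg s h g) {c : Caller} {b i : ℕ}
    (hp : s.pc t = .inclusionTest c b i) : StepOK asg s h t (.inclusionTest c b i) := by
  have hpc := hI.pcInv t
  rw [hp] at hpc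
  obtain ⟨hT, hc⟩ := hpc
  have hG := hI.glob
  cases c with
  | push x =>
    refine ⟨g, hI.local hp ?_ ?_ ?_⟩ <;> simp only [next] <;> split
    · next hi => exact ⟨x, hT, hc, hi⟩
    · next hi =>
      obtain ⟨v, hv, -, h2, -⟩ := hT.1
      have h3 := List.mem_of_getElem? hv
      obtain ⟨nx, h4⟩ := hG.pushers_node b _ h3
      obtain ⟨h5, h6⟩ := h2 fun he => hi he.2.1
      exact ⟨v, nx, h4, hG.pushers_owner b _ h3, h6, h5⟩
    · exact fun k b hb => Or.inl hb
    · next hi =>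
      exact left_of_push (hT.1.left hG (not_pushLive hc fun _ h1 _ => hi h1))
    · exact fun b hb => hb
    · exact fun b hb => hb
  | pop =>
    refine ⟨g, hI.local hp ?_ ?_ ?_⟩ <;> simp only [next] <;> split
    · next hi => exact ⟨hT, hc, hi⟩
    · next hi => exact PopTicket.pending hT fun he => hi he.2.1
    · exact fun k b hb => Or.inl hb
    · next hi =>
      exact left_of_pop (PopTicket.left hG hT (not_popLive hc fun _ h1 _ => hi h1))
    · exact fun b hb => hb
    · exact fun b hb => hb

theorem Inv.step_pushElimTest (hI : Inv asg s h g) {b i : ℕ}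
    (hp : s.pc t = .pushElimTest b i) : StepOK asg s h t (.pushElimTest b i) := by
  have hpc := hI.pcInv t
  rw [hp] at hpc
  obtain ⟨x, hT, hc, hi⟩ := hpc
  have hG := hI.glob
  refine ⟨g, hI.local hp ?_ ?_ ?_⟩ <;> simp only [next] <;> split
  · next hw => exact ⟨x, hT, hc, hi, hw⟩
  · next hw =>
    obtain ⟨v, -, h1, -⟩ := hT.1
    exact h1 ⟨hc, hi, Or.inl (not_le.1 hw)⟩
  · exact fun k b hb => Or.inl hb
  · next hw => exact left_of_push (hT.1.left hG (not_pushLive hc fun h1 _ _ => hw h1))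
  · exact fun b hb => hb
  · exact fun b hb => hb

theorem Inv.step_pushCombinerTest (hI : Inv asg s h g) {b i : ℕ}
    (hp : s.pc t = .pushCombinerTest b i) : StepOK asg s h t (.pushCombinerTest b i) := by
  have hpc := hI.pcInv t
  rw [hp] at hpc
  obtain ⟨x, hT, hc, hi, hw⟩ := hpc
  refine ⟨g, hI.local hp ?_ ?_ ?_⟩ <;> simp only [next] <;> split
  · next he => exact ⟨x, hT, hc, hi, he⟩
  · exact ⟨x, i, hT.1, hc, hi⟩
  · exact fun k b hb => Or.inl hb
  · exact fun k b hb => Or.inl hb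
  · exact fun b hb => hb
  · exact fun b hb => hb

theorem Inv.step_pushWaitApplied (hI : Inv asg s h g) {b : ℕ}
    (hp : s.pc t = .pushWaitApplied b) : StepOK asg s h t (.pushWaitApplied b) := by
  have hpc := hI.pcInv t
  rw [hp] at hpc
  obtain ⟨x, i, hT, hc, hi⟩ := id hpc
  have hG := hI.glob
  refine ⟨g, hI.local hp ?_ ?_ ?_⟩ <;> simp only [next] <;> split
  · next ha =>
    obtain ⟨v, -, h1, -⟩ := hT
    exact h1 ⟨hc, hi, Or.inr (hG.applied b ha).1⟩
  · exact hpc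
  · next ha =>
    exact left_of_push (hT.left hG (not_pushLive hc fun _ _ h1 => (hG.applied b ha).1 h1))
  · exact fun k b hb => Or.inl hb
  · exact fun b hb => hb
  · exact fun b hb => hb

theorem Inv.step_ptsInit (hI : Inv asg s h g) {b i : ℕ}
    (hp : s.pc t = .ptsInit b i) : StepOK asg s h t (.ptsInit b i) := by
  have hpc := hI.pcInv t
  rw [hp] at hpc
  obtain ⟨x, ⟨hT, hs⟩, hc, hi, rfl⟩ := hpc
  have hn : next (asg t) s.mem (.ptsInit b (s.mem.batches b).popCountAtFreeze) =
      (s.mem, .ptsLoop b (s.mem.batches b).popCountAtFreeze (some x) (some x)) := by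
    simp only [next, hs]
  rw [StepOK, hn]
  refine ⟨g, hI.local hp ?_ (fun k b hb => Or.inl hb) (fun b hb => hb)⟩
  obtain ⟨v, hv, -⟩ := id hT
  exact ⟨⟨⟨x, hT⟩, hc, hi⟩, hi, le_rfl, ⟨_, hv, rfl⟩, ⟨_, hv, rfl⟩, fun j h1 h2 => by omega⟩

theorem Inv.step_ptsLoop (hI : Inv asg s h g) {b i : ℕ} {top bot : Option ℕ}
    (hp : s.pc t = .ptsLoop b i top bot) : StepOK asg s h t (.ptsLoop b i top bot) := by
  have hpc := hI.pcInv t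
  rw [hp] at hpc
  obtain ⟨hC, hi, hw, hL⟩ := hpc
  refine ⟨g, hI.local hp ?_ ?_ ?_⟩ <;> simp only [next] <;> split
  · next h1 => exact ⟨hC, h1, i, rfl, hw, hL⟩
  · exact ⟨hC, i, by omega, hw, hL⟩
  · exact fun k b hb => Or.inl hb
  · exact fun k b hb => Or.inl hb
  · exact fun b hb => hb
  · exact fun b hb => hb

theorem Inv.step_ptsWait (hI : Inv asg s h g)
    (hP : ∀ a : Fin K, (Finset.univ.filter fun t => asg t = a).card ≤ P)
    {b i : ℕ} {top bot : Option ℕ}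
    (hp : s.pc t = .ptsWait b i top bot) : StepOK asg s h t (.ptsWait b i top bot) := by
  have hpc := hI.pcInv t
  rw [hp] at hpc
  obtain ⟨hC, hi, hL⟩ := id hpc
  refine ⟨g, ?_⟩
  rcases hs : (s.mem.batches b).slot i with - | - | x
  · exact absurd hs (hI.glob.slot_ne_none hP hi)
  · have hn : next (asg t) s.mem (.ptsWait b i top bot) = (s.mem, .ptsWait b i top bot) := by
      simp only [next, hs]
    rw [hn]
    exact hI.local hp hpc (fun k b hb => Or.inl hb) (fun b hb => hb)
  · have hn : next (asg t) s.mem (.ptsWait b i top bot) = (s.mem, .ptsRead b i top bot) := by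
      simp only [next, hs]
    rw [hn]
    exact hI.local hp ⟨hC, hi, hL, x, hs⟩ (fun k b hb => Or.inl hb) (fun b hb => hb)

theorem Inv.step_ptsRead (hI : Inv asg s h g) {b i : ℕ} {top bot : Option ℕ}
    (hp : s.pc t = .ptsRead b i top bot) : StepOK asg s h t (.ptsRead b i top bot) := by
  have hpc := hI.pcInv t
  rw [hp] at hpc
  obtain ⟨hC, hi, hL, x, hs⟩ := hpc
  have hn : next (asg t) s.mem (.ptsRead b i top bot) =
      (s.mem, .ptsLink b i (some x) top bot) := by
    simp only [next, hs]
  rw [StepOK, hn]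
  obtain ⟨e, he, rfl⟩ := hI.glob.slot b i x hs
  exact ⟨g, hI.local hp ⟨hC, hi, hL, e, he, rfl⟩ (fun k b hb => Or.inl hb) (fun b hb => hb)⟩

theorem Inv.step_popElimTest (hI : Inv asg s h g) {b i : ℕ}
    (hp : s.pc t = .popElimTest b i) : StepOK asg s h t (.popElimTest b i) := by
  have hpc := hI.pcInv t
  rw [hp] at hpc
  obtain ⟨hT, hc, hi⟩ := hpc
  refine ⟨g, hI.local hp ?_ ?_ ?_⟩ <;> simp only [next] <;> split
  · next hu => exact ⟨hT, hc, hi, hu⟩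
  · next hu => exact ⟨hT, hc, hi, not_lt.1 hu⟩
  · exact fun k b hb => Or.inl hb
  · exact fun k b hb => Or.inl hb
  · exact fun b hb => hb
  · exact fun b hb => hb

theorem Inv.step_popElimWait (hI : Inv asg s h g)
    (hP : ∀ a : Fin K, (Finset.univ.filter fun t => asg t = a).card ≤ P) {b i : ℕ}
    (hp : s.pc t = .popElimWait b i) : StepOK asg s h t (.popElimWait b i) := by
  have hpc := hI.pcInv t
  rw [hp] at hpc
  obtain ⟨hT, hc, hi, hu⟩ := id hpc
  refine ⟨g, ?_⟩
  rcases hs : (s.mem.batches b).slot i with - | - | x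
  · exact absurd hs (hI.glob.slot_ne_none hP hu)
  · have hn : next (asg t) s.mem (.popElimWait b i) = (s.mem, .popElimWait b i) := by
      simp only [next, hs]
    rw [hn]
    exact hI.local hp hpc (fun k b hb => Or.inl hb) (fun b hb => hb)
  · have hn : next (asg t) s.mem (.popElimWait b i) = (s.mem, .popElimRead b i) := by
      simp only [next, hs]
    rw [hn]
    exact hI.local hp ⟨hT, hc, hi, hu, x, hs⟩ (fun k b hb => Or.inl hb) (fun b hb => hb)

theorem Inv.step_popElimRead (hI : Inv asg s h g) {b i : ℕ}
    (hp : s.pc t = .popElimRead b i) : StepOK asg s h t (.popElimRead b i) := by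
  have hpc := hI.pcInv t
  rw [hp] at hpc
  obtain ⟨hT, hc, hi, hu, x, hs⟩ := hpc
  have hG := hI.glob
  have hn : next (asg t) s.mem (.popElimRead b i) = (s.mem, .popElimValue (some x)) := by
    simp only [next, hs]
  rw [StepOK, hn]
  obtain ⟨e, he, rfl⟩ := hG.slot b i x hs
  obtain ⟨nx, hnx⟩ := hG.pushers_node b e (List.mem_of_getElem? he)
  refine ⟨g, hI.local hp ⟨_, _, rfl, hnx, hT.eliminated hc hi hu e he⟩ ?_ (fun b hb => hb)⟩
  exact left_of_pop (hT.left hG (not_popLive hc fun h1 _ _ => by omega))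

theorem Inv.step_popElimValue (hI : Inv asg s h g) {y : Option ℕ}
    (hp : s.pc t = .popElimValue y) : StepOK asg s h t (.popElimValue y) := by
  have hpc := hI.pcInv t
  rw [hp] at hpc
  obtain ⟨x, N, rfl, hN, hst⟩ := hpc
  have hn : next (asg t) s.mem (.popElimValue (some x)) = (s.mem, .ret (.val N.value)) := by
    simp only [next, Option.bind_some, hN]
  rw [StepOK, hn]
  exact ⟨g, hI.local hp hst (fun k b hb => Or.inl hb) (fun b hb => hb)⟩

theorem Inv.step_peekValue (hI : Inv asg s h g) {y : Option ℕ}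
    (hp : s.pc t = .peekValue y) : StepOK asg s h t (.peekValue y) := by
  have hpc := hI.pcInv t
  rw [hp] at hpc
  obtain ⟨x, N, rfl, hN, hst⟩ := hpc
  have hn : next (asg t) s.mem (.peekValue (some x)) = (s.mem, .ret (.val N.value)) := by
    simp only [next, Option.bind_some, hN]
  rw [StepOK, hn]
  exact ⟨g, hI.local hp hst (fun k b hb => Or.inl hb) (fun b hb => hb)⟩

theorem Inv.step_popCombinerTest (hI : Inv asg s h g) {b i : ℕ}
    (hp : s.pc t = .popCombinerTest b i) : StepOK asg s h t (.popCombinerTest b i) := by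
  have hpc := hI.pcInv t
  rw [hp] at hpc
  obtain ⟨hT, hc, hi, hu⟩ := hpc
  refine ⟨g, hI.local hp ?_ ?_ ?_⟩ <;> simp only [next] <;> split
  · next he => exact ⟨hT, hc, he, hi⟩
  · exact ⟨hT, hc, hi, hu⟩
  · exact fun k b hb => Or.inl hb
  · exact fun k b hb => Or.inl hb
  · exact fun b hb => hb
  · exact fun b hb => hb

theorem Inv.step_popWaitApplied (hI : Inv asg s h g) {b i : ℕ}
    (hp : s.pc t = .popWaitApplied b i) : StepOK asg s h t (.popWaitApplied b i) := by
  have hpc := hI.pcInv t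
  rw [hp] at hpc
  obtain ⟨hT, hc, hi, hu⟩ := id hpc
  have hG := hI.glob
  refine ⟨g, hI.local hp ?_ ?_ ?_⟩ <;> simp only [next] <;> split
  · next ha =>
    obtain ⟨l, hl, hS⟩ := (hG.applied b ha).2 (hu.trans_lt hi)
    exact ⟨l, hl, hS, hc, hT.combined hc hi hu l hl⟩
  · exact hpc
  · next ha =>
    exact left_of_pop (hT.left hG (not_popLive hc fun _ _ h1 => (hG.applied b ha).1 h1))
  · exact fun k b hb => Or.inl hb
  · exact fun b hb => hb
  · exact fun b hb => hb

theorem Inv.step_gvLoop (hI : Inv asg s h g) {k : ℕ} {temp : Option ℕ}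
    (hp : s.pc t = .gvLoop k temp) : StepOK asg s h t (.gvLoop k temp) := by
  have hpc := hI.pcInv t
  rw [hp] at hpc
  obtain ⟨l, hS, hst⟩ := hpc
  refine ⟨g, ?_⟩
  cases temp with
  | none =>
    obtain rfl := hS.eq_nil
    have hn : next (asg t) s.mem (.gvLoop k none) = (s.mem, .ret .empty) := by
      cases k <;> simp only [next]
    rw [hn]
    exact hI.local hp hst (fun k b hb => Or.inl hb) (fun b hb => hb)
  | some y =>
    obtain ⟨v, nxt, l', rfl, -, hN, hS'⟩ := hS.of_some
    cases k with
    | zero =>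
      have hn : next (asg t) s.mem (.gvLoop 0 (some y)) = (s.mem, .ret (.val v)) := by
        simp only [next, hN]
      rw [hn]
      exact hI.local hp hst (fun k b hb => Or.inl hb) (fun b hb => hb)
    | succ k =>
      have hn : next (asg t) s.mem (.gvLoop (k + 1) (some y)) = (s.mem, .gvLoop k nxt) := by
        simp only [next, hN]
      rw [hn]
      exact hI.local hp ⟨l', hS', hst⟩ (fun k b hb => Or.inl hb) (fun b hb => hb)

theorem Inv.step_pfsLoop (hI : Inv asg s h g) {b i j : ℕ} {top bot : Option ℕ}
    (hp : s.pc t = .pfsLoop b i j top bot) : StepOK asg s h t (.pfsLoop b i j top bot) := by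
  have hpc := hI.pcInv t
  rw [hp] at hpc
  obtain ⟨hC, hij, hj, l, h1, h2⟩ := hpc
  refine ⟨g, hI.local hp ?_ ?_ ?_⟩ <;> simp only [next] <;> split
  · next hw => exact ⟨hC, j, rfl, hij, hw, l, h1, h2⟩
  · next hw =>
    obtain rfl : j = (s.mem.batches b).popCountAtFreeze := by omega
    exact ⟨hC, l, h1, h2⟩
  · exact fun k b hb => Or.inl hb
  · exact fun k b hb => Or.inl hb
  · exact fun b hb => hb
  · exact fun b hb => hb

theorem Inv.step_pfsNext (hI : Inv asg s h g) {b i j : ℕ} {top bot : Option ℕ}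
    (hp : s.pc t = .pfsNext b i j top bot) : StepOK asg s h t (.pfsNext b i j top bot) := by
  have hpc := hI.pcInv t
  rw [hp] at hpc
  obtain ⟨hC, k, rfl, hik, hk, l, h1, h2⟩ := hpc
  refine ⟨g, ?_⟩
  cases bot with
  | none =>
    -- the stack is exhausted, and longer suffixes of its contents are empty as well
    have h3 := List.drop_eq_nil_iff.1 h2.eq_nil
    have h4 : l.drop ((s.mem.batches b).popCountAtFreeze - i) = [] :=
      List.drop_eq_nil_iff.2 (by omega)
    exact hI.local hp ⟨hC, l, h1, by rw [h4]; rfl⟩ (fun k b hb => Or.inl hb) (fun b hb => hb)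
  | some y =>
    obtain ⟨v, nxt, l', hl', -, hN, hS'⟩ := h2.of_some
    have hn : next (asg t) s.mem (.pfsNext b i (k + 1) top (some y)) =
        (s.mem, .pfsLoop b i (k + 1) top nxt) := by
      simp only [next, hN]
    rw [hn]
    refine hI.local hp ⟨hC, by omega, hk, l, h1, ?_⟩ (fun k b hb => Or.inl hb) (fun b hb => hb)
    have h5 : l.drop (k + 1 - i) = l' := by
      rw [Nat.succ_sub hik, Nat.succ_eq_add_one, ← List.drop_drop, hl']
      rfl
    rwa [h5]

end Step

/-! ### Participants of a batch -/

section Participants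

variable {asg : Fin n → Fin K} {s : Config V n K P} {h : List (Event (Fin n) (Op V) (Ret V))}
  {g : Ghost V n K}

/-- A push that may still take effect in its batch is pending there, and its node is not
published. -/
theorem Inv.live_pusher (hI : Inv asg s h g) {b i : ℕ} {e : Fin n × ℕ × V}
    (he : (g.pushers b)[i]? = some e) (hl : PushLive s.mem g b i) :
    (s.pc e.1).batch = some (true, b) ∧ g.status e.1 = .pending (.push e.2.2) ∧
      e.2.1 ∉ g.published := by
  have hb := hI.pushLive b i e he hl
  refine ⟨hb, ?_⟩
  obtain ⟨t, x, v⟩ := e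
  obtain ⟨x', i', v', hv, -, h2, -⟩ := (hI.pcInv t).pushTicket hb
  obtain rfl := hI.glob.pusher_index_unique he hv rfl
  rw [he] at hv
  simp only [Option.some.injEq, Prod.mk.injEq, true_and] at hv
  obtain ⟨rfl, rfl⟩ := hv
  refine h2 fun hE => ?_
  obtain ⟨h3, h4, h5⟩ := hl hE.1
  rcases hE.2.2 with h6 | h6
  · omega
  · exact h6 h5

/-- A pop that may still take effect in its batch is pending there. -/
theorem Inv.live_popper (hI : Inv asg s h g) {b i : ℕ} {t : Fin n}
    (ht : (g.poppers b)[i]? = some t) (hl : PopLive s.mem g b i) :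
    (s.pc t).batch = some (false, b) ∧ g.status t = .pending .pop := by
  have hb := hI.popLive b i t ht hl
  refine ⟨hb, ?_⟩
  obtain ⟨i', hT⟩ := (hI.pcInv t).popTicket hb
  obtain rfl := hI.glob.popper_index_unique ht hT.mem
  refine hT.pending fun hE => ?_
  obtain ⟨h3, h4, h5⟩ := hl hE.1
  rcases hE.2.2 with h6 | h6
  · omega
  · exact h6 h5

theorem Global.pusher_thread_eq {m : Mem V K P} (hG : Global asg m g) {b b' i i' : ℕ}
    {e e' : Fin n × ℕ × V} (he : (g.pushers b)[i]? = some e) (he' : (g.pushers b')[i']? = some e')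
    (hx : e.2.1 = e'.2.1) : e.1 = e'.1 := by
  have h1 := hG.pushers_owner b e (List.mem_of_getElem? he)
  have h2 := hG.pushers_owner b' e' (List.mem_of_getElem? he')
  rw [hx, h2] at h1
  injection h1 with h1
  exact h1.symm

theorem PushCombiner.snap_eq_none {m : Mem V K P} {t : Fin n} {b : ℕ}
    (hC : PushCombiner m g t b) : g.snap b = none := by
  obtain ⟨⟨x, v, -, -, -, h1⟩, -, h2⟩ := hC
  exact h1 rfl h2

theorem PopCombiner.snap_eq_none {m : Mem V K P} {t : Fin n} {b i : ℕ}
    (hC : PopCombiner m g t b i) : g.snap b = none :=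
  hC.1.combiner hC.2.2.1 hC.2.2.2

theorem PushCombiner.live {m : Mem V K P} {t : Fin n} {b : ℕ} (hC : PushCombiner m g t b) {j : ℕ}
    (hw : (m.batches b).popCountAtFreeze ≤ j) (hu : j < (m.batches b).pushCountAtFreeze) :
    PushLive m g b j :=
  fun _ => ⟨hw, hu, hC.snap_eq_none⟩

theorem PopCombiner.live {m : Mem V K P} {t : Fin n} {b i : ℕ} (hC : PopCombiner m g t b i) {j : ℕ}
    (hw : (m.batches b).pushCountAtFreeze ≤ j) (hu : j < (m.batches b).popCountAtFreeze) :
    PopLive m g b j :=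
  fun _ => ⟨hw, hu, hC.snap_eq_none⟩

/-- The combiners of distinct threads are in charge of disjoint sets of nodes. -/
theorem Inv.combiner_nodes_disjoint (hI : Inv asg s h g) {t t' : Fin n} (ht : t' ≠ t)
    {b b' j j' : ℕ} {e e' : Fin n × ℕ × V}
    (hC : PushCombiner s.mem g t b) (hw : (s.mem.batches b).popCountAtFreeze ≤ j)
    (hu : j < (s.mem.batches b).pushCountAtFreeze) (he : (g.pushers b)[j]? = some e)
    (hC' : PushCombiner s.mem g t' b') (hw' : (s.mem.batches b').popCountAtFreeze ≤ j')
    (hu' : j' < (s.mem.batches b').pushCountAtFreeze) (he' : (g.pushers b')[j']? = some e') :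
    e'.2.1 ≠ e.2.1 := by
  intro hx
  have h1 := hI.glob.pusher_thread_eq he' he hx
  have h2 := (hI.live_pusher he (hC.live hw hu)).1
  have h3 := (hI.live_pusher he' (hC'.live hw' hu')).1
  rw [h1, h2] at h3
  obtain rfl : b = b' := by simpa using h3
  obtain ⟨x, v, hv, -⟩ := hC.1
  obtain ⟨x', v', hv', -⟩ := hC'.1
  rw [hv] at hv'
  simp only [Option.some.injEq, Prod.mk.injEq] at hv'
  exact ht hv'.1.symm

end Participants

/-! ### Announcing an operation and choosing the freezer -/

section Step

variable {asg : Fin n → Fin K} {s : Config V n K P} {h : List (Event (Fin n) (Op V) (Ret V))}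
  {g : Ghost V n K} {t : Fin n}

theorem Inv.step_getBatch (hI : Inv asg s h g) {c : Caller}
    (hp : s.pc t = .getBatch c) : StepOK asg s h t (.getBatch c) := by
  have hpc := hI.pcInv t
  rw [hp] at hpc
  have hopen : ¬ Closed s.mem (s.mem.agg (asg t)) := fun hc => hc.2 (asg t) rfl
  refine ⟨g, hI.local hp ⟨hpc, hI.glob.home_agg _, ?_⟩ (fun k b hb => Or.inl hb)
    (fun b hb => hb)⟩
  cases c with
  | push x =>
    intro e he h1
    obtain ⟨i, hi⟩ := List.mem_iff_getElem?.1 he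
    have h2 := hI.pushLive _ i e hi fun hc => absurd hc hopen
    rw [h1, hp] at h2
    cases h2
  | pop =>
    intro he
    obtain ⟨i, hi⟩ := List.mem_iff_getElem?.1 he
    have h2 := hI.popLive _ i t hi fun hc => absurd hc hopen
    rw [hp] at h2
    cases h2

theorem Inv.step_pushAlloc (hI : Inv asg s h g) {v : V}
    (hp : s.pc t = .pushAlloc v) : StepOK asg s h t (.pushAlloc v) := by
  have hpc := hI.pcInv t
  rw [hp] at hpc
  have hG := hI.glob
  have hne : ∀ x N, s.mem.nodes x = some N → x ≠ s.mem.numNodes :=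
    fun x N hx => (hG.nodes_lt x N hx).ne
  have hpub : ∀ x ∈ g.published, x ≠ s.mem.numNodes := fun x hx => (hG.published_lt x hx).ne
  let m' : Mem V K P := { s.mem with
    nodes := Function.update s.mem.nodes s.mem.numNodes (some ⟨v, none⟩)
    numNodes := s.mem.numNodes + 1 }
  let g' : Ghost V n K := { g with owner := Function.update g.owner s.mem.numNodes (some t) }
  have hnodes : ∀ x, x ≠ s.mem.numNodes → m'.nodes x = s.mem.nodes x :=
    fun x hx => Function.update_of_ne hx _ _
  have hchain : ∀ p l, IsStack s.mem g p l → IsStack m' g' p l :=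
    fun p l hl => hl.mono (fun _ hx => hx) fun x hx => hnodes x (hpub x hx)
  have howner : ∀ x a, g.owner x = some a → g'.owner x = some a := by
    intro x a hx
    rw [← hx]
    exact Function.update_of_ne (hG.owner_lt x a hx).ne _ _
  refine ⟨g', hI.quiet (m' := m') (g' := g') ?_ rfl rfl hI.lin ?_ ?_ ?_ ?_ ?_⟩
  · exact ⟨rfl, rfl, rfl, rfl, rfl, fun _ _ => rfl, fun _ _ _ h => h, fun _ _ _ _ h => h,
      fun _ _ _ h => h, fun _ _ _ _ h => h, howner, fun _ _ => rfl, fun _ _ => rfl,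
      fun _ => le_rfl, fun _ => le_rfl, fun _ _ _ h => h, fun _ h => h,
      fun x N hx => ⟨N, (hnodes x (hne x N hx)).trans hx, rfl⟩,
      fun x hx => hnodes x (hpub x hx), fun b l _ hl => hchain _ _ hl⟩
  · refine { hG with
      pushers_owner := fun b e he => howner _ _ (hG.pushers_owner b e he)
      pushers_node := fun b e he => ?_
      applied := fun b hb => ?_
      stack := hchain _ _ hG.stack
      nodes_lt := fun x N hx => ?_
      owner_lt := fun x a hx => ?_
      published_lt := fun x hx => (hG.published_lt x hx).trans (Nat.lt_succ_self _) }
    · obtain ⟨nx, hnx⟩ := hG.pushers_node b e he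
      exact ⟨nx, (hnodes _ (hne _ _ hnx)).trans hnx⟩
    · obtain ⟨h1, h2⟩ := hG.applied b hb
      refine ⟨h1, fun h3 => ?_⟩
      obtain ⟨l, hl, h4⟩ := h2 h3
      exact ⟨l, hl, hchain _ _ h4⟩
    · by_cases hxn : x = s.mem.numNodes
      · subst hxn
        exact Nat.lt_succ_self _
      · rw [hnodes x hxn] at hx
        exact (hG.nodes_lt x N hx).trans (Nat.lt_succ_self _)
    · by_cases hxn : x = s.mem.numNodes
      · subst hxn
        exact Nat.lt_succ_self _
      · exact (hG.owner_lt x a (((Function.update_of_ne hxn _ _).symm.trans hx))).trans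
          (Nat.lt_succ_self _)
  · exact ⟨v, none, Function.update_self _ _ _, Function.update_self _ _ _,
      fun hx => (hpub _ hx) rfl, hpc⟩
  · intro t' ht b _ _ j e _ _ he
    obtain ⟨nx, hnx⟩ := hG.pushers_node b e (List.mem_of_getElem? he)
    exact hnodes _ (hne _ _ hnx)
  · intro k b hb
    rw [hp] at hb
    cases hb
  · intro b hb
    cases hb

theorem getElem?_update_concat {α : Type*} (f : ℕ → List α) (b b' i : ℕ) (a y : α) :
    (Function.update f b (f b ++ [a]) b')[i]? = some y ↔
      (f b')[i]? = some y ∨ (b' = b ∧ i = (f b).length ∧ a = y) := by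
  by_cases hb : b' = b
  · subst hb
    rw [Function.update_self, getElem?_concat_eq_some]
    simp
  · rw [Function.update_of_ne hb]
    simp [hb]

theorem mem_update_concat {α : Type*} {f : ℕ → List α} {b b' : ℕ} {a y : α}
    (hy : y ∈ Function.update f b (f b ++ [a]) b') : y ∈ f b' ∨ (b' = b ∧ y = a) := by
  by_cases hb : b' = b
  · subst hb
    rw [Function.update_self] at hy
    simpa using hy
  · rw [Function.update_of_ne hb] at hy
    exact Or.inl hy

theorem Inv.step_announce_push (hI : Inv asg s h g) {x b : ℕ}
    (hp : s.pc t = .announce (.push x) b) : StepOK asg s h t (.announce (.push x) b) := by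
  have hpc := hI.pcInv t
  rw [hp] at hpc
  obtain ⟨⟨v, nx, hnx, hown, hpub, hst⟩, hhome, habs⟩ := hpc
  have hG := hI.glob
  let f : Batch P → Batch P := fun B => { B with pushCount := B.pushCount + 1 }
  let g' : Ghost V n K :=
    { g with pushers := Function.update g.pushers b (g.pushers b ++ [(t, x, v)]) }
  have hpush := getElem?_update_concat g.pushers b
  have hlen := hG.pushCount b
  have hle := hG.pushFreeze_le b
  have hQ : Quiet t s.mem g (s.mem.modBatch b f) g' := by
    refine ⟨rfl, rfl, rfl, rfl, rfl, fun _ _ => rfl,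
      fun b' i e he => (hpush b' i _ e).2 (Or.inl he), ?_,
      fun _ _ _ h => h, fun _ _ _ _ h => h, fun _ _ h => h, ?_, ?_, ?_, ?_, ?_, ?_,
      fun x N h => ⟨N, h, rfl⟩, fun _ _ => rfl, ?_⟩
    · intro b' i e ht he
      rcases (hpush b' i _ e).1 he with h1 | ⟨-, -, rfl⟩
      · exact h1
      · exact absurd rfl ht
    all_goals
      intro b'
      rcases eq_or_ne b' b with rfl | hb <;>
        [rw [Mem.modBatch_self]; rw [Mem.modBatch_of_ne _ hb]]
    · exact fun _ => rfl
    · exact fun _ => rfl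
    · exact fun _ => rfl
    · exact fun _ => rfl
    · exact Nat.le_succ _
    · exact fun _ _ h => h
    · exact fun _ _ h => h
    · exact fun h => h
    · exact fun h => h
    · exact fun _ _ h => h
    · exact fun _ _ h => h
  refine ⟨g', hI.update (m' := s.mem.modBatch b f) (g' := g') hI.lin ?_ ?_ ?_ ?_ ?_ ?_ ?_ ?_⟩
  · have hhome' : ∀ b', ∀ e ∈ g'.pushers b', g.home b' = some (asg e.1) := by
      intro b' e he
      rcases mem_update_concat he with h1 | ⟨rfl, rfl⟩
      · exact hG.pushers_home b' e h1
      · exact hhome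
    have hown' : ∀ b', ∀ e ∈ g'.pushers b', g.owner e.2.1 = some e.1 := by
      intro b' e he
      rcases mem_update_concat he with h1 | ⟨rfl, rfl⟩
      · exact hG.pushers_owner b' e h1
      · exact hown
    have hnode' : ∀ b', ∀ e ∈ g'.pushers b', ∃ nx, s.mem.nodes e.2.1 = some ⟨e.2.2, nx⟩ := by
      intro b' e he
      rcases mem_update_concat he with h1 | ⟨rfl, rfl⟩
      · exact hG.pushers_node b' e h1
      · exact ⟨nx, hnx⟩
    have hnodup' : ∀ b', ((g'.pushers b').map Prod.fst).Nodup := by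
      intro b'
      by_cases hb : b' = b
      · subst hb
        simp only [g', Function.update_self, List.map_append, List.map_cons, List.map_nil]
        refine List.nodup_append.2 ⟨hG.pushers_nodup b', by simp, ?_⟩
        rintro t1 h1 t2 h2 rfl
        obtain ⟨e, he, rfl⟩ := List.mem_map.1 h1
        exact habs e he (by simpa using h2)
      · simp only [g', Function.update_of_ne hb]
        exact hG.pushers_nodup b'
    have hslot' : ∀ b' i y, ((s.mem.modBatch b f).batches b').slot i = some (some y) →
        ∃ e, (g'.pushers b')[i]? = some e ∧ y = e.2.1 := by
      intro b' i y hy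
      have h1 : (s.mem.batches b').slot i = some (some y) := by
        rcases eq_or_ne b' b with rfl | hb
        · rwa [Mem.modBatch_self] at hy
        · rwa [Mem.modBatch_of_ne _ hb] at hy
      obtain ⟨e, he, h2⟩ := hG.slot b' i y h1
      exact ⟨e, (hpush b' i _ e).2 (Or.inl he), h2⟩
    refine { hG with
      pushers_home := hhome', pushers_owner := hown', pushers_node := hnode',
      pushers_nodup := hnodup', slot := hslot'
      pushCount := ?_, popCount := ?_, pushFreeze_le := ?_, popFreeze_le := ?_
      closed_decided := ?_, applied := ?_ }
    all_goals
      intro b'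
      rcases eq_or_ne b' b with rfl | hb <;>
        [rw [Mem.modBatch_self]; rw [Mem.modBatch_of_ne _ hb]]
    · simp [g', f, hlen]
    · simp only [g', Function.update_of_ne hb]
      exact hG.pushCount b'
    · exact hG.popCount b'
    · exact hG.popCount b'
    · exact hle.trans (Nat.le_succ _)
    · exact hG.pushFreeze_le b'
    · exact hG.popFreeze_le b'
    · exact hG.popFreeze_le b'
    · exact hG.closed_decided b'
    · exact hG.closed_decided b'
    · exact hG.applied b'
    · exact hG.applied b'
  · exact fun t' ht => hQ.frame hG ht fun _ _ _ _ _ _ _ _ => rfl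
  · refine ⟨v, (hpush b _ _ _).2 (Or.inr ⟨rfl, hlen.symm, rfl⟩), ?_, fun _ => ⟨hst, hpub⟩, ?_⟩
    · intro hE
      have h1 := hE.2.1
      rw [Mem.modBatch_self] at h1
      simp only [f] at h1
      omega
    · intro _ h1
      rw [Mem.modBatch_self] at h1
      simp only [f] at h1
      omega
  · intro b' i e ht he hl
    exact ⟨hQ.newPushers b' i e ht he, (hQ.pushLive_iff b' i).1 hl⟩
  · intro b' i t' _ he hl
    exact ⟨he, (hQ.popLive_iff b' i).1 hl⟩
  · intro b' i e ht he hl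
    rcases (hpush b' i _ e).1 he with h1 | ⟨rfl, -, -⟩
    · have h2 := hI.pushLive b' i e h1 ((hQ.pushLive_iff b' i).1 hl)
      rw [ht, hp] at h2
      cases h2
    · rfl
  · intro b' i he hl
    have h2 := hI.popLive b' i t he ((hQ.popLive_iff b' i).1 hl)
    rw [hp] at h2
    cases h2
  · intro b' hb
    cases hb

theorem Inv.step_announce_pop (hI : Inv asg s h g) {b : ℕ}
    (hp : s.pc t = .announce .pop b) : StepOK asg s h t (.announce .pop b) := by
  have hpc := hI.pcInv t
  rw [hp] at hpc
  obtain ⟨hst, hhome, habs⟩ := hpc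
  have hG := hI.glob
  let f : Batch P → Batch P := fun B => { B with popCount := B.popCount + 1 }
  let g' : Ghost V n K :=
    { g with poppers := Function.update g.poppers b (g.poppers b ++ [t]) }
  have hpop := getElem?_update_concat g.poppers b
  have hlen := hG.popCount b
  have hle := hG.popFreeze_le b
  have hQ : Quiet t s.mem g (s.mem.modBatch b f) g' := by
    refine ⟨rfl, rfl, rfl, rfl, rfl, fun _ _ => rfl,
      fun _ _ _ h => h, fun _ _ _ _ h => h,
      fun b' i e he => (hpop b' i _ e).2 (Or.inl he), ?_,
      fun _ _ h => h, ?_, ?_, ?_, ?_, ?_, ?_,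
      fun x N h => ⟨N, h, rfl⟩, fun _ _ => rfl, ?_⟩
    · intro b' i e ht he
      rcases (hpop b' i _ e).1 he with h1 | ⟨-, -, rfl⟩
      · exact h1
      · exact absurd rfl ht
    all_goals
      intro b'
      rcases eq_or_ne b' b with rfl | hb <;>
        [rw [Mem.modBatch_self]; rw [Mem.modBatch_of_ne _ hb]]
    · exact fun _ => rfl
    · exact fun _ => rfl
    · exact fun _ => rfl
    · exact fun _ => rfl
    · exact Nat.le_succ _
    · exact fun _ _ h => h
    · exact fun _ _ h => h
    · exact fun h => h
    · exact fun h => h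
    · exact fun _ _ h => h
    · exact fun _ _ h => h
  refine ⟨g', hI.update (m' := s.mem.modBatch b f) (g' := g') hI.lin ?_ ?_ ?_ ?_ ?_ ?_ ?_ ?_⟩
  · have hhome' : ∀ b', ∀ t' ∈ g'.poppers b', g.home b' = some (asg t') := by
      intro b' t' he
      rcases mem_update_concat he with h1 | ⟨rfl, rfl⟩
      · exact hG.poppers_home b' t' h1
      · exact hhome
    have hnodup' : ∀ b', (g'.poppers b').Nodup := by
      intro b'
      by_cases hb : b' = b
      · subst hb
        simp only [g', Function.update_self]
        refine List.nodup_append.2 ⟨hG.poppers_nodup b', by simp, ?_⟩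
        rintro t1 h1 t2 h2 rfl
        rw [List.mem_singleton] at h2
        subst h2
        exact habs h1
      · simp only [g', Function.update_of_ne hb]
        exact hG.poppers_nodup b'
    refine { hG with
      poppers_home := hhome', poppers_nodup := hnodup'
      pushCount := ?_, popCount := ?_, pushFreeze_le := ?_, popFreeze_le := ?_, slot := ?_
      closed_decided := ?_, applied := ?_ }
    all_goals
      intro b'
      rcases eq_or_ne b' b with rfl | hb <;>
        [rw [Mem.modBatch_self]; rw [Mem.modBatch_of_ne _ hb]]
    · exact hG.pushCount b'
    · exact hG.pushCount b'
    · simp [g', f, hlen]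
    · simp only [g', Function.update_of_ne hb]
      exact hG.popCount b'
    · exact hG.pushFreeze_le b'
    · exact hG.pushFreeze_le b'
    · exact hle.trans (Nat.le_succ _)
    · exact hG.popFreeze_le b'
    · exact hG.slot b'
    · exact hG.slot b'
    · exact hG.closed_decided b'
    · exact hG.closed_decided b'
    · exact hG.applied b'
    · exact hG.applied b'
  · exact fun t' ht => hQ.frame hG ht fun _ _ _ _ _ _ _ _ => rfl
  · have hlt : ¬ (s.mem.batches b).popCount < (s.mem.batches b).popCountAtFreeze := by omega
    have hf : ((s.mem.modBatch b f).batches b).popCountAtFreeze =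
      (s.mem.batches b).popCountAtFreeze := by rw [Mem.modBatch_self]
    rw [← hf] at hlt
    exact ⟨(hpop b _ _ _).2 (Or.inr ⟨rfl, hlen.symm, rfl⟩), fun _ h1 => absurd h1 hlt,
      fun _ h1 => absurd h1 hlt, fun _ => hst, fun _ h1 => absurd h1 hlt⟩
  · intro b' i e ht he hl
    exact ⟨he, (hQ.pushLive_iff b' i).1 hl⟩
  · intro b' i t' ht he hl
    exact ⟨hQ.newPoppers b' i t' ht he, (hQ.popLive_iff b' i).1 hl⟩
  · intro b' i e ht he hl
    have h2 := hI.pushLive b' i e he ((hQ.pushLive_iff b' i).1 hl)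
    rw [ht, hp] at h2
    cases h2
  · intro b' i he hl
    rcases (hpop b' i _ t).1 he with h1 | ⟨rfl, -, -⟩
    · have h2 := hI.popLive b' i t h1 ((hQ.popLive_iff b' i).1 hl)
      rw [hp] at h2
      cases h2
    · rfl
  · intro b' hb
    cases hb

theorem Inv.step_pushWrite (hI : Inv asg s h g)
    (hP : ∀ a : Fin K, (Finset.univ.filter fun t => asg t = a).card ≤ P) {x b i : ℕ}
    (hp : s.pc t = .pushWrite x b i) : StepOK asg s h t (.pushWrite x b i) := by
  have hpc := hI.pcInv t
  rw [hp] at hpc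
  have hG := hI.glob
  obtain ⟨v, hv, -⟩ := id hpc
  have hi : i < P := (lt_length_of_getElem?_eq_some hv).trans_le (hG.pushers_length_le hP b)
  let f : Batch P → Batch P := fun B =>
    { B with eliminationArray := Function.update B.eliminationArray ⟨i, hi⟩ (some x) }
  have hn : next (asg t) s.mem (.pushWrite x b i) =
      (s.mem.modBatch b f, .freezerTest (.push x) b i) := by
    simp only [next, dif_pos hi, f]
  rw [StepOK, hn]
  have hself : (f (s.mem.batches b)).slot i = some (some x) := by
    simp [Batch.slot, f, hi]
  have hother : ∀ j, j ≠ i → (f (s.mem.batches b)).slot j = (s.mem.batches b).slot j := by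
    intro j hj
    by_cases hjP : j < P <;> simp [Batch.slot, f, hjP, hj]
  refine ⟨g, hI.modBatch hp rfl rfl rfl (hG.pushFreeze_le b) (hG.popFreeze_le b)
    (fun _ => ⟨rfl, rfl⟩) ?_ ?_ (fun h => h) (fun _ _ h => h) (hG.applied b) ?_
    (fun k b hb => Or.inl hb) (fun b hb => by cases hb)⟩
  · intro j y hy
    by_cases hj : j = i
    · subst hj
      obtain ⟨e, he, rfl⟩ := hG.slot b j y hy
      rw [hv] at he
      injection he with he
      subst he
      exact hself
    · rw [hother j hj]
      exact hy
  · intro j y hy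
    by_cases hj : j = i
    · subst hj
      rw [hself] at hy
      simp only [Option.some.injEq] at hy
      exact ⟨_, hv, hy.symm⟩
    · rw [hother j hj] at hy
      exact hG.slot b j y hy
  · intro hQ
    refine ⟨hQ.pushTicket hG rfl hpc, ?_⟩
    rw [Mem.modBatch_self]
    exact hself

theorem Inv.step_freezerTest (hI : Inv asg s h g) {c : Caller} {b i : ℕ}
    (hp : s.pc t = .freezerTest c b i) : StepOK asg s h t (.freezerTest c b i) := by
  have hpc := hI.pcInv t
  rw [hp] at hpc
  have hG := hI.glob
  by_cases hi : i = 0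
  swap
  · have hn : next (asg t) s.mem (.freezerTest c b i) = (s.mem, .freezeWait c b i) := by
      simp only [next, if_neg hi]
    rw [StepOK, hn]
    exact ⟨g, hI.local hp hpc (fun k b hb => Or.inl hb) (fun b hb => hb)⟩
  let f : Batch P → Batch P := fun B => { B with isFreezerDecided := true }
  by_cases hd : (s.mem.batches b).isFreezerDecided = true
  · have hn : next (asg t) s.mem (.freezerTest c b i) =
        (s.mem.modBatch b f, .freezeWait c b i) := by
      simp only [next, if_pos hi, if_pos hd, f]
    rw [StepOK, hn]
    exact ⟨g, hI.modBatch hp rfl rfl rfl (hG.pushFreeze_le b) (hG.popFreeze_le b)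
      (fun _ => ⟨rfl, rfl⟩) (fun _ _ h => h) (hG.slot b) (fun _ => rfl) (fun _ _ h => h)
      (hG.applied b) (fun hQ => hQ.ticket hG rfl hpc)
      (fun k b hb => Or.inl hb) (fun b hb => by cases hb)⟩
  · have hn : next (asg t) s.mem (.freezerTest c b i) =
        (s.mem.modBatch b f, .freezeReadPop c b i) := by
      simp only [next, if_pos hi, if_neg hd, f]
    rw [StepOK, hn]
    refine ⟨g, hI.modBatch hp rfl rfl rfl (hG.pushFreeze_le b) (hG.popFreeze_le b)
      (fun _ => ⟨rfl, rfl⟩) (fun _ _ h => h) (hG.slot b) (fun _ => rfl) (fun _ _ h => h)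
      (hG.applied b) (fun hQ => ⟨hQ.ticket hG rfl hpc, ?_, ?_⟩)
      (fun k b hb => Or.inl hb) ?_⟩
    · by_contra hne
      exact hd (hG.closed_decided b ((hG.closed_iff (Ticket.home hG hpc)).2 hne))
    · rw [Mem.modBatch_self]
    · intro b' hb t' ht hfr
      cases hb
      exact hd ((hI.pcInv t').freezing hfr).2

end Step

/-! ### Freezing, linking, publishing and peeking -/

section Step

variable {asg : Fin n → Fin K} {s : Config V n K P} {h : List (Event (Fin n) (Op V) (Ret V))}
  {g : Ghost V n K} {t : Fin n}

theorem Inv.step_freezeWritePop (hI : Inv asg s h g) {c : Caller} {b i r : ℕ}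
    (hp : s.pc t = .freezeWritePop c b i r) : StepOK asg s h t (.freezeWritePop c b i r) := by
  have hpc := hI.pcInv t
  rw [hp] at hpc
  obtain ⟨hT, hF, hr⟩ := hpc
  have hG := hI.glob
  simp only [StepOK, next]
  have hopen : ¬ Closed s.mem b := fun hc => hc.2 _ hF.1
  refine ⟨g, hI.modBatch hp rfl rfl rfl (hG.pushFreeze_le b) hr
    (fun hc => absurd hc hopen) (fun _ _ h => h) (hG.slot b) (fun h => h) (fun _ _ h => h)
    (fun ha => absurd (hG.snap_closed b (hG.applied b ha).1) hopen)
    (fun hQ => ⟨hQ.ticket hG rfl hT, hF.1, ?_⟩) (fun k b hb => Or.inl hb) ?_⟩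
  · rw [Mem.modBatch_self]
    exact hF.2
  · intro b' hb t' ht hfr
    exact ht (hI.freezer t' t b' hfr (by rw [hp]; exact hb))

theorem Inv.step_freezeWritePush (hI : Inv asg s h g) {c : Caller} {b i r : ℕ}
    (hp : s.pc t = .freezeWritePush c b i r) : StepOK asg s h t (.freezeWritePush c b i r) := by
  have hpc := hI.pcInv t
  rw [hp] at hpc
  obtain ⟨hT, hF, hr⟩ := hpc
  have hG := hI.glob
  simp only [StepOK, next]
  have hopen : ¬ Closed s.mem b := fun hc => hc.2 _ hF.1
  refine ⟨g, hI.modBatch hp rfl rfl rfl hr (hG.popFreeze_le b)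
    (fun hc => absurd hc hopen) (fun _ _ h => h) (hG.slot b) (fun h => h) (fun _ _ h => h)
    (fun ha => absurd (hG.snap_closed b (hG.applied b ha).1) hopen)
    (fun hQ => ⟨hQ.ticket hG rfl hT, hF.1, ?_⟩) (fun k b hb => Or.inl hb) ?_⟩
  · rw [Mem.modBatch_self]
    exact hF.2
  · intro b' hb t' ht hfr
    exact ht (hI.freezer t' t b' hfr (by rw [hp]; exact hb))

theorem Inv.step_pushApplied (hI : Inv asg s h g) {b : ℕ}
    (hp : s.pc t = .pushApplied b) : StepOK asg s h t (.pushApplied b) := by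
  have hpc := hI.pcInv t
  rw [hp] at hpc
  obtain ⟨hst, hs, hc, hlt⟩ := hpc
  have hG := hI.glob
  simp only [StepOK, next]
  exact ⟨g, hI.modBatch hp rfl rfl rfl (hG.pushFreeze_le b) (hG.popFreeze_le b)
    (fun _ => ⟨rfl, rfl⟩) (fun _ _ h => h) (hG.slot b) (fun h => h) (fun _ _ h => h)
    (fun _ => ⟨hs, fun h1 => absurd h1 hlt.not_gt⟩) (fun _ => hst)
    (fun k b hb => Or.inl hb) (fun b hb => by cases hb)⟩

theorem Inv.step_popApplied (hI : Inv asg s h g) {b i : ℕ}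
    (hp : s.pc t = .popApplied b i) : StepOK asg s h t (.popApplied b i) := by
  have hpc := hI.pcInv t
  rw [hp] at hpc
  obtain ⟨l, hl, hS, hc, hst⟩ := hpc
  have hG := hI.glob
  simp only [StepOK, next]
  refine ⟨g, hI.modBatch hp rfl rfl rfl (hG.pushFreeze_le b) (hG.popFreeze_le b)
    (fun _ => ⟨rfl, rfl⟩) (fun _ _ h => h) (hG.slot b) (fun h => h) (fun _ _ h => h)
    (fun _ => ⟨by rw [hl]; simp, fun _ => ⟨l, hl, hS⟩⟩)
    (fun hQ => ⟨l, hl, ?_, (hQ.closed_iff b).2 hc, ?_⟩)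
    (fun k b hb => Or.inl hb) (fun b hb => by cases hb)⟩
  · rw [Mem.modBatch_self]
    exact hS
  · rw [Mem.modBatch_self]
    exact hst

theorem Inv.step_pfsPublish (hI : Inv asg s h g) {b i : ℕ} {top : Option ℕ}
    (hp : s.pc t = .pfsPublish b i top) : StepOK asg s h t (.pfsPublish b i top) := by
  have hpc := hI.pcInv t
  rw [hp] at hpc
  obtain ⟨l, hl, hS, hc, hst⟩ := hpc
  have hG := hI.glob
  simp only [StepOK, next]
  refine ⟨g, hI.modBatch hp rfl rfl rfl (hG.pushFreeze_le b) (hG.popFreeze_le b)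
    (fun _ => ⟨rfl, rfl⟩) (fun _ _ h => h) (hG.slot b) (fun h => h) ?_
    (fun ha => ⟨(hG.applied b ha).1, fun _ => ⟨l, hl, hS⟩⟩)
    (fun hQ => ⟨l, hl, ?_, (hQ.closed_iff b).2 hc, ?_⟩)
    (fun k b hb => Or.inl hb) (fun b hb => by cases hb)⟩
  · intro l' hl' _
    rw [hl] at hl'
    injection hl' with hl'
    subst hl'
    exact hS
  · rw [Mem.modBatch_self]
    exact hS
  · rw [Mem.modBatch_self]
    exact hst

/-- The combiner `t` of a batch writes to the field `next` of a node of the batch. -/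
theorem Inv.setNext (hI : Inv asg s h g) {pc pc' : PC V} (hp : s.pc t = pc) {b j : ℕ}
    {e : Fin n × ℕ × V} {N : Node V} (p : Option ℕ)
    (hC : PushCombiner s.mem g t b) (hw : (s.mem.batches b).popCountAtFreeze ≤ j)
    (hu : j < (s.mem.batches b).pushCountAtFreeze) (he : (g.pushers b)[j]? = some e)
    (hN : s.mem.nodes e.2.1 = some N) {m' : Mem V K P}
    (hm : m' = { s.mem with
      nodes := Function.update s.mem.nodes e.2.1 (some { N with next := p }) })
    (own : PushCombiner m' g t b →
      m'.nodes e.2.1 = some ⟨e.2.2, p⟩ →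
      (∀ i e', (g.pushers b)[i]? = some e' → i ≠ j → m'.nodes e'.2.1 = s.mem.nodes e'.2.1) →
      PCInv asg m' g t pc')
    (batch : pc'.batch = pc.batch) (freezer : pc'.freezing = none) :
    Inv asg ⟨m', Function.update s.pc t pc'⟩ h g := by
  have hG := hI.glob
  have hpub := (hI.live_pusher he (hC.live hw hu)).2.2
  have hself : m'.nodes e.2.1 = some { N with next := p } := by
    rw [hm]
    exact Function.update_self _ _ _
  have hother : ∀ x, x ≠ e.2.1 → m'.nodes x = s.mem.nodes x := by
    intro x hx
    rw [hm]
    exact Function.update_of_ne hx _ _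
  have hvalue : ∀ x N', s.mem.nodes x = some N' →
      ∃ N'', m'.nodes x = some N'' ∧ N''.value = N'.value := by
    intro x N' hx
    by_cases hxe : x = e.2.1
    · subst hxe
      rw [hN] at hx
      injection hx with hx
      subst hx
      exact ⟨_, hself, rfl⟩
    · exact ⟨N', (hother x hxe).trans hx, rfl⟩
  have hpubn : ∀ x ∈ g.published, m'.nodes x = s.mem.nodes x := by
    intro x hx
    refine hother x ?_
    rintro rfl
    exact hpub hx
  have hchain : ∀ p l, IsStack s.mem g p l → IsStack m' g p l :=
    fun p l hl => hl.mono (fun _ hx => hx) hpubn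
  have hbat : m'.batches = s.mem.batches := by rw [hm]
  have hagg : m'.agg = s.mem.agg := by rw [hm]
  have hnum : m'.numBatches = s.mem.numBatches := by rw [hm]
  have hnumN : m'.numNodes = s.mem.numNodes := by rw [hm]
  have htop : m'.stackTop = s.mem.stackTop := by rw [hm]
  have hQ : Quiet t s.mem g m' g := by
    refine ⟨hagg, hnum, rfl, rfl, rfl, fun _ _ => rfl, fun _ _ _ h => h, fun _ _ _ _ h => h,
      fun _ _ _ h => h, fun _ _ _ _ h => h, fun _ _ h => h, ?_, ?_, ?_, ?_, ?_, ?_, hvalue,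
      hpubn, ?_⟩ <;> rw [hbat]
    · exact fun _ _ => rfl
    · exact fun _ _ => rfl
    · exact fun _ => le_rfl
    · exact fun _ => le_rfl
    · exact fun _ _ _ h => h
    · exact fun _ h => h
    · exact fun b l _ hl => hchain _ _ hl
  refine hI.quiet hQ rfl rfl hI.lin ?_ ?_ ?_ ?_ ?_
  · have hnode : ∀ b', ∀ e' ∈ g.pushers b', ∃ nx, m'.nodes e'.2.1 = some ⟨e'.2.2, nx⟩ := by
      intro b' e' he'
      obtain ⟨nx, hnx⟩ := hG.pushers_node b' e' he'
      obtain ⟨⟨v, nx'⟩, h1, h2⟩ := hvalue _ _ hnx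
      simp only at h2
      subst h2
      exact ⟨nx', h1⟩
    have happ : ∀ b, (m'.batches b).isBatchApplied = true → g.snap b ≠ none ∧
        ((m'.batches b).pushCountAtFreeze < (m'.batches b).popCountAtFreeze →
          ∃ l, g.snap b = some l ∧ IsStack m' g (m'.batches b).subStackTop l) := by
      intro b' hb'
      rw [hbat] at hb' ⊢
      obtain ⟨h1, h2⟩ := hG.applied b' hb'
      refine ⟨h1, fun h3 => ?_⟩
      obtain ⟨l, hl, h4⟩ := h2 h3
      exact ⟨l, hl, hchain _ _ h4⟩
    have hlt : ∀ x N, m'.nodes x = some N → x < m'.numNodes := by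
      intro x N' hx
      rw [hnumN]
      by_cases hxe : x = e.2.1
      · subst hxe
        exact hG.nodes_lt _ N hN
      · exact hG.nodes_lt _ N' ((hother x hxe).symm.trans hx)
    exact
      { agg_lt := by rw [hagg, hnum]; exact hG.agg_lt
        home_agg := by rw [hagg]; exact hG.home_agg
        home_lt := by rw [hnum]; exact hG.home_lt
        pushCount := by rw [hbat]; exact hG.pushCount
        popCount := by rw [hbat]; exact hG.popCount
        pushFreeze_le := by rw [hbat]; exact hG.pushFreeze_le
        popFreeze_le := by rw [hbat]; exact hG.popFreeze_le
        pushers_home := hG.pushers_home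
        poppers_home := hG.poppers_home
        pushers_owner := hG.pushers_owner
        pushers_node := hnode
        pushers_nodup := hG.pushers_nodup
        poppers_nodup := hG.poppers_nodup
        slot := by rw [hbat]; exact hG.slot
        closed_decided := fun b hc => by
          rw [hbat]; exact hG.closed_decided b ((hQ.closed_iff b).1 hc)
        snap_closed := fun b hb => (hQ.closed_iff b).2 (hG.snap_closed b hb)
        applied := happ
        stack := by rw [htop]; exact hchain _ _ hG.stack
        nodes_lt := hlt
        owner_lt := by rw [hnumN]; exact hG.owner_lt
        published_lt := by rw [hnumN]; exact hG.published_lt }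
  · obtain ⟨⟨x, hx⟩, hc, hlt⟩ := hC
    refine own ⟨⟨x, ?_⟩, (hQ.closed_iff b).2 hc, by rwa [hbat]⟩ ?_ ?_
    · rw [hbat]
      exact hQ.pushTicket hG rfl hx
    · obtain ⟨nx, hnx⟩ := hG.pushers_node b e (List.mem_of_getElem? he)
      rw [hN] at hnx
      injection hnx with hnx
      rw [hself, hnx]
    · intro i e' he' hij
      refine hother _ fun hx => hij ?_
      exact hG.pusher_index_unique he' he (hG.pusher_thread_eq he' he hx)
  · intro t' ht b' _ hC' j' e' hw' hu' he'
    exact hother _ (hI.combiner_nodes_disjoint ht hC hw hu he hC' hw' hu' he')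
  · intro k b' hb'
    rw [hp, ← batch] at hb'
    exact Or.inl hb'
  · intro b' hb'
    rw [freezer] at hb'
    cases hb'

theorem Inv.step_ptsLink (hI : Inv asg s h g) {b i : ℕ} {temp top bot : Option ℕ}
    (hp : s.pc t = .ptsLink b i temp top bot) :
    StepOK asg s h t (.ptsLink b i temp top bot) := by
  have hpc := hI.pcInv t
  rw [hp] at hpc
  obtain ⟨hC, hi, ⟨j, rfl, hj, hL⟩, e, he, rfl⟩ := hpc
  obtain ⟨nx, hnx⟩ := hI.glob.pushers_node b e (List.mem_of_getElem? he)
  obtain ⟨⟨e0, he0, hbot⟩, ⟨e1, he1, htop⟩, hlink⟩ := hL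
  refine ⟨g, ?_⟩
  simp only [next, hnx]
  refine hI.setNext hp top hC (by omega) hi he hnx rfl ?_ rfl rfl
  intro hC' hself hother
  refine ⟨hC', hi, by simp only; omega, ⟨e0, he0, hbot⟩, ⟨e, he, rfl⟩, ?_⟩
  intro k hk1 hk2
  rcases Nat.lt_succ_iff_lt_or_eq.1 hk2 with hk | rfl
  · obtain ⟨e2, e3, h2, h3, h4⟩ := hlink k hk1 hk
    exact ⟨e2, e3, h2, h3, (hother _ _ h3 (by omega)).trans h4⟩
  · exact ⟨e1, e, he1, he, by rw [← htop]; exact hself⟩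

theorem Inv.step_ptsSetBot (hI : Inv asg s h g) {b : ℕ} {top bot temp : Option ℕ}
    (hp : s.pc t = .ptsSetBot b top bot temp) :
    StepOK asg s h t (.ptsSetBot b top bot temp) := by
  have hpc := hI.pcInv t
  rw [hp] at hpc
  obtain ⟨hC, i, hi, hj, ⟨⟨e0, he0, rfl⟩, ⟨e1, he1, htop⟩, hlink⟩⟩ := hpc
  obtain ⟨nx, hnx⟩ := hI.glob.pushers_node b e0 (List.mem_of_getElem? he0)
  refine ⟨g, ?_⟩
  simp only [next, hnx]
  refine hI.setNext hp temp hC le_rfl hC.2.2 he0 hnx rfl ?_ rfl rfl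
  intro hC' hself hother
  refine ⟨hC', ⟨i, hi, hj, ⟨e0, he0, rfl⟩, ⟨e1, he1, htop⟩, ?_⟩, e0, he0, hself⟩
  intro k hk1 hk2
  simp only at hk1
  obtain ⟨e2, e3, h2, h3, h4⟩ := hlink k hk1 hk2
  exact ⟨e2, e3, h2, h3, (hother _ _ h3 (by omega)).trans h4⟩

theorem Inv.step_peekTop (hI : Inv asg s h g)
    (hp : s.pc t = .peekTop) : StepOK asg s h t .peekTop := by
  have hpc := hI.pcInv t
  rw [hp] at hpc
  have hG := hI.glob
  have hst : g.status t = .pending .peek := hpc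
  have hlin := hI.lin.linearize t .peek hst
  have hstack := hG.stack
  refine ⟨{ g with status := Function.update g.status t (.done (stackSpec g.stack .peek).2) }, ?_⟩
  refine hI.quiet (Quiet.of_status s.mem g t _) rfl rfl ?_ (hG.congr_status _) ?_
    (fun _ _ _ _ _ _ _ _ _ _ => rfl) (fun k b hb => by rw [hp] at hb; cases hb) ?_
  · have h1 : (stackSpec g.stack .peek).1 = g.stack := by cases g.stack <;> rfl
    rw [h1] at hlin
    exact hlin
  · simp only [next]
    split
    · next h0 =>
      rw [h0] at hstack
      rw [hstack.eq_nil]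
      exact Function.update_self _ _ _
    · next h0 =>
      obtain ⟨y, hy⟩ := Option.ne_none_iff_exists'.1 h0
      rw [hy] at hstack ⊢
      obtain ⟨v, nxt, l, hl, -, hN, -⟩ := hstack.of_some
      rw [hl]
      exact ⟨y, _, rfl, hN, Function.update_self _ _ _⟩
  · intro b hb
    simp only [next] at hb
    split at hb <;> cases hb

theorem Inv.invoke (hI : Inv asg s h g) (o : Op V) (hp : s.pc t = .idle) :
    ∃ g', Inv asg ⟨s.mem, Function.update s.pc t (startPC o)⟩ (h ++ [.inv t o]) g' := by
  have hpc := hI.pcInv t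
  rw [hp] at hpc
  refine ⟨{ g with status := Function.update g.status t (.pending o) }, ?_⟩
  refine hI.quiet (Quiet.of_status s.mem g t _) rfl rfl (hI.lin.invoke t o hpc)
    (hI.glob.congr_status _) ?_ (fun _ _ _ _ _ _ _ _ _ _ => rfl)
    (fun k b hb => by rw [hp] at hb; cases hb) (fun b hb => by cases o <;> cases hb)
  cases o <;> exact Function.update_self _ _ _

theorem Inv.respond (hI : Inv asg s h g) (r : Ret V) (hp : s.pc t = .ret r) :
    ∃ g', Inv asg ⟨s.mem, Function.update s.pc t .idle⟩ (h ++ [.res t r]) g' := by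
  have hpc := hI.pcInv t
  rw [hp] at hpc
  refine ⟨{ g with status := Function.update g.status t .idle }, ?_⟩
  exact hI.quiet (Quiet.of_status s.mem g t _) rfl rfl (hI.lin.respond t r hpc)
    (hI.glob.congr_status _) (Function.update_self _ _ _) (fun _ _ _ _ _ _ _ _ _ _ => rfl)
    (fun k b hb => by rw [hp] at hb; cases hb) (fun b hb => by cases hb)

end Step

/-! ### Operations that a combiner makes take effect -/

section Linearize

theorem stackSpec_drop_pop (l : List V) (k : ℕ) :
    stackSpec (l.drop k) .pop = (l.drop (k + 1), popResult l k) := by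
  rw [← List.drop_drop]
  cases hl : l.drop k with
  | nil =>
    have h1 : l[k]? = none := List.getElem?_eq_none (List.drop_eq_nil_iff.1 hl)
    simp [stackSpec, popResult, h1]
  | cons v l' =>
    have h1 : l[k]? = some v := by
      have h2 : (l.drop k)[0]? = some v := by rw [hl]; rfl
      simpa using h2
    simp [stackSpec, popResult, h1]

/-- Let pushes and pops of distinct threads take effect in pairs, each pop directly after a push
whose value it returns. This leaves the stack as it is. -/
theorem linearize_pairs {h : List (Event (Fin n) (Op V) (Ret V))}
    {st : Fin n → Status (Op V) (Ret V)} {l : List V} (a b : ℕ → Fin n) (v : ℕ → V) (N : ℕ)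
    (he : LinExec stackSpec [] h l st)
    (ha : ∀ i, i < N → st (a i) = .pending (.push (v i)))
    (hb : ∀ i, i < N → st (b i) = .pending .pop)
    (hainj : ∀ i j, i < N → j < N → a i = a j → i = j)
    (hbinj : ∀ i j, i < N → j < N → b i = b j → i = j) :
    ∃ st', LinExec stackSpec [] h l st' ∧ (∀ i, i < N → st' (a i) = .done .tt) ∧
      (∀ i, i < N → st' (b i) = .done (.val (v i))) ∧
      ∀ t, (∀ i, i < N → a i ≠ t ∧ b i ≠ t) → st' t = st t := by
  induction N with
  | zero => exact ⟨st, he, by simp, by simp, by simp⟩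
  | succ N ih =>
    obtain ⟨st', h1, h2, h3, h4⟩ := ih (fun i hi => ha i (by omega)) (fun i hi => hb i (by omega))
      (fun i j hi hj => hainj i j (by omega) (by omega))
      (fun i j hi hj => hbinj i j (by omega) (by omega))
    have hab : ∀ i j, i < N + 1 → j < N + 1 → a i ≠ b j := by
      intro i j hi hj hij
      have h5 := ha i hi
      rw [hij, hb j hj] at h5
      cases h5
    have haN : ∀ i, i < N → a i ≠ a N := by
      intro i hi hij
      have := hainj i N (by omega) (by omega) hij
      omega
    have hbN : ∀ i, i < N → b i ≠ b N := by
      intro i hi hij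
      have := hbinj i N (by omega) (by omega) hij
      omega
    have h5 : st' (a N) = .pending (.push (v N)) :=
      (h4 _ fun i hi => ⟨haN i hi, (hab N i (by omega) (by omega)).symm⟩).trans
        (ha N (by omega))
    have h6 : st' (b N) = .pending .pop :=
      (h4 _ fun i hi => ⟨hab i N (by omega) (by omega), hbN i hi⟩).trans (hb N (by omega))
    have h7 := h1.linearize (a N) _ h5
    have h8 : Function.update st' (a N) (.done (stackSpec l (.push (v N))).2) (b N) =
        .pending .pop := by
      rw [Function.update_of_ne (hab N N (by omega) (by omega)).symm]
      exact h6
    refine ⟨_, h7.linearize (b N) _ h8, ?_, ?_, ?_⟩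
    · intro i hi
      rw [Function.update_of_ne (hab i N hi (by omega))]
      rcases Nat.lt_succ_iff_lt_or_eq.1 hi with hi | rfl
      · rw [Function.update_of_ne (haN i hi)]
        exact h2 i hi
      · exact Function.update_self _ _ _
    · intro i hi
      rcases Nat.lt_succ_iff_lt_or_eq.1 hi with hi | rfl
      · rw [Function.update_of_ne (hbN i hi),
          Function.update_of_ne (hab N i (by omega) (by omega)).symm]
        exact h3 i hi
      · exact Function.update_self _ _ _
    · intro t ht
      rw [Function.update_of_ne (ht N (by omega)).2.symm,
        Function.update_of_ne (ht N (by omega)).1.symm]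
      exact h4 t fun i hi => ht i (by omega)

end Linearize

/-! ### The CAS of a combiner -/

section Combine

variable {asg : Fin n → Fin K} {s : Config V n K P} {h : List (Event (Fin n) (Op V) (Ret V))}
  {g : Ghost V n K} {t : Fin n}

/-- The nodes that the combiner of batch `b` adds to the stack. -/
def combinedNodes (m : Mem V K P) (g : Ghost V n K) (b : ℕ) : Set ℕ :=
  {x | ∃ (j : ℕ) (e : Fin n × ℕ × V), (m.batches b).popCountAtFreeze ≤ j ∧
    j < (m.batches b).pushCountAtFreeze ∧ (g.pushers b)[j]? = some e ∧ x = e.2.1}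

/-- The combined pushes of a batch take effect in the order of their sequence numbers, and the
linked nodes of the batch, put on top of the stack, represent the result. -/
theorem Inv.linearize_pushes (hI : Inv asg s h g) {b i : ℕ} {top bot : Option ℕ}
    (hC : PushCombiner s.mem g t b) (hi : i + 1 = (s.mem.batches b).pushCountAtFreeze)
    (hL : Linked s.mem g b i top bot) {e0 : Fin n × ℕ × V}
    (he0 : (g.pushers b)[(s.mem.batches b).popCountAtFreeze]? = some e0)
    (hbot : s.mem.nodes e0.2.1 = some ⟨e0.2.2, s.mem.stackTop⟩) :
    ∃ l st, LinExec stackSpec [] h l st ∧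
      Chain s.mem.nodes (g.published ∪ combinedNodes s.mem g b) top l ∧
      (∀ (j : ℕ) (e : Fin n × ℕ × V), (s.mem.batches b).popCountAtFreeze ≤ j →
        j < (s.mem.batches b).pushCountAtFreeze → (g.pushers b)[j]? = some e →
        st e.1 = .done .tt) ∧
      ∀ t', (∀ (j : ℕ) (e : Fin n × ℕ × V), (s.mem.batches b).popCountAtFreeze ≤ j →
        j < (s.mem.batches b).pushCountAtFreeze → (g.pushers b)[j]? = some e → e.1 ≠ t') →
        st t' = g.status t' := by
  have hG := hI.glob
  have hwu := hC.2.2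
  set w := (s.mem.batches b).popCountAtFreeze with hw
  set u := (s.mem.batches b).pushCountAtFreeze with hu
  let f : ℕ → Fin n × ℕ × V := fun k => ((g.pushers b)[w + k]?).getD e0
  have hf : ∀ k, w + k < u → (g.pushers b)[w + k]? = some (f k) := by
    intro k hk
    obtain ⟨e, he⟩ := hG.exists_pusher hk
    simp only [f, he, Option.getD_some]
  have hf' : ∀ j e, w ≤ j → j < u → (g.pushers b)[j]? = some e → e = f (j - w) := by
    intro j e h1 h2 he
    have h3 := hf (j - w) (by omega)
    rw [Nat.add_sub_cancel' h1, he] at h3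
    exact Option.some.inj h3
  let stk : ℕ → List V := fun k => Nat.rec g.stack (fun k l => (f k).2.2 :: l) k
  obtain ⟨st, h1, h2, h3⟩ := LinExec.linearize_many (fun k => (f k).1)
    (fun k => Op.push (f k).2.2) (fun _ => Ret.tt) stk (u - w) hI.lin
    (fun i j hi hj hij => by
      have := hG.pusher_index_unique (hf i (by omega)) (hf j (by omega)) hij
      omega)
    (fun k hk => (hI.live_pusher (hf k (by omega)) (hC.live (by omega) (by omega))).2.1)
    (fun k hk => rfl)
  refine ⟨_, st, h1, ?_, ?_, ?_⟩
  · have hmem : ∀ k, w + k < u → (f k).2.1 ∈ g.published ∪ combinedNodes s.mem g b :=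
      fun k hk => Or.inr ⟨w + k, f k, by omega, hk, hf k hk, rfl⟩
    have hchain : ∀ k, w + k < u → Chain s.mem.nodes (g.published ∪ combinedNodes s.mem g b)
        (some (f k).2.1) (stk (k + 1)) := by
      intro k
      induction k with
      | zero =>
        intro hk
        have hf0 : f 0 = e0 := (hf' w e0 le_rfl hwu he0).symm ▸ by simp
        refine ⟨_, s.mem.stackTop, rfl, hmem 0 hk, ?_, ?_⟩
        · rw [hf0]
          exact hbot
        · exact hG.stack.mono Set.subset_union_left fun _ _ => rfl
      | succ k ih =>
        intro hk
        obtain ⟨e, e', h4, h5, h6⟩ := hL.2.2 (w + k) (by omega) (by omega)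
        obtain rfl : e = f k := Option.some.inj (h4.symm.trans (hf k (by omega)))
        obtain rfl : e' = f (k + 1) := Option.some.inj (h5.symm.trans (hf (k + 1) hk))
        exact ⟨_, _, rfl, hmem _ hk, h6, ih (by omega)⟩
    obtain ⟨e1, he1, rfl⟩ := hL.2.1
    have h4 := hchain (u - w - 1) (by omega)
    have h5 : i = w + (u - w - 1) := by omega
    rw [h5, hf _ (by omega)] at he1
    rw [← Option.some.inj he1]
    have h6 : u - w - 1 + 1 = u - w := by omega
    rwa [h6] at h4
  · intro j e hj1 hj2 he
    rw [hf' j e hj1 hj2 he]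
    exact h2 (j - w) (by omega)
  · intro t' ht'
    exact h3 t' fun k hk => ht' (w + k) (f k) (by omega) (by omega) (hf k (by omega))

/-- The CAS of a combiner for pushes. If it succeeds, the nodes linked by the combiner become
published, and the pushes with sequence numbers from `popCountAtFreeze` on take effect. -/
theorem Inv.step_ptsCAS (hI : Inv asg s h g) {b : ℕ} {top bot temp : Option ℕ}
    (hp : s.pc t = .ptsCAS b top bot temp) : StepOK asg s h t (.ptsCAS b top bot temp) := by
  have hpc := hI.pcInv t
  rw [hp] at hpc
  obtain ⟨hC, ⟨i, hi, hwi, hL⟩, e0, he0, hbot⟩ := hpc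
  by_cases hcas : s.mem.stackTop = temp
  swap
  · have hn : next (asg t) s.mem (.ptsCAS b top bot temp) = (s.mem, .ptsReadTop b top bot) := by
      simp only [next, if_neg hcas]
    rw [StepOK, hn]
    exact ⟨g, hI.local hp ⟨hC, i, hi, hwi, hL⟩ (fun k b hb => Or.inl hb) (fun b hb => hb)⟩
  have hn : next (asg t) s.mem (.ptsCAS b top bot temp) =
      ({ s.mem with stackTop := top }, .pushApplied b) := by
    simp only [next, if_pos hcas]
  rw [StepOK, hn]
  subst hcas
  have hG := hI.glob
  have hsnap := hC.snap_eq_none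
  obtain ⟨l, st, hlin, hchain, hdone, hsame⟩ := hI.linearize_pushes hC hi hL he0 hbot
  let g' : Ghost V n K := { g with
    published := g.published ∪ combinedNodes s.mem g b
    snap := Function.update g.snap b (some g.stack)
    status := st
    stack := l }
  let m' : Mem V K P := { s.mem with stackTop := top }
  have hsb : g'.snap b = some g.stack := Function.update_self _ _ _
  have hsne : ∀ b', b' ≠ b → g'.snap b' = g.snap b' := fun b' hb => Function.update_of_ne hb _ _
  have hs_mono : ∀ b' l, g.snap b' = some l → g'.snap b' = some l := by
    intro b' l hl
    rw [hsne b' (by rintro rfl; rw [hsnap] at hl; cases hl)]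
    exact hl
  have hs_none : ∀ b', g'.snap b' = none → g.snap b' = none := by
    intro b' hb
    cases hl : g.snap b' with
    | none => rfl
    | some l =>
      rw [hs_mono b' l hl] at hb
      cases hb
  have hmono : ∀ p l, IsStack s.mem g p l → IsStack m' g' p l :=
    fun p l hl => hl.mono Set.subset_union_left fun _ _ => rfl
  -- the threads whose operations take effect are in batch `b` with a push
  have hbatch : ∀ (j : ℕ) (e : Fin n × ℕ × V), (s.mem.batches b).popCountAtFreeze ≤ j →
      j < (s.mem.batches b).pushCountAtFreeze → (g.pushers b)[j]? = some e →
      (s.pc e.1).batch = some (true, b) :=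
    fun j e h1 h2 he => (hI.live_pusher he (hC.live h1 h2)).1
  have hother : ∀ t', (s.pc t').batch ≠ some (true, b) → st t' = g.status t' := by
    refine fun t' ht' => hsame t' fun j e h1 h2 he h3 => ht' ?_
    rw [← h3]
    exact hbatch j e h1 h2 he
  have hunpub : ∀ t' x, (s.pc t').batch ≠ some (true, b) → g.owner x = some t' →
      x ∉ g.published → x ∉ g'.published := by
    rintro t' x ht' hx hxp (h1 | ⟨j, e, h1, h2, he, rfl⟩)
    · exact hxp h1
    · rw [hG.pushers_owner b e (List.mem_of_getElem? he)] at hx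
      injection hx with hx
      rw [← hx] at ht'
      exact ht' (hbatch j e h1 h2 he)
  obtain ⟨x0, v0, hv0, -⟩ := id hC.1
  have hlive : ∀ b' i, PushLive m' g' b' i → PushLive s.mem g b' i :=
    fun b' i hl hc => ⟨(hl hc).1, (hl hc).2.1, hs_none b' (hl hc).2.2⟩
  have hlive' : ∀ b' i, PopLive m' g' b' i → PopLive s.mem g b' i :=
    fun b' i hl hc => ⟨(hl hc).1, (hl hc).2.1, hs_none b' (hl hc).2.2⟩
  refine ⟨g', hI.update (m' := m') (g' := g') hlin ?_ ?_ ?_ ?_ ?_ ?_ ?_ ?_⟩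
  · refine { hG with
      snap_closed := fun b' hb => ?_
      applied := fun b' hb => ?_
      stack := hchain
      published_lt := fun x hx => ?_ }
    · by_cases hbb : b' = b
      · subst hbb
        exact hC.2.1
      · rw [hsne b' hbb] at hb
        exact hG.snap_closed b' hb
    · obtain ⟨h1, h2⟩ := hG.applied b' hb
      refine ⟨fun h3 => h1 (hs_none b' h3), fun h3 => ?_⟩
      obtain ⟨l', hl', h4⟩ := h2 h3
      exact ⟨l', hs_mono b' l' hl', hmono _ _ h4⟩
    · rcases hx with hx | ⟨j, e, -, -, he, rfl⟩
      · exact hG.published_lt x hx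
      · obtain ⟨nx, hnx⟩ := hG.pushers_node b e (List.mem_of_getElem? he)
        exact hG.nodes_lt _ _ hnx
  · intro t' ht'
    refine
      { fresh := ?_
        status := fun hb => hother t' (by rw [hb]; simp)
        home := fun _ _ h => h
        absent := fun c b h => by cases c <;> exact h
        pushTicket := ?_
        popTicket := ?_
        pushers := fun _ _ _ h => h
        slot := fun _ _ _ h => h
        closed := fun _ h => h
        pushFreeze := fun _ _ => rfl
        popFreeze := fun _ _ => rfl
        snap := hs_mono
        freezing := fun _ _ h => h
        pushCount := fun _ _ => le_rfl
        popCount := fun _ _ => le_rfl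
        linking := fun _ _ _ _ _ _ _ _ => rfl
        value := fun x N hx => ⟨N, hx, rfl⟩
        chain := hmono
        sub := fun b' l' _ hl => hmono _ _ hl }
    · intro hb c hc
      have hne : (s.pc t').batch ≠ some (true, b) := by rw [hb]; simp
      cases c with
      | push x =>
        obtain ⟨v, nx, h1, h2, h3, h4⟩ := hc
        exact ⟨v, nx, h1, h2, hunpub t' x hne h2 h3, (hother t' hne).trans h4⟩
      | pop => exact (hother t' hne).trans hc
    · intro x b1 i1 hb1 hT
      have hT0 := hT
      obtain ⟨v, h1, h2, h3, h4⟩ := hT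
      by_cases hbb : b1 = b
      · subst hbb
        by_cases hin : (s.mem.batches b1).popCountAtFreeze ≤ i1 ∧
            i1 < (s.mem.batches b1).pushCountAtFreeze
        · refine ⟨v, h1, fun _ => hdone i1 _ hin.1 hin.2 h1, ?_, ?_⟩
          · intro hE
            exact absurd ⟨hC.2.1, hin.2, Or.inr (by rw [hsb]; simp)⟩ hE
          · rintro rfl -
            rw [hv0] at h1
            simp only [Option.some.injEq, Prod.mk.injEq] at h1
            exact absurd h1.1.symm ht'
        · have hst : st t' = g.status t' := by
            refine hsame t' fun j e h5 h6 he h7 => hin ?_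
            rw [← hG.pusher_index_unique he h1 h7]
            exact ⟨h5, h6⟩
          have hE : PushEffective m' g' b1 i1 ↔ PushEffective s.mem g b1 i1 := by
            constructor
            · rintro ⟨h5, h6, -⟩
              refine ⟨h5, h6, Or.inl ?_⟩
              by_contra h8
              exact hin ⟨not_lt.1 h8, h6⟩
            · rintro ⟨h5, h6, h7⟩
              refine ⟨h5, h6, h7.imp_right fun h8 => absurd hsnap h8⟩
          refine ⟨v, h1, ?_, ?_, fun h5 h6 => absurd ⟨h5.ge, h6⟩ hin⟩
          · rw [hE]
            exact fun h5 => hst.trans (h2 h5)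
          · rw [hE]
            intro h5
            refine ⟨hst.trans (h3 h5).1, ?_⟩
            rintro (h6 | ⟨j, e, h6, h7, he, h8⟩)
            · exact (h3 h5).2 h6
            · have h9 := hG.pusher_thread_eq h1 he h8
              exact hin ((hG.pusher_index_unique he h1 h9.symm) ▸ ⟨h6, h7⟩)
      · have hne : (s.pc t').batch ≠ some (true, b) := by
          rw [hb1]
          simpa using hbb
        have hst := hother t' hne
        have hE : PushEffective m' g' b1 i1 ↔ PushEffective s.mem g b1 i1 := by
          rw [PushEffective, PushEffective, hsne b1 hbb]
          rfl
        refine ⟨v, h1, ?_, ?_, ?_⟩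
        · rw [hE]
          exact fun h5 => hst.trans (h2 h5)
        · rw [hE]
          exact fun h5 => ⟨hst.trans (h3 h5).1,
            hunpub t' x hne (hG.pushers_owner b1 _ (List.mem_of_getElem? h1)) (h3 h5).2⟩
        · rw [hsne b1 hbb]
          exact h4
    · intro b1 i1 hb1 hT
      have hst := hother t' (by rw [hb1]; simp)
      by_cases hbb : b1 = b
      · subst hbb
        have hwu := hC.2.2
        refine ⟨hT.mem, fun h1 h2 h3 e he => hst.trans (hT.eliminated h1 h2 h3 e he), ?_, ?_, ?_⟩
        · intro _ (h2 : i1 < (s.mem.batches b1).popCountAtFreeze)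
            (h3 : (s.mem.batches b1).pushCountAtFreeze ≤ i1)
          omega
        · intro hE
          refine hst.trans (hT.pending fun hE' => hE ⟨hE'.1, hE'.2.1, Or.inl ?_⟩)
          exact hE'.2.1.trans hwu
        · intro (h2 : i1 = (s.mem.batches b1).pushCountAtFreeze)
            (h3 : i1 < (s.mem.batches b1).popCountAtFreeze)
          omega
      · refine ⟨hT.mem, fun h1 h2 h3 e he => hst.trans (hT.eliminated h1 h2 h3 e he), ?_, ?_, ?_⟩
        · rw [hsne b1 hbb]
          exact fun h1 h2 h3 l hl => hst.trans (hT.combined h1 h2 h3 l hl)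
        · rw [PopEffective, hsne b1 hbb]
          exact fun hE => hst.trans (hT.pending hE)
        · rw [hsne b1 hbb]
          exact hT.combiner
  · exact ⟨hdone _ _ le_rfl hC.2.2 hv0, by rw [hsb]; simp, hC.2.1, hC.2.2⟩
  · exact fun b' i e _ he hl => ⟨he, hlive b' i hl⟩
  · exact fun b' i e _ he hl => ⟨he, hlive' b' i hl⟩
  · intro b' i e ht he hl
    have h1 := hI.pushLive b' i e he (hlive b' i hl)
    rw [ht, hp] at h1
    cases h1
    have h2 := (hl hC.2.1).2.2
    rw [hsb] at h2
    cases h2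
  · intro b' i he hl
    have h1 := hI.popLive b' i t he (hlive' b' i hl)
    rw [hp] at h1
    cases h1
  · intro b' hb
    cases hb

/-- The combined pops of a batch take effect in the order of their sequence numbers. -/
theorem Inv.linearize_pops (hI : Inv asg s h g) {b i : ℕ} (hC : PopCombiner s.mem g t b i) :
    ∃ st, LinExec stackSpec [] h (g.stack.drop ((s.mem.batches b).popCountAtFreeze - i)) st ∧
      (∀ (j : ℕ) (t' : Fin n), (s.mem.batches b).pushCountAtFreeze ≤ j →
        j < (s.mem.batches b).popCountAtFreeze → (g.poppers b)[j]? = some t' →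
        st t' = .done (popResult g.stack (j - (s.mem.batches b).pushCountAtFreeze))) ∧
      ∀ t', (∀ j : ℕ, (s.mem.batches b).pushCountAtFreeze ≤ j →
        j < (s.mem.batches b).popCountAtFreeze → (g.poppers b)[j]? ≠ some t') →
        st t' = g.status t' := by
  have hG := hI.glob
  obtain ⟨-, -, hiu, huw⟩ := id hC
  set w := (s.mem.batches b).popCountAtFreeze with hw
  set u := (s.mem.batches b).pushCountAtFreeze with hu
  let f : ℕ → Fin n := fun k => ((g.poppers b)[u + k]?).getD t
  have hf : ∀ k, u + k < w → (g.poppers b)[u + k]? = some (f k) := by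
    intro k hk
    obtain ⟨e, he⟩ := hG.exists_popper hk
    simp only [f, he, Option.getD_some]
  obtain ⟨st, h1, h2, h3⟩ := LinExec.linearize_many f
    (fun _ => Op.pop) (fun k => popResult g.stack k) (fun k => g.stack.drop k) (w - i)
    (l := g.status) hI.lin
    (fun i j hi hj hij => by
      have := hG.popper_index_unique (hf i (by omega)) (hij ▸ hf j (by omega))
      omega)
    (fun k hk => (hI.live_popper (hf k (by omega)) (hC.live (by omega) (by omega))).2)
    (fun k hk => stackSpec_drop_pop _ _)
  refine ⟨st, h1, ?_, ?_⟩
  · intro j t' hj1 hj2 he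
    have h4 := hf (j - u) (by omega)
    rw [Nat.add_sub_cancel' hj1, he] at h4
    rw [Option.some.inj h4]
    exact h2 (j - u) (by omega)
  · intro t' ht'
    refine h3 t' fun k hk h4 => ht' (u + k) (by omega) (by omega) ?_
    rw [← h4]
    exact hf k (by omega)

/-- The CAS of a combiner for pops. If it succeeds, the pops with sequence numbers from
`pushCountAtFreeze` on take effect. -/
theorem Inv.step_pfsCAS (hI : Inv asg s h g) {b i : ℕ} {top bot : Option ℕ}
    (hp : s.pc t = .pfsCAS b i top bot) : StepOK asg s h t (.pfsCAS b i top bot) := by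
  have hpc := hI.pcInv t
  rw [hp] at hpc
  obtain ⟨hC, l, hS1, hS2⟩ := hpc
  by_cases hcas : s.mem.stackTop = top
  swap
  · have hn : next (asg t) s.mem (.pfsCAS b i top bot) = (s.mem, .pfsReadTop b i) := by
      simp only [next, if_neg hcas]
    rw [StepOK, hn]
    exact ⟨g, hI.local hp hC (fun k b hb => Or.inl hb) (fun b hb => hb)⟩
  have hn : next (asg t) s.mem (.pfsCAS b i top bot) =
      ({ s.mem with stackTop := bot }, .pfsPublish b i top) := by
    simp only [next, if_pos hcas]
  rw [StepOK, hn]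
  subst hcas
  have hG := hI.glob
  -- published nodes do not change, so `stackTop` alone determines the contents of the stack
  obtain rfl : l = g.stack := hS1.unique hG.stack
  have hsnap := hC.snap_eq_none
  obtain ⟨st, hlin, hdone, hsame⟩ := hI.linearize_pops hC
  obtain ⟨hTt, hclosed, hiu, hiw⟩ := id hC
  let g' : Ghost V n K := { g with
    snap := Function.update g.snap b (some g.stack)
    status := st
    stack := g.stack.drop ((s.mem.batches b).popCountAtFreeze - i) }
  let m' : Mem V K P := { s.mem with stackTop := bot }
  have hsb : g'.snap b = some g.stack := Function.update_self _ _ _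
  have hsne : ∀ b', b' ≠ b → g'.snap b' = g.snap b' := fun b' hb => Function.update_of_ne hb _ _
  have hs_mono : ∀ b' l, g.snap b' = some l → g'.snap b' = some l := by
    intro b' l hl
    rw [hsne b' (by rintro rfl; rw [hsnap] at hl; cases hl)]
    exact hl
  have hs_none : ∀ b', g'.snap b' = none → g.snap b' = none := by
    intro b' hb
    cases hl : g.snap b' with
    | none => rfl
    | some l =>
      rw [hs_mono b' l hl] at hb
      cases hb
  have hother : ∀ t', (s.pc t').batch ≠ some (false, b) → st t' = g.status t' :=
    fun t' ht' => hsame t' fun j h1 h2 he => ht' (hI.live_popper he (hC.live h1 h2)).1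
  have hlive : ∀ b' i, PushLive m' g' b' i → PushLive s.mem g b' i :=
    fun b' i hl hc => ⟨(hl hc).1, (hl hc).2.1, hs_none b' (hl hc).2.2⟩
  have hlive' : ∀ b' i, PopLive m' g' b' i → PopLive s.mem g b' i :=
    fun b' i hl hc => ⟨(hl hc).1, (hl hc).2.1, hs_none b' (hl hc).2.2⟩
  refine ⟨g', hI.update (m' := m') (g' := g') hlin ?_ ?_ ?_ ?_ ?_ ?_ ?_ ?_⟩
  · refine { hG with
      snap_closed := fun b' hb => ?_
      applied := fun b' hb => ?_
      stack := hS2 }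
    · by_cases hbb : b' = b
      · subst hbb
        exact hclosed
      · rw [hsne b' hbb] at hb
        exact hG.snap_closed b' hb
    · obtain ⟨h1, h2⟩ := hG.applied b' hb
      refine ⟨fun h3 => h1 (hs_none b' h3), fun h3 => ?_⟩
      obtain ⟨l', hl', h4⟩ := h2 h3
      exact ⟨l', hs_mono b' l' hl', h4⟩
  · intro t' ht'
    refine
      { fresh := ?_
        status := fun hb => hother t' (by rw [hb]; simp)
        home := fun _ _ h => h
        absent := fun c b h => by cases c <;> exact h
        pushTicket := ?_
        popTicket := ?_
        pushers := fun _ _ _ h => h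
        slot := fun _ _ _ h => h
        closed := fun _ h => h
        pushFreeze := fun _ _ => rfl
        popFreeze := fun _ _ => rfl
        snap := hs_mono
        freezing := fun _ _ h => h
        pushCount := fun _ _ => le_rfl
        popCount := fun _ _ => le_rfl
        linking := fun _ _ _ _ _ _ _ _ => rfl
        value := fun x N hx => ⟨N, hx, rfl⟩
        chain := fun _ _ h => h
        sub := fun b' l' _ hl => hl }
    · intro hb c hc
      have hst := hother t' (by rw [hb]; simp)
      cases c with
      | push x =>
        obtain ⟨v, nx, h1, h2, h3, h4⟩ := hc
        exact ⟨v, nx, h1, h2, h3, hst.trans h4⟩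
      | pop => exact hst.trans hc
    · intro x b1 i1 hb1 hT
      have hst := hother t' (by rw [hb1]; simp)
      obtain ⟨v, h1, h2, h3, h4⟩ := hT
      by_cases hbb : b1 = b
      · subst hbb
        have hE : PushEffective m' g' b1 i1 ↔ PushEffective s.mem g b1 i1 := by
          constructor
          · rintro ⟨h5, h6, -⟩
            change i1 < (s.mem.batches b1).pushCountAtFreeze at h6
            exact ⟨h5, h6, Or.inl (by omega)⟩
          · rintro ⟨h5, h6, h7⟩
            exact ⟨h5, h6, h7.imp_right fun h8 => absurd hsnap h8⟩
        refine ⟨v, h1, ?_, ?_, ?_⟩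
        · rw [hE]
          exact fun h5 => hst.trans (h2 h5)
        · rw [hE]
          exact fun h5 => ⟨hst.trans (h3 h5).1, (h3 h5).2⟩
        · intro (h5 : i1 = (s.mem.batches b1).popCountAtFreeze)
            (h6 : i1 < (s.mem.batches b1).pushCountAtFreeze)
          omega
      · have hE : PushEffective m' g' b1 i1 ↔ PushEffective s.mem g b1 i1 := by
          rw [PushEffective, PushEffective, hsne b1 hbb]
          rfl
        refine ⟨v, h1, ?_, ?_, ?_⟩
        · rw [hE]
          exact fun h5 => hst.trans (h2 h5)
        · rw [hE]
          exact fun h5 => ⟨hst.trans (h3 h5).1, (h3 h5).2⟩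
        · rw [hsne b1 hbb]
          exact h4
    · intro b1 i1 hb1 hT
      by_cases hbb : b1 = b
      · subst hbb
        by_cases hin : (s.mem.batches b1).pushCountAtFreeze ≤ i1 ∧
            i1 < (s.mem.batches b1).popCountAtFreeze
        · refine ⟨hT.mem, fun _ _ h3 => absurd hin.1 (not_le.2 h3), ?_, ?_, ?_⟩
          · intro _ _ _ l hl
            rw [hsb] at hl
            injection hl with hl
            subst hl
            exact hdone i1 t' hin.1 hin.2 hT.mem
          · intro hE
            exact absurd ⟨hclosed, hin.2, Or.inr (by rw [hsb]; simp)⟩ hE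
          · intro (h5 : i1 = (s.mem.batches b1).pushCountAtFreeze) _
            have h6 := hT.mem
            rw [h5, ← hiu, hTt.mem] at h6
            exact absurd (Option.some.inj h6).symm ht'
        · have hst : st t' = g.status t' := by
            refine hsame t' fun j h5 h6 he => hin ?_
            rw [← hG.popper_index_unique he hT.mem]
            exact ⟨h5, h6⟩
          refine ⟨hT.mem, fun h1 h2 h3 e he => hst.trans (hT.eliminated h1 h2 h3 e he),
            fun _ h2 h3 => absurd ⟨h3, h2⟩ hin, ?_, fun h2 h3 => absurd ⟨h2.ge, h3⟩ hin⟩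
          intro hE
          refine hst.trans (hT.pending fun hE' => hE ⟨hE'.1, hE'.2.1, Or.inl ?_⟩)
          by_contra h8
          exact hin ⟨not_lt.1 h8, hE'.2.1⟩
      · have hst := hother t' (by rw [hb1]; simpa using hbb)
        refine ⟨hT.mem, fun h1 h2 h3 e he => hst.trans (hT.eliminated h1 h2 h3 e he), ?_, ?_, ?_⟩
        · rw [hsne b1 hbb]
          exact fun h1 h2 h3 l hl => hst.trans (hT.combined h1 h2 h3 l hl)
        · rw [PopEffective, hsne b1 hbb]
          exact fun hE => hst.trans (hT.pending hE)
        · rw [hsne b1 hbb]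
          exact hT.combiner
  · exact ⟨g.stack, hsb, hS1, hclosed, hdone i t hiu.ge hiw hTt.mem⟩
  · exact fun b' i e _ he hl => ⟨he, hlive b' i hl⟩
  · exact fun b' i e _ he hl => ⟨he, hlive' b' i hl⟩
  · intro b' i e ht he hl
    have h1 := hI.pushLive b' i e he (hlive b' i hl)
    rw [ht, hp] at h1
    cases h1
  · intro b' i he hl
    have h1 := hI.popLive b' i t he (hlive' b' i hl)
    rw [hp] at h1
    cases h1
    have h2 := (hl hclosed).2.2
    rw [hsb] at h2
    cases h2
  · intro b' hb
    cases hb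

end Combine

/-! ### Elimination -/

section Freeze

variable {asg : Fin n → Fin K} {s : Config V n K P} {h : List (Event (Fin n) (Op V) (Ret V))}
  {g : Ghost V n K} {t : Fin n}

/-- While a batch is not closed, all its operations are pending, and the pushes and pops that
eliminate each other can take effect. -/
theorem Inv.linearize_eliminated (hI : Inv asg s h g) {b : ℕ} (hopen : ¬ Closed s.mem b) :
    ∃ st, LinExec stackSpec [] h g.stack st ∧
      (∀ (j : ℕ) (e : Fin n × ℕ × V) (t' : Fin n), (g.pushers b)[j]? = some e →
        (g.poppers b)[j]? = some t' → j < (s.mem.batches b).pushCountAtFreeze →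
        j < (s.mem.batches b).popCountAtFreeze →
        st e.1 = .done .tt ∧ st t' = .done (.val e.2.2)) ∧
      ∀ t', (∀ j : ℕ, j < (s.mem.batches b).pushCountAtFreeze →
        j < (s.mem.batches b).popCountAtFreeze →
        (∀ e : Fin n × ℕ × V, (g.pushers b)[j]? = some e → e.1 ≠ t') ∧
          (g.poppers b)[j]? ≠ some t') → st t' = g.status t' := by
  have hG := hI.glob
  set w := (s.mem.batches b).popCountAtFreeze with hw
  set u := (s.mem.batches b).pushCountAtFreeze with hu
  by_cases hN : min u w = 0
  · refine ⟨g.status, hI.lin, fun j e t' _ _ h1 h2 => ?_, fun _ _ => rfl⟩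
    have := lt_min h1 h2
    omega
  obtain ⟨e0, he0⟩ := hG.exists_pusher (b := b) (i := 0) (by omega)
  let f : ℕ → Fin n × ℕ × V := fun k => ((g.pushers b)[k]?).getD e0
  let f' : ℕ → Fin n := fun k => ((g.poppers b)[k]?).getD e0.1
  have hf : ∀ k, k < min u w → (g.pushers b)[k]? = some (f k) := by
    intro k hk
    obtain ⟨e, he⟩ := hG.exists_pusher (lt_min_iff.1 hk).1
    simp only [f, he, Option.getD_some]
  have hf' : ∀ k, k < min u w → (g.poppers b)[k]? = some (f' k) := by
    intro k hk
    obtain ⟨e, he⟩ := hG.exists_popper (lt_min_iff.1 hk).2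
    simp only [f', he, Option.getD_some]
  obtain ⟨st, h1, h2, h3, h4⟩ := linearize_pairs (fun k => (f k).1) f' (fun k => (f k).2.2)
    (min u w) hI.lin
    (fun k hk => (hI.live_pusher (hf k hk) fun hc => absurd hc hopen).2.1)
    (fun k hk => (hI.live_popper (hf' k hk) fun hc => absurd hc hopen).2)
    (fun i j hi hj hij => hG.pusher_index_unique (hf i hi) (hf j hj) hij)
    (fun i j hi hj hij => hG.popper_index_unique (hf' i hi) (hij ▸ hf' j hj))
  refine ⟨st, h1, ?_, ?_⟩
  · intro j e t' he ht' hju hjw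
    have hj := lt_min hju hjw
    obtain rfl : e = f j := Option.some.inj (he.symm.trans (hf j hj))
    obtain rfl : t' = f' j := Option.some.inj (ht'.symm.trans (hf' j hj))
    exact ⟨h2 j hj, h3 j hj⟩
  · intro t' ht'
    refine h4 t' fun i hi => ?_
    obtain ⟨h5, h6⟩ := ht' i (lt_min_iff.1 hi).1 (lt_min_iff.1 hi).2
    refine ⟨h5 _ (hf i hi), fun h7 => h6 ?_⟩
    rw [← h7]
    exact hf' i hi

/-- The freezer replaces the batch of its aggregator, and the eliminated operations take
effect. -/
theorem Inv.step_freezeNewBatch (hI : Inv asg s h g) {c : Caller} {b i : ℕ}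
    (hp : s.pc t = .freezeNewBatch c b i) : StepOK asg s h t (.freezeNewBatch c b i) := by
  have hpc := hI.pcInv t
  rw [hp] at hpc
  obtain ⟨hTt, hagg, hdec⟩ := hpc
  have hG := hI.glob
  have hopen : ¬ Closed s.mem b := fun hc => hc.2 _ hagg
  have hsnap : g.snap b = none := by
    by_contra h1
    exact hopen (hG.snap_closed b h1)
  obtain ⟨st, hlin, hdone, hsame⟩ := hI.linearize_eliminated hopen
  let N := s.mem.numBatches
  let m' : Mem V K P := { s.mem with
    batches := Function.update s.mem.batches N (Batch.new P)
    numBatches := N + 1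
    agg := Function.update s.mem.agg (asg t) N }
  let g' : Ghost V n K := { g with
    home := Function.update g.home N (some (asg t))
    status := st }
  have hbN : b < N := hagg ▸ hG.agg_lt _
  have hbat : ∀ b', b' ≠ N → m'.batches b' = s.mem.batches b' :=
    fun b' hb => Function.update_of_ne hb _ _
  have hbatN : m'.batches N = Batch.new P := Function.update_self _ _ _
  have haggt : m'.agg (asg t) = N := Function.update_self _ _ _
  have haggo : ∀ a, a ≠ asg t → m'.agg a = s.mem.agg a :=
    fun a ha => Function.update_of_ne ha _ _
  have hopenN : ¬ Closed m' N := fun hc => hc.2 _ haggt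
  have hclosed : ∀ b', b' ≠ N → (Closed m' b' ↔ Closed s.mem b' ∨ b' = b) := by
    intro b' hb'
    constructor
    · rintro ⟨h1, h2⟩
      by_cases hbb : b' = b
      · exact Or.inr hbb
      refine Or.inl ⟨lt_of_le_of_ne (Nat.lt_succ_iff.1 h1) hb', fun a ha => ?_⟩
      by_cases hat : a = asg t
      · rw [hat, hagg] at ha
        exact hbb ha.symm
      · exact h2 a ((haggo a hat).trans ha)
    · rintro (⟨h1, h2⟩ | rfl)
      · refine ⟨h1.trans (Nat.lt_succ_self _), fun a ha => ?_⟩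
        by_cases hat : a = asg t
        · rw [hat, haggt] at ha
          exact hb' ha.symm
        · exact h2 a ((haggo a hat).symm.trans ha)
      · refine ⟨hbN.trans (Nat.lt_succ_self _), fun a ha => ?_⟩
        by_cases hat : a = asg t
        · rw [hat, haggt] at ha
          exact hb' ha.symm
        · rw [haggo a hat] at ha
          have h1 := hG.home_agg a
          have h2 := hG.home_agg (asg t)
          rw [ha] at h1
          rw [hagg, h1] at h2
          exact hat (Option.some.inj h2)
  have hclosed_mono : ∀ b', Closed s.mem b' → Closed m' b' :=
    fun b' hc => (hclosed b' hc.1.ne).2 (Or.inl hc)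
  have hhome : ∀ b' a, g.home b' = some a → g'.home b' = some a := by
    intro b' a hb'
    exact (Function.update_of_ne (hG.home_lt b' a hb').ne _ _).trans hb'
  have hpush : ∀ b' (j : ℕ) (e : Fin n × ℕ × V), (g.pushers b')[j]? = some e → b' ≠ N :=
    fun b' j e he => (hG.home_lt b' _ (hG.pushers_home b' e (List.mem_of_getElem? he))).ne
  have hpop : ∀ b' (j : ℕ) (t' : Fin n), (g.poppers b')[j]? = some t' → b' ≠ N :=
    fun b' j t' he => (hG.home_lt b' _ (hG.poppers_home b' t' (List.mem_of_getElem? he))).ne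
  have hslot : ∀ b' j x, (s.mem.batches b').slot j = some (some x) → b' ≠ N := by
    intro b' j x hx
    obtain ⟨e, he, -⟩ := hG.slot b' j x hx
    exact hpush b' j e he
  have hsnapN : ∀ b' l, g.snap b' = some l → b' ≠ N := by
    intro b' l hl
    exact (hG.snap_closed b' (by rw [hl]; simp)).1.ne
  -- the threads whose operations take effect are in batch `b`
  have hother : ∀ t', (∀ k, (s.pc t').batch ≠ some (k, b)) → st t' = g.status t' := by
    refine fun t' ht' => hsame t' fun j _ _ => ⟨fun e he h1 => ht' true ?_, fun he => ht' false ?_⟩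
    · rw [← h1]
      exact (hI.live_pusher he fun hc => absurd hc hopen).1
    · exact (hI.live_popper he fun hc => absurd hc hopen).1
  have hPush : ∀ t' x b1 i1, (s.pc t').batch = some (true, b1) → PushTicket s.mem g t' x b1 i1 →
      PushTicket m' g' t' x b1 i1 := by
    intro t' x b1 i1 hb1 hT
    obtain ⟨v, h1, h2, h3, h4⟩ := hT
    have hne := hpush _ _ _ h1
    by_cases hbb : b1 = b
    · subst hbb
      obtain ⟨h5, h6⟩ := h3 fun hE => hopen hE.1
      refine ⟨v, h1, ?_, ?_, fun _ _ => hsnap⟩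
      · rintro ⟨-, h7, h8⟩
        rw [hbat b1 hne] at h7 h8
        have h9 := h8.resolve_right fun h9 => h9 hsnap
        obtain ⟨t2, ht2⟩ := hG.exists_popper h9
        exact (hdone i1 _ t2 h1 ht2 h7 h9).1
      · intro hE
        refine ⟨(hsame t' fun j hj1 hj2 => ⟨fun e he h7 => hE ?_, fun he => ?_⟩).trans h5, h6⟩
        · obtain rfl := hG.pusher_index_unique he h1 h7
          refine ⟨(hclosed b1 hne).2 (Or.inr rfl), ?_, Or.inl ?_⟩ <;> rwa [hbat b1 hne]
        · have h7 := (hI.live_popper he fun hc => absurd hc hopen).2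
          rw [h5] at h7
          cases h7
    · have hst := hother t' fun k hk => by
        rw [hb1] at hk
        simp only [Option.some.injEq, Prod.mk.injEq] at hk
        exact hbb hk.2
      have hc : Closed m' b1 ↔ Closed s.mem b1 := by
        rw [hclosed b1 hne]
        exact or_iff_left hbb
      have hE : PushEffective m' g' b1 i1 ↔ PushEffective s.mem g b1 i1 := by
        rw [PushEffective, PushEffective, hc, hbat b1 hne]
      refine ⟨v, h1, ?_, ?_, ?_⟩
      · rw [hE]
        exact fun h5 => hst.trans (h2 h5)
      · rw [hE]
        exact fun h5 => ⟨hst.trans (h3 h5).1, (h3 h5).2⟩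
      · rw [hbat b1 hne]
        exact h4
  have hPop : ∀ t' b1 i1, (s.pc t').batch = some (false, b1) → PopTicket s.mem g t' b1 i1 →
      PopTicket m' g' t' b1 i1 := by
    intro t' b1 i1 hb1 hT
    have hne := hpop _ _ _ hT.mem
    by_cases hbb : b1 = b
    · subst hbb
      have h5 := hT.pending fun hE => hopen hE.1
      refine ⟨hT.mem, ?_, ?_, ?_, fun _ _ => hsnap⟩
      · intro _ h7 h8 e he
        rw [hbat b1 hne] at h7 h8
        exact (hdone i1 e t' he hT.mem h8 h7).2
      · intro _ _ _ l hl
        change g.snap b1 = some l at hl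
        rw [hsnap] at hl
        cases hl
      · intro hE
        refine (hsame t' fun j hj1 hj2 => ⟨fun e he h7 => ?_, fun he => hE ?_⟩).trans h5
        · have h8 := (hI.live_pusher he fun hc => absurd hc hopen).2.1
          rw [h7, h5] at h8
          cases h8
        · obtain rfl := hG.popper_index_unique he hT.mem
          refine ⟨(hclosed b1 hne).2 (Or.inr rfl), ?_, Or.inl ?_⟩ <;> rwa [hbat b1 hne]
    · have hst := hother t' fun k hk => by
        rw [hb1] at hk
        simp only [Option.some.injEq, Prod.mk.injEq] at hk
        exact hbb hk.2
      have hc : Closed m' b1 ↔ Closed s.mem b1 := by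
        rw [hclosed b1 hne]
        exact or_iff_left hbb
      refine ⟨hT.mem, ?_, ?_, ?_, ?_⟩
      · rw [hc, hbat b1 hne]
        exact fun h1 h2 h3 e he => hst.trans (hT.eliminated h1 h2 h3 e he)
      · rw [hc, hbat b1 hne]
        exact fun h1 h2 h3 l hl => hst.trans (hT.combined h1 h2 h3 l hl)
      · rw [PopEffective, hc, hbat b1 hne]
        exact fun hE => hst.trans (hT.pending hE)
      · rw [hbat b1 hne]
        exact hT.combiner
  have hlive : ∀ b' j, b' ≠ N → PushLive m' g' b' j → PushLive s.mem g b' j := by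
    intro b' j hb' hl hc
    have h1 := hl (hclosed_mono b' hc)
    rwa [hbat b' hb'] at h1
  have hlive' : ∀ b' j, b' ≠ N → PopLive m' g' b' j → PopLive s.mem g b' j := by
    intro b' j hb' hl hc
    have h1 := hl (hclosed_mono b' hc)
    rwa [hbat b' hb'] at h1
  refine ⟨g', hI.update (m' := m') (g' := g') hlin ?_ ?_ ?_ ?_ ?_ ?_ ?_ ?_⟩
  · have hnewPush : g.pushers N = [] := by
      rw [List.eq_nil_iff_forall_not_mem]
      intro e he
      exact absurd (hG.home_lt N _ (hG.pushers_home N e he)) (lt_irrefl _)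
    have hnewPop : g.poppers N = [] := by
      rw [List.eq_nil_iff_forall_not_mem]
      intro e he
      exact absurd (hG.home_lt N _ (hG.poppers_home N e he)) (lt_irrefl _)
    refine { hG with
      agg_lt := fun a => ?_
      home_agg := fun a => ?_
      home_lt := fun b' a hb' => ?_
      pushCount := fun b' => ?_
      popCount := fun b' => ?_
      pushFreeze_le := fun b' => ?_
      popFreeze_le := fun b' => ?_
      pushers_home := fun b' e he => hhome _ _ (hG.pushers_home b' e he)
      poppers_home := fun b' e he => hhome _ _ (hG.poppers_home b' e he)
      slot := fun b' j x hx => ?_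
      closed_decided := fun b' hc => ?_
      snap_closed := fun b' hb' => hclosed_mono b' (hG.snap_closed b' hb')
      applied := fun b' hb' => ?_ }
    · by_cases ha : a = asg t
      · rw [ha, haggt]
        exact Nat.lt_succ_self _
      · rw [haggo a ha]
        exact (hG.agg_lt a).trans (Nat.lt_succ_self _)
    · by_cases ha : a = asg t
      · rw [ha, haggt]
        exact Function.update_self _ _ _
      · rw [haggo a ha]
        exact hhome _ _ (hG.home_agg a)
    · by_cases hbN' : b' = N
      · subst hbN'
        exact Nat.lt_succ_self _
      · have h1 : g.home b' = some a := (Function.update_of_ne hbN' _ _).symm.trans hb'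
        exact (hG.home_lt b' a h1).trans (Nat.lt_succ_self _)
    · by_cases hbN' : b' = N
      · rw [hbN', hbatN]
        simp [g', hnewPush, Batch.new]
      · rw [hbat b' hbN']
        exact hG.pushCount b'
    · by_cases hbN' : b' = N
      · rw [hbN', hbatN]
        simp [g', hnewPop, Batch.new]
      · rw [hbat b' hbN']
        exact hG.popCount b'
    · by_cases hbN' : b' = N
      · rw [hbN', hbatN]
        exact le_rfl
      · rw [hbat b' hbN']
        exact hG.pushFreeze_le b'
    · by_cases hbN' : b' = N
      · rw [hbN', hbatN]
        exact le_rfl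
      · rw [hbat b' hbN']
        exact hG.popFreeze_le b'
    · by_cases hbN' : b' = N
      · rw [hbN', hbatN] at hx
        simp [Batch.slot, Batch.new] at hx
      · rw [hbat b' hbN'] at hx
        exact hG.slot b' j x hx
    · have hbN' : b' ≠ N := by
        rintro rfl
        exact hopenN hc
      rw [hbat b' hbN']
      rcases (hclosed b' hbN').1 hc with hc | rfl
      · exact hG.closed_decided b' hc
      · exact hdec
    · by_cases hbN' : b' = N
      · rw [hbN', hbatN] at hb'
        cases hb'
      · rw [hbat b' hbN'] at hb' ⊢
        exact hG.applied b' hb'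
  · intro t' ht'
    have hfree : ∀ b', (s.pc t').freezing = some b' → b' ≠ N := by
      intro b' hb'
      rw [← ((hI.pcInv t').freezing hb').1]
      exact (hG.agg_lt _).ne
    refine
      { fresh := ?_
        status := fun hb => hother t' (by rw [hb]; simp)
        home := hhome
        absent := fun c b h => by cases c <;> exact h
        pushTicket := hPush t'
        popTicket := hPop t'
        pushers := fun _ _ _ h => h
        slot := fun b' j x hx => by rw [hbat b' (hslot b' j x hx)]; exact hx
        closed := hclosed_mono
        pushFreeze := fun b' hc => by rw [hbat b' hc.1.ne]
        popFreeze := fun b' hc => by rw [hbat b' hc.1.ne]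
        snap := fun _ _ h => h
        freezing := ?_
        pushCount := fun b' hb' => by rw [hbat b' (hfree b' hb')]
        popCount := fun b' hb' => by rw [hbat b' (hfree b' hb')]
        linking := fun _ _ _ _ _ _ _ _ => rfl
        value := fun x N hx => ⟨N, hx, rfl⟩
        chain := fun _ _ h => h
        sub := fun b' l' hl h => by rw [hbat b' (hsnapN b' l' hl)]; exact h }
    · intro hb c hc
      have hst := hother t' (by rw [hb]; simp)
      cases c with
      | push x =>
        obtain ⟨v, nx, h1, h2, h3, h4⟩ := hc
        exact ⟨v, nx, h1, h2, h3, hst.trans h4⟩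
      | pop => exact hst.trans hc
    · intro b' hb' hF
      refine ⟨?_, by rw [hbat b' (hfree b' hb')]; exact hF.2⟩
      rw [haggo _ ?_]
      · exact hF.1
      · intro ha
        have h1 := hF.1
        rw [ha, hagg] at h1
        subst h1
        exact ht' (hI.freezer t' t b hb' (by rw [hp]; rfl))
  · have hbne : b ≠ N := hbN.ne
    refine ⟨?_, (hclosed b hbne).2 (Or.inr rfl)⟩
    cases c with
    | push x =>
      refine ⟨hPush t x b i (by rw [hp]; rfl) hTt.1, ?_⟩
      rw [hbat b hbne]
      exact hTt.2
    | pop => exact hPop t b i (by rw [hp]; rfl) hTt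
  · exact fun b' i e _ he hl => ⟨he, hlive b' i (hpush _ _ _ he) hl⟩
  · exact fun b' i e _ he hl => ⟨he, hlive' b' i (hpop _ _ _ he) hl⟩
  · intro b' i e ht he hl
    have h1 := hI.pushLive b' i e he (hlive b' i (hpush _ _ _ he) hl)
    rw [ht, hp] at h1
    exact h1
  · intro b' i he hl
    have h1 := hI.popLive b' i t he (hlive' b' i (hpop _ _ _ he) hl)
    rw [hp] at h1
    exact h1
  · intro b' hb
    cases hb

end Freeze

/-! ### Executions -/

section Execution

variable {asg : Fin n → Fin K} {s : Config V n K P} {h : List (Event (Fin n) (Op V) (Ret V))}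

theorem Inv.start (asg : Fin n → Fin K) : ∃ g, Inv asg (Config.start V n K P) [] g := by
  refine ⟨⟨fun b => if hb : b < K then some ⟨b, hb⟩ else none, fun _ => none, ∅, fun _ => [],
    fun _ => [], fun _ => none, fun _ => .idle, []⟩, ?_⟩
  refine ⟨.start, ?_, fun _ => rfl, ?_, ?_, ?_⟩
  · constructor <;> simp [Config.start, Mem.start, Batch.new, Batch.slot, Closed, Chain]
    exact fun b hb => ⟨⟨b, hb⟩, rfl⟩
  · intro b i e he
    simp at he
  · intro b i t he
    simp at he
  · intro t t' b hb
    cases hb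

theorem Inv.step {g : Ghost V n K} (hI : Inv asg s h g)
    (hP : ∀ a : Fin K, (Finset.univ.filter fun t => asg t = a).card ≤ P) (t : Fin n) :
    StepOK asg s h t (s.pc t) := by
  have hpc := hI.pcInv t
  cases hp : s.pc t <;> rw [hp] at hpc
  case idle => exact ⟨g, hI.local hp hpc (fun k b hb => Or.inl hb) (fun b hb => hb)⟩
  case ret => exact ⟨g, hI.local hp hpc (fun k b hb => Or.inl hb) (fun b hb => hb)⟩
  case fault => exact hpc.elim
  case pushAlloc => exact hI.step_pushAlloc hp
  case getBatch => exact hI.step_getBatch hp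
  case announce c b =>
    cases c with
    | push x => exact hI.step_announce_push hp
    | pop => exact hI.step_announce_pop hp
  case pushWrite => exact hI.step_pushWrite hP hp
  case freezerTest => exact hI.step_freezerTest hp
  case freezeReadPop =>
    exact ⟨g, hI.local hp ⟨hpc.1, hpc.2, le_rfl⟩ (fun k b hb => Or.inl hb) (fun b hb => hb)⟩
  case freezeWritePop => exact hI.step_freezeWritePop hp
  case freezeReadPush =>
    exact ⟨g, hI.local hp ⟨hpc.1, hpc.2, le_rfl⟩ (fun k b hb => Or.inl hb) (fun b hb => hb)⟩
  case freezeWritePush => exact hI.step_freezeWritePush hp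
  case freezeNewBatch => exact hI.step_freezeNewBatch hp
  case freezeWait => exact hI.step_freezeWait hp
  case inclusionTest => exact hI.step_inclusionTest hp
  case pushElimTest => exact hI.step_pushElimTest hp
  case pushCombinerTest => exact hI.step_pushCombinerTest hp
  case pushApplied => exact hI.step_pushApplied hp
  case pushWaitApplied => exact hI.step_pushWaitApplied hp
  case ptsInit => exact hI.step_ptsInit hp
  case ptsLoop => exact hI.step_ptsLoop hp
  case ptsWait => exact hI.step_ptsWait hP hp
  case ptsRead => exact hI.step_ptsRead hp
  case ptsLink => exact hI.step_ptsLink hp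
  case ptsReadTop =>
    exact ⟨g, hI.local hp hpc (fun k b hb => Or.inl hb) (fun b hb => hb)⟩
  case ptsSetBot => exact hI.step_ptsSetBot hp
  case ptsCAS => exact hI.step_ptsCAS hp
  case popElimTest => exact hI.step_popElimTest hp
  case popElimWait => exact hI.step_popElimWait hP hp
  case popElimRead => exact hI.step_popElimRead hp
  case popElimValue => exact hI.step_popElimValue hp
  case popCombinerTest => exact hI.step_popCombinerTest hp
  case popApplied => exact hI.step_popApplied hp
  case popWaitApplied => exact hI.step_popWaitApplied hp
  case pfsReadTop b i =>
    refine ⟨g, hI.local hp ⟨hpc, le_rfl, hpc.2.2.2.le, g.stack, hI.glob.stack, ?_⟩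
      (fun k b hb => Or.inl hb) (fun b hb => hb)⟩
    rw [Nat.sub_self]
    exact hI.glob.stack
  case pfsLoop => exact hI.step_pfsLoop hp
  case pfsNext => exact hI.step_pfsNext hp
  case pfsCAS => exact hI.step_pfsCAS hp
  case pfsPublish => exact hI.step_pfsPublish hp
  case gvArg =>
    obtain ⟨l, h1, h2, h3, h4⟩ := hpc
    exact ⟨g, hI.local hp ⟨l, h1, h2, h4⟩ (fun k b hb => Or.inl hb) (fun b hb => hb)⟩
  case gvInit =>
    obtain ⟨l, h1, h2, h3⟩ := hpc
    exact ⟨g, hI.local hp ⟨l, h2, h3⟩ (fun k b hb => Or.inl hb) (fun b hb => hb)⟩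
  case gvLoop => exact hI.step_gvLoop hp
  case peekTop => exact hI.step_peekTop hp
  case peekValue => exact hI.step_peekValue hp

theorem Execution.exists_inv
    (hP : ∀ a : Fin K, (Finset.univ.filter fun t => asg t = a).card ≤ P)
    (hE : Execution asg s h) : ∃ g, Inv asg s h g := by
  induction hE with
  | start => exact Inv.start asg
  | invoke t o _ hp ih =>
    obtain ⟨g, hI⟩ := ih
    exact hI.invoke o hp
  | step t _ ih =>
    obtain ⟨g, hI⟩ := ih
    exact hI.step hP t
  | respond t r _ hp ih =>
    obtain ⟨g, hI⟩ := ih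
    exact hI.respond r hp

end Execution

end SEC

theorem mainTheorem1 {V : Type*} (n K P : ℕ) (asg : Fin n → Fin K)
    (hP : ∀ a : Fin K, (Finset.univ.filter fun t => asg t = a).card ≤ P)
    (s : SEC.Config V n K P) (h : List (ConcObj.Event (Fin n) (SEC.Op V) (SEC.Ret V)))
    (hE : SEC.Execution asg s h) :
    ConcObj.Linearizable SEC.stackSpec [] h ∧ ∀ t : Fin n, s.pc t ≠ SEC.PC.fault := by
  obtain ⟨g, hI⟩ := hE.exists_inv hP
  refine ⟨hI.lin.linearizable, fun t ht => ?_⟩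
  have hpc := hI.pcInv t
  rw [ht] at hpc
  exact hpc
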